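/- Let $r,n\ge 1$ and let $q,q_1,\dots,q_r\in\mathbb{C}$ have absolute value $1$. Let $\mathcal{H}$ be the Hecke algebra of $G(r,1,n)$ over $\mathbb{C}$ with these parameters (the Ariki–Koike algebra), i.e. the algebra generated by $T_0,\dots,T_{n-1}$ with the relations $(T_0-q_1)\cdots(T_0-q_r)=0$, $T_0T_1T_0T_1=T_1T_0T_1T_0$, $(T_i+1)(T_i-q)=0$ for $1\le i\le n-1$, $T_iT_{i+1}T_i=T_{i+1}T_iT_{i+1}$ for $1\le i\le n-2$, and $T_iT_j=T_jT_i$ for $0\le i\le j-2\le n-3$. Let $*$ be the $\mathbb{C}$-linear anti-involution of $\mathcal{H}$ fixing every $T_i$, and let $\sigma$ be the $\mathbb{C}$-semilinear ring involution of $\mathcal{H}$ (with $\sigma(ah)=\bar a\,\sigma(h)$ for $a\in\mathbb{C}$) such that $\sigma(T_i)=T_i^{-1}$ for all $i$. For $w\in\mathfrak{S}_n$ (acting on $\{1,\dots,n\}$ from the right) with a reduced expression $w=s_{i_1}\cdots s_{i_k}$ in the transpositions $s_i=(i,i+1)$, put $T_w=T_{i_1}\cdots T_{i_k}$. For a multipartition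 $\mu=(\mu^1,\dots,\mu^r)$ of $n$ let $\mathbf{t}^\mu$ be the tableau filled with $1,\dots,n$ in order along the rows of $\mu^1,\dots,\mu^r$, let $\mathfrak{S}_\mu$ be its row stabilizer, and for a standard $\mu$-tableau $\mathfrak{s}$ let $d(\mathfrak{s})$ be the permutation with $\mathbf{t}^\mu d(\mathfrak{s})=\mathfrak{s}$. Put $x_\mu=\sum_{w\in\mathfrak{S}_\mu}T_w$, $L_m=q^{1-m}T_{m-1}\cdots T_1T_0T_1\cdots T_{m-1}$, $a_k=\sum_{j<k}|\mu^j|$, $$m_\mu=\Big(\prod_{k=1}^r\prod_{m=1}^{a_k}(L_m-q_k)\Big)x_\mu,\qquad m_{\mathfrak{s}\mathfrak{t}}=T_{d(\mathfrak{s})}^*\,m_\mu\,T_{d(\mathfrak{t})}.$$ Write $\mu\rhd\lambda$ if $\mu\neq\lambda$ and $\sum_{i<k}|\mu^i|+\sum_{i\le j}\mu^k_i\ge\sum_{i<k}|\lambda^i|+\sum_{i\le j}\lambda^k_i$ for all $1\le k\le r$ and $j\ge1$. Let $\bar N^\lambda$ be the two-sided ideal of $\mathcal{H}$ generated by the $m_{\mathfrak{s}\mathfrak{t}}$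 with $\mathfrak{s},\mathfrak{t}$ standard $\mu$-tableaux, $\mu\rhd\lambda$ (it is also their linear span). Let $z_\lambda$ be the class of $m_\lambda$ in $\mathcal{H}/\bar N^\lambda$, and let $S^\lambda=\mathcal{H}z_\lambda$ be the Specht module. The Dipper–James–Mathas bilinear form $\langle\cdot,\cdot\rangle$ on $S^\lambda$ is given by $m_\lambda h^*h'z_\lambda=\langle hz_\lambda,h'z_\lambda\rangle z_\lambda$ for $h,h'\in\mathcal{H}$. Let $D^\lambda=S^\lambda/\operatorname{rad}\langle\cdot,\cdot\rangle$, where the radical is the submodule of all $v\in S^\lambda$ with $m_\lambda hv=0$ for all $h\in\mathcal{H}$. **Proposition.** Let $\lambda$ be a multipartition of $n$ with $D^\lambda\ne0$. Then $D^\lambda$ is an irreducible $\mathcal{H}$-module, and it carries a nondegenerate Hermitian form $(\cdot,\cdot)$ (linear in the first variable, conjugate-linear in the second, $(v',v)=\overline{(v,v')}$) such that $$(Tv,v')=(v,\sigma(T^*)v')\qquad\text{for all }v,v'\in D^\lambda,\ T\in\mathcal{H}.$$ In particular the form is invariant under the braid group: $(Tv,v')=(v,T^{-1}v')$ for every $T$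 in the group generated by $T_0,\dots,T_{n-1}$. Moreover, the form arises as follows. The bilinear form $\langle\cdot,\cdot\rangle$ on $S^\lambda$ exists, is symmetric, satisfies $\langle Tv,v'\rangle=\langle v,T^*v'\rangle$, and its radical $\{v:\langle v,w\rangle=0\ \text{for all }w\in S^\lambda\}$ is the submodule named above; $\sigma$ induces a semilinear involution, again denoted $\sigma$, of $S^\lambda\subseteq\mathcal{H}/\bar N^\lambda$ with $\sigma(Tv)=\sigma(T)\sigma(v)$; and there is a complex number $\alpha$ with $|\alpha|=1$ such that $(\bar v,\bar w)=\alpha\langle v,\sigma(w)\rangle$ for all $v,w\in S^\lambda$ with classes $\bar v,\bar w$ in $D^\lambda$. -/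

import Mathlib

namespace ArikiKoike

/-! ### The Hecke algebra of `G(r,1,n)` -/

/-- The defining relations of the Hecke algebra of `G(r,1,n)` with parameters `q` and
`Q 0, …, Q (r-1)` (standing for `q₁, …, q_r`), on generators indexed by `0, …, n-1`. -/
inductive HeckeRel (n : ℕ) (q : ℂ) {r : ℕ} (Q : Fin r → ℂ) :
    FreeAlgebra ℂ (Fin n) → FreeAlgebra ℂ (Fin n) → Prop
  | cyclotomic (i : Fin n) (hi : i.val = 0) :
      HeckeRel n q Q
        (List.ofFn fun k : Fin r => FreeAlgebra.ι ℂ i - algebraMap ℂ _ (Q k)).prod 0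
  | braidFour (i j : Fin n) (hi : i.val = 0) (hj : j.val = 1) :
      HeckeRel n q Q
        (FreeAlgebra.ι ℂ i * FreeAlgebra.ι ℂ j * FreeAlgebra.ι ℂ i * FreeAlgebra.ι ℂ j)
        (FreeAlgebra.ι ℂ j * FreeAlgebra.ι ℂ i * FreeAlgebra.ι ℂ j * FreeAlgebra.ι ℂ i)
  | quadratic (i : Fin n) (hi : 1 ≤ i.val) :
      HeckeRel n q Q
        ((FreeAlgebra.ι ℂ i + 1) * (FreeAlgebra.ι ℂ i - algebraMap ℂ _ q)) 0
  | braidThree (i j : Fin n) (hi : 1 ≤ i.val) (hj : j.val = i.val + 1) :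
      HeckeRel n q Q
        (FreeAlgebra.ι ℂ i * FreeAlgebra.ι ℂ j * FreeAlgebra.ι ℂ i)
        (FreeAlgebra.ι ℂ j * FreeAlgebra.ι ℂ i * FreeAlgebra.ι ℂ j)
  | comm (i j : Fin n) (hij : i.val + 2 ≤ j.val) :
      HeckeRel n q Q
        (FreeAlgebra.ι ℂ i * FreeAlgebra.ι ℂ j) (FreeAlgebra.ι ℂ j * FreeAlgebra.ι ℂ i)

/-- The Hecke algebra (Ariki–Koike algebra) of `G(r,1,n)` over `ℂ`. -/
def HeckeAlg (n : ℕ) (q : ℂ) {r : ℕ} (Q : Fin r → ℂ) : Type :=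
  RingQuot (HeckeRel n q Q)

noncomputable instance (n : ℕ) (q : ℂ) {r : ℕ} (Q : Fin r → ℂ) : Ring (HeckeAlg n q Q) :=
  inferInstanceAs (Ring (RingQuot (HeckeRel n q Q)))

noncomputable instance (n : ℕ) (q : ℂ) {r : ℕ} (Q : Fin r → ℂ) :
    Algebra ℂ (HeckeAlg n q Q) :=
  inferInstanceAs (Algebra ℂ (RingQuot (HeckeRel n q Q)))

/-- The quotient map from the free algebra. -/
noncomputable def toHecke (n : ℕ) (q : ℂ) {r : ℕ} (Q : Fin r → ℂ) :
    FreeAlgebra ℂ (Fin n) →ₐ[ℂ] HeckeAlg n q Q :=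
  RingQuot.mkAlgHom ℂ (HeckeRel n q Q)

section Algebra

variable {n r : ℕ} (q : ℂ) (Q : Fin r → ℂ)

/-- The generators `T₀, …, T_{n-1}`. -/
noncomputable def T (i : Fin n) : HeckeAlg n q Q := toHecke n q Q (FreeAlgebra.ι ℂ i)

variable {q Q}

theorem toHecke_rel {x y : FreeAlgebra ℂ (Fin n)} (h : HeckeRel n q Q x y) :
    toHecke n q Q x = toHecke n q Q y :=
  RingQuot.mkAlgHom_rel ℂ h

theorem T_cyclotomic (i : Fin n) (hi : i.val = 0) :
    ((List.ofFn Q).map fun c => T q Q i - algebraMap ℂ _ c).prod = 0 := by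
  have h := toHecke_rel (HeckeRel.cyclotomic (q := q) (Q := Q) i hi)
  rw [map_list_prod, List.map_ofFn, map_zero] at h
  rw [List.map_ofFn, ← h]
  congr 2
  funext k
  simp [T]

theorem T_braidFour (i j : Fin n) (hi : i.val = 0) (hj : j.val = 1) :
    T q Q i * T q Q j * T q Q i * T q Q j = T q Q j * T q Q i * T q Q j * T q Q i := by
  simpa [T] using toHecke_rel (HeckeRel.braidFour (q := q) (Q := Q) i j hi hj)

theorem T_quadratic (i : Fin n) (hi : 1 ≤ i.val) :
    (T q Q i + 1) * (T q Q i - algebraMap ℂ _ q) = 0 := by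
  simpa [T] using toHecke_rel (HeckeRel.quadratic (q := q) (Q := Q) i hi)

theorem T_braidThree (i j : Fin n) (hi : 1 ≤ i.val) (hj : j.val = i.val + 1) :
    T q Q i * T q Q j * T q Q i = T q Q j * T q Q i * T q Q j := by
  simpa [T] using toHecke_rel (HeckeRel.braidThree (q := q) (Q := Q) i j hi hj)

theorem T_comm (i j : Fin n) (hij : i.val + 2 ≤ j.val) :
    T q Q i * T q Q j = T q Q j * T q Q i := by
  simpa [T] using toHecke_rel (HeckeRel.comm (q := q) (Q := Q) i j hij)

/-! ### Invertibility of the generators -/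

theorem list_prod_eq_aeval {A : Type*} [Ring A] [Algebra ℂ A] (x : A) (l : List ℂ) :
    (l.map fun c => x - algebraMap ℂ A c).prod =
      Polynomial.aeval x (l.map fun c => Polynomial.X - Polynomial.C c).prod := by
  rw [map_list_prod, List.map_map]
  congr 2
  funext c
  simp

theorem list_prod_inv {A : Type*} [Ring A] [Algebra ℂ A] (x : Aˣ) (l : List ℂ)
    (hl : ∀ c ∈ l, c ≠ 0) : ∃ (s : ℂ) (y : A),
      (l.map fun c => (↑x⁻¹ : A) - algebraMap ℂ A c⁻¹).prod =
        s • (y * (l.map fun c => (x : A) - algebraMap ℂ A c).prod) := by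
  induction l with
  | nil => exact ⟨1, 1, by simp⟩
  | cons a l ih =>
    obtain ⟨s, y, hy⟩ := ih fun c hc => hl c (List.mem_cons_of_mem _ hc)
    have ha : a ≠ 0 := hl a List.mem_cons_self
    have hcomm : Commute (l.map fun c => (x : A) - algebraMap ℂ A c).prod
        ((x : A) - algebraMap ℂ A a) := by
      rw [list_prod_eq_aeval, show (x : A) - algebraMap ℂ A a =
        Polynomial.aeval (x : A) (Polynomial.X - Polynomial.C a) by simp]
      exact (Commute.all _ _).map (Polynomial.aeval (x : A))
    have hcomm' : Commute (↑x⁻¹ : A) (l.map fun c => (↑x⁻¹ : A) - algebraMap ℂ A c⁻¹).prod := by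
      have : (l.map fun c => (↑x⁻¹ : A) - algebraMap ℂ A c⁻¹) =
          ((l.map fun c => c⁻¹).map fun c => (↑x⁻¹ : A) - algebraMap ℂ A c) := by simp
      rw [this, list_prod_eq_aeval]
      conv_lhs => rw [← Polynomial.aeval_X (R := ℂ) (↑x⁻¹ : A)]
      exact (Commute.all _ _).map (Polynomial.aeval (↑x⁻¹ : A))
    have h1 : (↑x⁻¹ : A) - algebraMap ℂ A a⁻¹ =
        (-a⁻¹) • (((x : A) - algebraMap ℂ A a) * (↑x⁻¹ : A)) := by
      rw [sub_mul, Units.mul_inv, smul_sub, ← Algebra.smul_def, smul_smul]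
      simp [ha, Algebra.algebraMap_eq_smul_one]
      abel
    have h2 : Commute (↑x⁻¹ : A) ((l.map fun c => (x : A) - algebraMap ℂ A c).prod *
        ((x : A) - algebraMap ℂ A a)) := by
      have : Commute (x : A) ((l.map fun c => (x : A) - algebraMap ℂ A c).prod *
          ((x : A) - algebraMap ℂ A a)) := by
        rw [list_prod_eq_aeval, show (x : A) - algebraMap ℂ A a =
          Polynomial.aeval (x : A) (Polynomial.X - Polynomial.C a) by simp, ← map_mul]
        conv_lhs => rw [← Polynomial.aeval_X (R := ℂ) (x : A)]
        exact (Commute.all _ _).map (Polynomial.aeval (x : A))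
      exact this.units_inv_left
    refine ⟨s * (-a⁻¹), y * (↑x⁻¹ : A), ?_⟩
    rw [List.map_cons, List.prod_cons, List.map_cons, List.prod_cons, sub_mul, hcomm'.eq,
      Algebra.commutes, ← mul_sub, h1, hy, mul_smul_comm, smul_mul_assoc, smul_smul,
      mul_comm s, ← hcomm.eq, mul_assoc y (↑x⁻¹ : A), h2.eq]
    simp only [mul_assoc]

theorem isUnit_of_prod_eq_zero {A : Type*} [Ring A] [Algebra ℂ A] (x : A) (l : List ℂ)
    (hl : ∀ c ∈ l, c ≠ 0) (h : (l.map fun c => x - algebraMap ℂ A c).prod = 0) : IsUnit x := by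
  set p : Polynomial ℂ := (l.map fun c => Polynomial.X - Polynomial.C c).prod with hp
  have hx : Polynomial.aeval x p = 0 := by rw [hp, ← list_prod_eq_aeval, h]
  have h0 : p.coeff 0 ≠ 0 := by
    rw [Polynomial.coeff_zero_eq_eval_zero, hp, Polynomial.eval_list_prod]
    rw [List.map_map]
    refine List.prod_ne_zero ?_
    simp only [List.mem_map, Function.comp, not_exists, not_and]
    intro c hc h'
    simp at h'
    exact hl c hc h'
  have h1 : Polynomial.aeval x p.divX * x = algebraMap ℂ A (-(p.coeff 0)) := by
    have := congrArg (Polynomial.aeval x) (Polynomial.divX_mul_X_add p)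
    rw [hx] at this
    simp only [map_add, map_mul, Polynomial.aeval_X, Polynomial.aeval_C] at this
    rw [map_neg]
    exact eq_neg_of_add_eq_zero_left this
  have h2 : x * Polynomial.aeval x p.divX = algebraMap ℂ A (-(p.coeff 0)) := by
    have := congrArg (Polynomial.aeval x) (mul_comm Polynomial.X p.divX)
    simp only [map_mul, Polynomial.aeval_X] at this
    rw [this, h1]
  have hu : IsUnit (algebraMap ℂ A (-(p.coeff 0))) :=
    (isUnit_iff_ne_zero.2 (neg_ne_zero.2 h0)).map (algebraMap ℂ A)
  exact (Commute.isUnit_mul_iff (h2.trans h1.symm)).1 (h2 ▸ hu) |>.1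

theorem isUnit_T (hq : ‖q‖ = 1) (hQ : ∀ k, ‖Q k‖ = 1) (i : Fin n) : IsUnit (T q Q i) := by
  have hq0 : q ≠ 0 := fun h => by simp [h] at hq
  rcases Nat.eq_zero_or_pos i.val with hi | hi
  · refine isUnit_of_prod_eq_zero _ (List.ofFn Q) ?_ (T_cyclotomic i hi)
    intro c hc
    obtain ⟨k, rfl⟩ := (List.mem_ofFn' _ _).1 hc
    intro h
    have := hQ k
    simp [h] at this
  · refine isUnit_of_prod_eq_zero _ [-1, q] (by simp [hq0]) ?_
    simpa using T_quadratic (q := q) (Q := Q) i hi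

/-- The generators as units of the Hecke algebra. -/
noncomputable def Tunit (hq : ‖q‖ = 1) (hQ : ∀ k, ‖Q k‖ = 1) (i : Fin n) :
    (HeckeAlg n q Q)ˣ :=
  (isUnit_T hq hQ i).unit

@[simp]
theorem val_Tunit (hq : ‖q‖ = 1) (hQ : ∀ k, ‖Q k‖ = 1) (i : Fin n) :
    (Tunit hq hQ i : HeckeAlg n q Q) = T q Q i := rfl

/-! ### The anti-involution and the semilinear involution -/

/-- The anti-involution `*` as an algebra map to the opposite algebra. -/
noncomputable def antiHom (n : ℕ) (q : ℂ) {r : ℕ} (Q : Fin r → ℂ) :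
    HeckeAlg n q Q →ₐ[ℂ] (HeckeAlg n q Q)ᵐᵒᵖ :=
  RingQuot.liftAlgHom ℂ (s := HeckeRel n q Q)
    ⟨FreeAlgebra.lift ℂ fun i => MulOpposite.op (T q Q i), by
      intro x y h
      induction h with
      | cyclotomic i hi =>
        have h : FreeAlgebra.lift ℂ (fun i => MulOpposite.op (T q Q i)) ∘
            (fun k : Fin r => FreeAlgebra.ι ℂ i - algebraMap ℂ _ (Q k)) =
            (fun c => MulOpposite.op (T q Q i - algebraMap ℂ _ c)) ∘ Q := by
          funext k
          simp
        rw [map_list_prod, List.map_ofFn, map_zero, h, ← MulOpposite.unop_eq_zero_iff,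
          MulOpposite.unop_list_prod, ← List.map_ofFn, List.map_map, ← List.map_reverse]
        change ((List.ofFn Q).reverse.map fun c => T q Q i - algebraMap ℂ _ c).prod = 0
        rw [list_prod_eq_aeval, List.map_reverse, List.prod_reverse, ← list_prod_eq_aeval,
          T_cyclotomic i hi]
      | braidFour i j hi hj =>
        simp only [map_mul, FreeAlgebra.lift_ι_apply, ← MulOpposite.op_mul, ← mul_assoc]
        rw [T_braidFour i j hi hj]
      | quadratic i hi =>
        have h := T_quadratic (q := q) (Q := Q) i hi
        have h' : (T q Q i - algebraMap ℂ _ q) * (T q Q i + 1) = 0 := by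
          rw [← h, sub_mul, mul_sub, ← Algebra.commutes q (T q Q i + 1)]
          noncomm_ring
        simp only [map_mul, map_add, map_sub, map_one, map_zero, FreeAlgebra.lift_ι_apply,
          AlgHom.commutes, MulOpposite.algebraMap_apply]
        rw [← MulOpposite.op_one, ← MulOpposite.op_add, ← MulOpposite.op_sub,
          ← MulOpposite.op_mul, h', MulOpposite.op_zero]
      | braidThree i j hi hj =>
        simp only [map_mul, FreeAlgebra.lift_ι_apply, ← MulOpposite.op_mul, ← mul_assoc]
        rw [T_braidThree i j hi hj]
      | comm i j hij =>
        simp only [map_mul, FreeAlgebra.lift_ι_apply, ← MulOpposite.op_mul]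
        rw [T_comm i j hij]⟩

/-- The `ℂ`-linear anti-involution `*` of the Hecke algebra, fixing every generator. -/
noncomputable def anti (h : HeckeAlg n q Q) : HeckeAlg n q Q :=
  MulOpposite.unop (antiHom n q Q h)

theorem anti_T (i : Fin n) : anti (T q Q i) = T q Q i := by
  have h : antiHom n q Q (T q Q i) = MulOpposite.op (T q Q i) :=
    (RingQuot.liftAlgHom_mkAlgHom_apply ℂ _ _ _).trans (FreeAlgebra.lift_ι_apply _ _)
  rw [anti, h, MulOpposite.unop_op]

theorem anti_mul (x y : HeckeAlg n q Q) : anti (x * y) = anti y * anti x := by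
  simp [anti]

theorem anti_smul (c : ℂ) (x : HeckeAlg n q Q) : anti (c • x) = c • anti x := by
  simp [anti]

/-- The ring map of the free algebra that conjugates scalars and inverts generators. -/
noncomputable def sigmaFree (hq : ‖q‖ = 1) (hQ : ∀ k, ‖Q k‖ = 1) :
    FreeAlgebra ℂ (Fin n) →+* HeckeAlg n q Q :=
  letI : Algebra ℂ (HeckeAlg n q Q) :=
    ((algebraMap ℂ (HeckeAlg n q Q)).comp (starRingEnd ℂ)).toAlgebra'
      fun c x => Algebra.commutes (starRingEnd ℂ c) x
  (FreeAlgebra.lift ℂ fun i => (↑(Tunit hq hQ i)⁻¹ : HeckeAlg n q Q)).toRingHom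

theorem sigmaFree_ι (hq : ‖q‖ = 1) (hQ : ∀ k, ‖Q k‖ = 1) (i : Fin n) :
    sigmaFree hq hQ (FreeAlgebra.ι ℂ i) = (↑(Tunit hq hQ i)⁻¹ : HeckeAlg n q Q) := by
  let _ : Algebra ℂ (HeckeAlg n q Q) :=
    ((algebraMap ℂ (HeckeAlg n q Q)).comp (starRingEnd ℂ)).toAlgebra'
      fun c x => Algebra.commutes (starRingEnd ℂ c) x
  exact FreeAlgebra.lift_ι_apply (R := ℂ)
    (fun i => (↑(Tunit hq hQ i)⁻¹ : HeckeAlg n q Q)) i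

theorem sigmaFree_algebraMap (hq : ‖q‖ = 1) (hQ : ∀ k, ‖Q k‖ = 1) (c : ℂ) :
    sigmaFree hq hQ (algebraMap ℂ (FreeAlgebra ℂ (Fin n)) c) =
      algebraMap ℂ (HeckeAlg n q Q) (starRingEnd ℂ c) := by
  let _ : Algebra ℂ (HeckeAlg n q Q) :=
    ((algebraMap ℂ (HeckeAlg n q Q)).comp (starRingEnd ℂ)).toAlgebra'
      fun c x => Algebra.commutes (starRingEnd ℂ c) x
  exact AlgHom.commutes
    (FreeAlgebra.lift ℂ fun i : Fin n => (↑(Tunit hq hQ i)⁻¹ : HeckeAlg n q Q)) c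

theorem sigmaFree_rel (hq : ‖q‖ = 1) (hQ : ∀ k, ‖Q k‖ = 1)
    ⦃x y : FreeAlgebra ℂ (Fin n)⦄ (h : HeckeRel n q Q x y) :
    sigmaFree hq hQ x = sigmaFree hq hQ y := by
  have hq0 : q ≠ 0 := fun h => by simp [h] at hq
  induction h with
  | cyclotomic i hi =>
    have h : sigmaFree hq hQ ∘
        (fun k : Fin r => FreeAlgebra.ι ℂ i - algebraMap ℂ _ (Q k)) =
        (fun c => (↑(Tunit hq hQ i)⁻¹ : HeckeAlg n q Q) - algebraMap ℂ _ c⁻¹) ∘ Q := by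
      funext k
      simp [sigmaFree_ι, sigmaFree_algebraMap, Complex.inv_eq_conj (hQ k)]
    rw [map_list_prod, List.map_ofFn, map_zero, h, ← List.map_ofFn]
    obtain ⟨s, y, hs⟩ := list_prod_inv (Tunit hq hQ i) (List.ofFn Q) (by
      intro c hc
      obtain ⟨k, rfl⟩ := (List.mem_ofFn' _ _).1 hc
      intro h
      have := hQ k
      simp [h] at this)
    rw [hs]
    simp only [val_Tunit]
    rw [T_cyclotomic i hi, mul_zero, smul_zero]
  | braidFour i j hi hj =>
    simp only [map_mul, sigmaFree_ι, ← Units.val_mul, ← mul_inv_rev]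
    congr 2
    ext
    simp only [Units.val_mul, val_Tunit, ← mul_assoc]
    rw [T_braidFour i j hi hj]
  | quadratic i hi =>
    have h := T_quadratic (q := q) (Q := Q) i hi
    have e1 : (↑(Tunit hq hQ i)⁻¹ : HeckeAlg n q Q) + 1 =
        (↑(Tunit hq hQ i)⁻¹ : HeckeAlg n q Q) * (T q Q i + 1) := by
      rw [mul_add, ← val_Tunit hq hQ i, Units.inv_mul, mul_one, add_comm]
    have e2 : (↑(Tunit hq hQ i)⁻¹ : HeckeAlg n q Q) - algebraMap ℂ _ q⁻¹ =
        (-q⁻¹) • ((T q Q i - algebraMap ℂ _ q) * (↑(Tunit hq hQ i)⁻¹ : HeckeAlg n q Q)) := by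
      rw [sub_mul, ← val_Tunit hq hQ i, Units.mul_inv, smul_sub, ← Algebra.smul_def, smul_smul]
      simp [hq0, Algebra.algebraMap_eq_smul_one]
      abel
    simp only [map_mul, map_add, map_sub, map_one, map_zero, sigmaFree_ι,
      sigmaFree_algebraMap, ← Complex.inv_eq_conj hq]
    rw [e1, e2, mul_smul_comm, mul_assoc, ← mul_assoc (T q Q i + 1), h]
    simp
  | braidThree i j hi hj =>
    simp only [map_mul, sigmaFree_ι, ← Units.val_mul, ← mul_inv_rev]
    congr 2
    ext
    simp only [Units.val_mul, val_Tunit, ← mul_assoc]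
    rw [T_braidThree i j hi hj]
  | comm i j hij =>
    simp only [map_mul, sigmaFree_ι, ← Units.val_mul, ← mul_inv_rev]
    congr 2
    ext
    simp only [Units.val_mul, val_Tunit]
    rw [T_comm i j hij]

/-- The semilinear involution `σ`: the ring map with `σ (c • x) = conj c • σ x` and
`σ Tᵢ = Tᵢ⁻¹`; it exists because the parameters lie on the unit circle. -/
noncomputable def sigma (hq : ‖q‖ = 1) (hQ : ∀ k, ‖Q k‖ = 1) :
    HeckeAlg n q Q →+* HeckeAlg n q Q :=
  RingQuot.lift (r := HeckeRel n q Q) ⟨sigmaFree hq hQ, sigmaFree_rel hq hQ⟩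

theorem sigma_toHecke (hq : ‖q‖ = 1) (hQ : ∀ k, ‖Q k‖ = 1) (x : FreeAlgebra ℂ (Fin n)) :
    sigma hq hQ (toHecke n q Q x) = sigmaFree hq hQ x := by
  have h : toHecke n q Q x = RingQuot.mkRingHom (HeckeRel n q Q) x :=
    DFunLike.congr_fun (RingQuot.mkAlgHom_coe ℂ (HeckeRel n q Q)) x
  rw [h]
  exact RingQuot.lift_mkRingHom_apply (sigmaFree hq hQ) (sigmaFree_rel hq hQ) x

theorem sigma_T (hq : ‖q‖ = 1) (hQ : ∀ k, ‖Q k‖ = 1) (i : Fin n) :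
    sigma hq hQ (T q Q i) = (↑(Tunit hq hQ i)⁻¹ : HeckeAlg n q Q) := by
  rw [T, sigma_toHecke, sigmaFree_ι]

theorem sigma_smul (hq : ‖q‖ = 1) (hQ : ∀ k, ‖Q k‖ = 1) (c : ℂ) (x : HeckeAlg n q Q) :
    sigma hq hQ (c • x) = starRingEnd ℂ c • sigma hq hQ x := by
  have h : algebraMap ℂ (HeckeAlg n q Q) c = toHecke n q Q (algebraMap ℂ _ c) :=
    ((toHecke n q Q).commutes c).symm
  rw [Algebra.smul_def, map_mul, h, sigma_toHecke, sigmaFree_algebraMap, ← Algebra.smul_def]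

/-- The image of the braid group in the group of units: the subgroup generated by the `Tᵢ`. -/
noncomputable def braidImage (n : ℕ) (q : ℂ) {r : ℕ} (Q : Fin r → ℂ) :
    Subgroup (HeckeAlg n q Q)ˣ :=
  Subgroup.closure {u | ∃ i : Fin n, (u : HeckeAlg n q Q) = T q Q i}

end Algebra

/-! ### The elements `T_w` -/

/-- The transposition of the letters `j` and `j + 1` of `0, …, n-1`; it corresponds to the
generator `T_{j+1}`. -/
def simpleSwap (n : ℕ) (j : Fin (n - 1)) : Equiv.Perm (Fin n) :=
  Equiv.swap ⟨j.val, by omega⟩ ⟨j.val + 1, by omega⟩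

/-- The permutation spelled by a word; permutations act on letters from the right, so the
first letter of the word is applied first. -/
def wordPerm (n : ℕ) (l : List (Fin (n - 1))) : Equiv.Perm (Fin n) :=
  ((l.map (simpleSwap n)).reverse).prod

/-- `l` is a reduced word for `w`. -/
def IsReducedWord {n : ℕ} (l : List (Fin (n - 1))) (w : Equiv.Perm (Fin n)) : Prop :=
  wordPerm n l = w ∧ ∀ l', wordPerm n l' = w → l.length ≤ l'.length

theorem exists_wordPerm {n : ℕ} (w : Equiv.Perm (Fin n)) : ∃ l, wordPerm n l = w := by
  cases n with
  | zero => exact ⟨[], Subsingleton.elim _ _⟩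
  | succ m =>
    have hw : w ∈ Submonoid.closure
        (Set.range fun i : Fin m => Equiv.swap i.castSucc i.succ) := by
      rw [Equiv.Perm.mclosure_swap_castSucc_succ]
      trivial
    induction hw using Submonoid.closure_induction with
    | mem x hx =>
      obtain ⟨i, rfl⟩ := hx
      exact ⟨[i], by simp [wordPerm, simpleSwap]; rfl⟩
    | one => exact ⟨[], rfl⟩
    | mul x y _ _ hx hy =>
      obtain ⟨l, rfl⟩ := hx
      obtain ⟨l', rfl⟩ := hy
      exact ⟨l' ++ l, by simp [wordPerm]⟩

theorem exists_reducedWord {n : ℕ} (w : Equiv.Perm (Fin n)) :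
    ∃ l : List (Fin (n - 1)), IsReducedWord l w := by
  obtain ⟨l, hl, hmin⟩ := WellFounded.has_min (measure fun l : List (Fin (n - 1)) => l.length).wf
    {l | wordPerm n l = w} (exists_wordPerm w)
  exact ⟨l, hl, fun l' hl' => not_lt.1 (hmin l' hl')⟩

/-- `T_w = T_{i₁} ⋯ T_{i_k}` for a reduced expression `w = s_{i₁} ⋯ s_{i_k}` (by the braid
relations the choice of the reduced expression is irrelevant). -/
noncomputable def Tw {n r : ℕ} (q : ℂ) (Q : Fin r → ℂ) (w : Equiv.Perm (Fin n)) :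
    HeckeAlg n q Q :=
  ((Classical.choose (exists_reducedWord w)).map
    fun j => T q Q ⟨j.val + 1, by omega⟩).prod

/-! ### Multipartitions and tableaux -/

/-- An `r`-multipartition of `n`: an `r`-tuple of Young diagrams with `n` boxes in total. -/
structure Multipartition (r n : ℕ) where
  diag : Fin r → YoungDiagram
  sum_card : ∑ k, (diag k).card = n

namespace Multipartition

variable {r n : ℕ}

/-- `lam` dominates `mu`. -/
def Dominates (lam mu : Multipartition r n) : Prop :=
  ∀ (k : Fin r) (j : ℕ), 1 ≤ j →
    ∑ i ∈ Finset.Iio k, (mu.diag i).card + ∑ i ∈ Finset.range j, (mu.diag k).rowLen i ≤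
      ∑ i ∈ Finset.Iio k, (lam.diag i).card + ∑ i ∈ Finset.range j, (lam.diag k).rowLen i

/-- The boxes `(k, i, j)` (component, row, column) of a multipartition, ordered
lexicographically: component by component, row by row, from left to right. -/
def boxes (lam : Multipartition r n) : Finset (Fin r ×ₗ (ℕ ×ₗ ℕ)) :=
  (Finset.univ.sigma fun k => (lam.diag k).cells).map
    ⟨fun b => toLex (b.1, toLex b.2), by
      rintro ⟨k, c⟩ ⟨k', c'⟩ h
      have h1 := Prod.ext_iff.1 (toLex.injective h)
      obtain ⟨h2, h3⟩ := h1
      simp only at h2 h3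
      subst h2
      rw [toLex.injective h3]⟩

theorem card_boxes (lam : Multipartition r n) : lam.boxes.card = n := by
  rw [boxes, Finset.card_map, Finset.card_sigma]
  exact lam.sum_card

/-- The component of a box. -/
def comp {lam : Multipartition r n} (b : lam.boxes) : Fin r := (ofLex b.1).1

/-- The row of a box within its component. -/
def row {lam : Multipartition r n} (b : lam.boxes) : ℕ := (ofLex (ofLex b.1).2).1

/-- The column of a box within its component. -/
def col {lam : Multipartition r n} (b : lam.boxes) : ℕ := (ofLex (ofLex b.1).2).2

/-- A tableau of shape `lam`: a filling of the boxes with the numbers `0, …, n-1`, each used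
once. -/
abbrev Tableau (lam : Multipartition r n) : Type := lam.boxes ≃ Fin n

/-- Standard tableaux: in every component the entries increase along rows and down columns. -/
def IsStandard {lam : Multipartition r n} (t : lam.Tableau) : Prop :=
  ∀ b b' : lam.boxes, comp b = comp b' →
    (row b = row b' → col b < col b' → t b < t b') ∧
    (col b = col b' → row b < row b' → t b < t b')

/-- The tableau filled with `0, …, n-1` in order along the rows, in the first component, then
the second, and so on. -/
noncomputable def initialTableau (lam : Multipartition r n) : lam.Tableau :=
  (lam.boxes.orderIsoOfFin lam.card_boxes).symm.toEquiv

/-- The permutation `d(s)` carrying the initial tableau to `s`. -/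
noncomputable def dPerm {lam : Multipartition r n} (s : lam.Tableau) : Equiv.Perm (Fin n) :=
  lam.initialTableau.symm.trans s

/-- The row stabilizer of the initial tableau. -/
def rowStabilizer (lam : Multipartition r n) : Set (Equiv.Perm (Fin n)) :=
  {w | ∀ x : Fin n,
    comp (lam.initialTableau.symm (w x)) = comp (lam.initialTableau.symm x) ∧
    row (lam.initialTableau.symm (w x)) = row (lam.initialTableau.symm x)}

/-- `a_k`, the number of boxes in the components before the `k`-th. -/
def before (lam : Multipartition r n) (k : Fin r) : ℕ :=
  ∑ i ∈ Finset.Iio k, (lam.diag i).card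

theorem before_le (lam : Multipartition r n) (k : Fin r) : lam.before k ≤ n := by
  calc lam.before k ≤ ∑ i, (lam.diag i).card :=
        Finset.sum_le_sum_of_subset (Finset.subset_univ _)
    _ = n := lam.sum_card

end Multipartition

/-! ### Specht modules and their quotients -/

section Specht

variable {n r : ℕ} (q : ℂ) (Q : Fin r → ℂ)

/-- `jm m h` is `L_{m+1} = q^{-m} T_m ⋯ T_1 T_0 T_1 ⋯ T_m`, for `m = 0, …, n-1`. -/
noncomputable def jm : (m : ℕ) → m < n → HeckeAlg n q Q
  | 0, h => T q Q ⟨0, h⟩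
  | m + 1, h => q⁻¹ • (T q Q ⟨m + 1, h⟩ * jm m (Nat.lt_of_succ_lt h) * T q Q ⟨m + 1, h⟩)

open Classical in
/-- `x_λ`, the sum of the `T_w` over the row stabilizer of the initial tableau. -/
noncomputable def xElt (lam : Multipartition r n) : HeckeAlg n q Q :=
  ∑ w : Equiv.Perm (Fin n) with w ∈ lam.rowStabilizer, Tw q Q w

/-- `m_λ = (∏_k ∏_{m = 1}^{a_k} (L_m - q_k)) x_λ`. -/
noncomputable def mElt (lam : Multipartition r n) : HeckeAlg n q Q :=
  (List.ofFn fun k : Fin r =>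
    (List.ofFn fun m : Fin (lam.before k) =>
      jm q Q m.val (m.isLt.trans_le (lam.before_le k)) - algebraMap ℂ _ (Q k)).prod).prod *
  xElt q Q lam

/-- `m_{st} = T_{d(s)}^* m_μ T_{d(t)}`. -/
noncomputable def mTab {mu : Multipartition r n} (s t : mu.Tableau) : HeckeAlg n q Q :=
  anti (Tw q Q (Multipartition.dPerm s)) * mElt q Q mu * Tw q Q (Multipartition.dPerm t)

/-- The two-sided ideal `N̄^λ` of the `m_{st}`, where `s` and `t` run over the standard
tableaux of the shapes that strictly dominate `λ`. -/
noncomputable def Nbar (lam : Multipartition r n) : TwoSidedIdeal (HeckeAlg n q Q) :=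
  TwoSidedIdeal.span {x | ∃ mu : Multipartition r n, mu.Dominates lam ∧ mu ≠ lam ∧
    ∃ s t : mu.Tableau, Multipartition.IsStandard s ∧ Multipartition.IsStandard t ∧
      x = mTab q Q s t}

/-- The left module `H / N̄^λ`. -/
abbrev ModNbar (lam : Multipartition r n) : Type :=
  HeckeAlg n q Q ⧸ TwoSidedIdeal.asIdeal (Nbar q Q lam)

/-- The class of an element of `H` in `H / N̄^λ`. -/
noncomputable def toModNbar (lam : Multipartition r n) (h : HeckeAlg n q Q) :
    ModNbar q Q lam :=
  Submodule.Quotient.mk h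

/-- The Specht module `S^λ = H z_λ`, where `z_λ` is the class of `m_λ` in `H / N̄^λ`. -/
noncomputable def specht (lam : Multipartition r n) :
    Submodule (HeckeAlg n q Q) (ModNbar q Q lam) :=
  Submodule.span (HeckeAlg n q Q) {toModNbar q Q lam (mElt q Q lam)}

/-- The generator `z_λ` of the Specht module. -/
noncomputable def zElt (lam : Multipartition r n) : specht q Q lam :=
  ⟨toModNbar q Q lam (mElt q Q lam), Submodule.subset_span rfl⟩

/-- `B` is the Dipper–James–Mathas bilinear form on the Specht module: the scalar
`⟨h z_λ, h' z_λ⟩` is defined by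
`(h m_λ)^* (h' m_λ) = m_λ h^* h' m_λ ≡ ⟨h z_λ, h' z_λ⟩ m_λ` modulo `N̄^λ`. -/
def IsDJMForm (lam : Multipartition r n) (B : LinearMap.BilinForm ℂ (specht q Q lam)) : Prop :=
  ∀ h h' : HeckeAlg n q Q,
    (mElt q Q lam * anti h * h') • zElt q Q lam =
      B (h • zElt q Q lam) (h' • zElt q Q lam) • zElt q Q lam

/-- The radical of the Dipper–James–Mathas form, as a submodule. Since
`⟨h^* z_λ, v⟩ z_λ = m_λ h v`, a vector `v` is orthogonal to the whole Specht module
exactly if `m_λ h v = 0` for all `h`. -/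
noncomputable def djmRad (lam : Multipartition r n) :
    Submodule (HeckeAlg n q Q) (specht q Q lam) where
  carrier := {v | ∀ h : HeckeAlg n q Q, (mElt q Q lam * h) • v = 0}
  add_mem' := by
    intro a b ha hb h
    rw [smul_add, ha h, hb h, add_zero]
  zero_mem' := fun h => smul_zero _
  smul_mem' := by
    intro c v hv h
    rw [smul_smul, mul_assoc]
    exact hv (h * c)

/-- `D^λ`, the quotient of the Specht module by the radical of its form. -/
abbrev dModule (lam : Multipartition r n) : Type :=
  specht q Q lam ⧸ djmRad q Q lam

/-- `s` is the semilinear map that `σ` induces on the Specht module (through `H / N̄^λ`). -/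
def IsInducedSigma {q : ℂ} {Q : Fin r → ℂ} (hq : ‖q‖ = 1) (hQ : ∀ k, ‖Q k‖ = 1)
    (lam : Multipartition r n)
    (s : specht q Q lam →ₛₗ[starRingEnd ℂ] specht q Q lam) : Prop :=
  ∀ (x : HeckeAlg n q Q) (hx : toModNbar q Q lam x ∈ specht q Q lam),
    (s ⟨toModNbar q Q lam x, hx⟩ : ModNbar q Q lam) = toModNbar q Q lam (sigma hq hQ x)

end Specht

end ArikiKoike

/-! The heart of the proof is the inclusion `m_λ H m_λ ⊆ ℂ m_λ + N̄^λ` (`exists_mElt_mul_mElt`).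
Granting it, `m_λ h^* h' m_λ` is a multiple of `m_λ` modulo `N̄^λ`, and the scalar is the bilinear
form. It is well defined, symmetric and contravariant because `*` fixes `m_λ` and preserves `N̄^λ`.
If `v` is not in the radical, then some `m_λ h v` is a non-zero multiple of the generator `z_λ`, so
the class of `v` generates `D^λ`, which is therefore simple.

The parameters lie on the unit circle, so `σ` exists, and `σ(m_λ) = g m_λ` with a unit `g`
(`sigma_mElt`). Hence `σ` preserves `N̄^λ` and acts on `S^λ`. Applying it to the equation that
defines the form gives `⟨σv, σw⟩ z_λ = conj ⟨v, w⟩ g z_λ`. The form is not zero, since `D^λ ≠ 0`, so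
`g z_λ = c z_λ` for a scalar `c`, and `σ² = 1` forces `|c| = 1` (`IsDJMForm.exists_phase`). With `α²
= c⁻¹` the form `α ⟨v, σ w⟩` is Hermitian on `S^λ`, and it descends to a nondegenerate form on
`D^λ`.

The inclusion is obtained without the basis theorem for the `m_st`. Consider any algebra with
generators satisfying the Hecke relations in which `m_ρ = 0` for all multicompositions `ρ` above `λ`
(`HeckeDatum.Vanishes`). The algebra `H / N̄^λ` is of this kind: for multipartitions `m_ρ` is among
the generators of `N̄^λ`, and exchanging two rows conjugates `m_ρ` by a unit. In such an algebra the
Garnir relations straighten `T_u m_λ` to standard `u`, and the Jucys–Murphy elements act on `m_λ` by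
contents, which takes care of `T_0`. So the left module generated by `m_λ` is spanned by the `T_u
m_λ` with `u` standard (`adjoin_mul_m_mem`), and `m_λ h m_λ = ∑ a_u T_u m_λ`. The terms with `u ≠ 1`
must be shown to be removable.

For this the parameters are deformed by a variable `t` so that distinct diagonals have distinct
contents. Over the field of fractions there is Young's seminormal representation on functions on the
standard tableaux. In it the `m_ρ` above `λ` vanish, by a comparison of weights
(`seminormal_vanishes`). The image of `m_λ` lies in the line of the initial tableau `δ`, and the
vectors `T_u m_λ δ` are linearly independent by a dimension count (`linearIndependent_tw_m`). Now
both algebras are put side by side as one algebra over the Laurent polynomials in `t`, with `t`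
acting as `1` on the first factor. The spanning theorem applies to the product and yields the same
coefficients `a_u` in both factors. In the generic factor they vanish for `u ≠ 1`; hence they are
zero, and the first factor gives the inclusion. -/

namespace ArikiKoike

/-! ### Permutations, inversions and reduced words -/

section Perm

variable {n : ℕ}

/-- The value of a permutation of `0, …, n-1` at a natural number. -/
def ev (u : Equiv.Perm (Fin n)) (x : ℕ) : ℕ := if h : x < n then (u ⟨x, h⟩).val else x

theorem ev_of_lt (u : Equiv.Perm (Fin n)) {x : ℕ} (h : x < n) : ev u x = (u ⟨x, h⟩).val :=
  dif_pos h

theorem ev_val (u : Equiv.Perm (Fin n)) (x : Fin n) : ev u x.val = (u x).val := by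
  rw [ev_of_lt u x.isLt]

theorem ev_lt (u : Equiv.Perm (Fin n)) {x : ℕ} (h : x < n) : ev u x < n := by
  rw [ev_of_lt u h]; exact (u _).isLt

theorem ev_of_le (u : Equiv.Perm (Fin n)) {x : ℕ} (h : n ≤ x) : ev u x = x :=
  dif_neg (not_lt.2 h)

theorem ev_mul (u v : Equiv.Perm (Fin n)) (x : ℕ) : ev (u * v) x = ev u (ev v x) := by
  by_cases h : x < n
  · rw [ev_of_lt _ h, ev_of_lt v h, ev_val]; rfl
  · rw [ev_of_le _ (not_lt.1 h), ev_of_le v (not_lt.1 h), ev_of_le u (not_lt.1 h)]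

@[simp] theorem ev_one (x : ℕ) : ev (1 : Equiv.Perm (Fin n)) x = x := by
  by_cases h : x < n
  · rw [ev_of_lt _ h]; rfl
  · rw [ev_of_le _ (not_lt.1 h)]

@[simp] theorem ev_inv_ev (u : Equiv.Perm (Fin n)) (x : ℕ) : ev u⁻¹ (ev u x) = x := by
  rw [← ev_mul]; simp

@[simp] theorem ev_ev_inv (u : Equiv.Perm (Fin n)) (x : ℕ) : ev u (ev u⁻¹ x) = x := by
  rw [← ev_mul]; simp

theorem ev_injective (u : Equiv.Perm (Fin n)) : Function.Injective (ev u) :=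
  fun x y h => by rw [← ev_inv_ev u x, h, ev_inv_ev]

theorem perm_ext {u v : Equiv.Perm (Fin n)} (h : ∀ x < n, ev u x = ev v x) : u = v := by
  ext x
  rw [← ev_val, ← ev_val, h x x.isLt]

/-- The transposition of `i - 1` and `i`, for `0 < i < n`. -/
def sw (n i : ℕ) : Equiv.Perm (Fin n) :=
  if h : 0 < i ∧ i < n then Equiv.swap ⟨i - 1, by omega⟩ ⟨i, h.2⟩ else 1

theorem ev_sw {i : ℕ} (h0 : 0 < i) (h1 : i < n) (x : ℕ) :
    ev (sw n i) x = if x + 1 = i then i else if x = i then i - 1 else x := by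
  by_cases hx : x < n
  · rw [ev_of_lt _ hx, sw, dif_pos ⟨h0, h1⟩, Equiv.swap_apply_def]
    simp only [Fin.ext_iff]
    split_ifs <;> simp <;> omega
  · rw [ev_of_le _ (not_lt.1 hx)]
    split_ifs <;> omega

theorem sw_mul_self (i : ℕ) : sw n i * sw n i = 1 := by
  unfold sw; split_ifs <;> simp

theorem sw_inv (i : ℕ) : (sw n i)⁻¹ = sw n i := inv_eq_of_mul_eq_one_left (sw_mul_self i)

theorem sw_comm {i j : ℕ} (hi : 0 < i) (hij : i + 1 < j) (hj : j < n) :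
    sw n i * sw n j = sw n j * sw n i := by
  apply perm_ext
  intro x hx
  simp only [ev_mul, ev_sw hi (show i < n by omega), ev_sw (show 0 < j by omega) hj]
  grind

theorem sw_braid {i : ℕ} (hi : 0 < i) (hj : i + 1 < n) :
    sw n i * (sw n (i + 1) * sw n i) = sw n (i + 1) * (sw n i * sw n (i + 1)) := by
  apply perm_ext
  intro x hx
  simp only [ev_mul, ev_sw hi (show i < n by omega), ev_sw (show 0 < i + 1 by omega) hj]
  grind

/-- The set of inversions. -/
def invSet (u : Equiv.Perm (Fin n)) : Finset (ℕ × ℕ) :=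
  (Finset.range n ×ˢ Finset.range n).filter fun a => a.1 < a.2 ∧ ev u a.2 < ev u a.1

theorem mem_invSet {u : Equiv.Perm (Fin n)} {a : ℕ × ℕ} :
    a ∈ invSet u ↔ a.2 < n ∧ a.1 < a.2 ∧ ev u a.2 < ev u a.1 := by
  simp [invSet]; omega

/-- The number of inversions. -/
def inv (u : Equiv.Perm (Fin n)) : ℕ := (invSet u).card

@[simp] theorem inv_one : inv (1 : Equiv.Perm (Fin n)) = 0 := by
  rw [inv, Finset.card_eq_zero, Finset.eq_empty_iff_forall_notMem]
  intro a ha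
  rw [mem_invSet] at ha
  simp at ha; omega

/-- The transposition acts on positions, so it carries the inversions of `u` to inversions of the
product, and only the pair `(i - 1, i)` is new. -/
theorem inv_mul_sw {u : Equiv.Perm (Fin n)} {i : ℕ} (h0 : 0 < i) (h1 : i < n)
    (h : ev u (i - 1) < ev u i) : inv (u * sw n i) = inv u + 1 := by
  have hs := fun x => ev_sw (n := n) h0 h1 x
  have hss : ∀ x, ev (sw n i) (ev (sw n i) x) = x := fun x => by
    rw [← ev_mul, sw_mul_self, ev_one]
  have key : invSet (u * sw n i) = insert (i - 1, i)
      ((invSet u).image fun a => (ev (sw n i) a.1, ev (sw n i) a.2)) := by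
    ext ⟨a, b⟩
    rw [Finset.mem_insert, Finset.mem_image, mem_invSet]
    simp only [ev_mul, Prod.mk.injEq, Prod.exists, mem_invSet]
    constructor
    · rintro ⟨hb, hab, hu⟩
      by_cases hc : a = i - 1 ∧ b = i
      · exact Or.inl hc
      · refine Or.inr ⟨ev (sw n i) a, ev (sw n i) b, ⟨ev_lt _ hb, ?_, hu⟩, hss a, hss b⟩
        rw [hs a, hs b]; split_ifs <;> omega
    · rintro (⟨rfl, rfl⟩ | ⟨c, d, ⟨hd, hcd, hu⟩, rfl, rfl⟩)
      · refine ⟨h1, by omega, ?_⟩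
        rw [hs b, hs (b - 1), if_neg (by omega), if_pos rfl, if_pos (by omega)]; exact h
      · rw [hss, hss]
        refine ⟨ev_lt _ hd, ?_, hu⟩
        have : ¬ (c = i - 1 ∧ d = i) := by rintro ⟨rfl, rfl⟩; omega
        rw [hs c, hs d]; split_ifs <;> omega
  rw [inv, key, Finset.card_insert_of_notMem, Finset.card_image_of_injective, inv]
  · rintro ⟨a, b⟩ ⟨c, d⟩ hac
    simp only [Prod.mk.injEq] at hac
    rw [ev_injective _ hac.1, ev_injective _ hac.2]
  · simp only [Finset.mem_image, Prod.mk.injEq, Prod.exists, mem_invSet, not_exists]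
    rintro a b ⟨⟨hb, hab, _⟩, h2, h3⟩
    rw [hs a] at h2; rw [hs b] at h3
    split_ifs at h2 h3 <;> omega

theorem ev_mul_sw {u : Equiv.Perm (Fin n)} {i : ℕ} (h0 : 0 < i) (h1 : i < n) (x : ℕ) :
    ev (u * sw n i) x =
      if x + 1 = i then ev u i else if x = i then ev u (i - 1) else ev u x := by
  rw [ev_mul, ev_sw h0 h1]; split_ifs <;> rfl

theorem ev_mul_sw_pred {u : Equiv.Perm (Fin n)} {i : ℕ} (h0 : 0 < i) (h1 : i < n) :
    ev (u * sw n i) (i - 1) = ev u i := by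
  rw [ev_mul_sw h0 h1, if_pos (by omega)]

theorem ev_mul_sw_self {u : Equiv.Perm (Fin n)} {i : ℕ} (h0 : 0 < i) (h1 : i < n) :
    ev (u * sw n i) i = ev u (i - 1) := by
  rw [ev_mul_sw h0 h1, if_neg (by omega), if_pos rfl]

theorem ev_mul_sw_of_ne {u : Equiv.Perm (Fin n)} {i x : ℕ} (h0 : 0 < i) (h1 : i < n)
    (h2 : x + 1 ≠ i) (h3 : x ≠ i) : ev (u * sw n i) x = ev u x := by
  rw [ev_mul_sw h0 h1, if_neg h2, if_neg h3]

theorem inv_mul_sw_of_gt {u : Equiv.Perm (Fin n)} {i : ℕ} (h0 : 0 < i) (h1 : i < n)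
    (h : ev u i < ev u (i - 1)) : inv u = inv (u * sw n i) + 1 := by
  have h2 : ev (u * sw n i) (i - 1) < ev (u * sw n i) i := by
    rwa [ev_mul_sw_pred h0 h1, ev_mul_sw_self h0 h1]
  have := inv_mul_sw h0 h1 h2
  rwa [mul_assoc, sw_mul_self, mul_one] at this

theorem ev_pred_ne (u : Equiv.Perm (Fin n)) {i : ℕ} (h0 : 0 < i) : ev u (i - 1) ≠ ev u i :=
  fun h => by have := ev_injective u h; omega

theorem inv_perm_inv (u : Equiv.Perm (Fin n)) : inv u⁻¹ = inv u := by
  have key : ∀ u : Equiv.Perm (Fin n), inv u⁻¹ ≤ inv u := fun u => by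
    refine Finset.card_le_card_of_injOn (fun a => (ev u⁻¹ a.2, ev u⁻¹ a.1)) ?_ ?_
    · rintro ⟨a, b⟩ h
      simp only [Finset.mem_coe, mem_invSet] at h ⊢
      exact ⟨ev_lt _ (by omega), h.2.2, by simpa using h.2.1⟩
    · rintro ⟨a, b⟩ - ⟨c, d⟩ - hac
      simp only [Prod.mk.injEq] at hac
      rw [ev_injective _ hac.1, ev_injective _ hac.2]
  refine le_antisymm (key u) ?_
  simpa using key u⁻¹

/-- A permutation of `Fin n` without descents is strictly increasing, hence the identity. -/
theorem exists_descent {u : Equiv.Perm (Fin n)} (h : u ≠ 1) :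
    ∃ i, 0 < i ∧ i < n ∧ ev u i < ev u (i - 1) := by
  by_contra! hc
  apply h
  have hmono : StrictMono u := by
    intro x y hxy
    have : ∀ d, ∀ x, x + (d + 1) < n → ev u x < ev u (x + (d + 1)) := by
      intro d
      induction d with
      | zero =>
        intro x hx
        have := hc (x + 1) (by omega) hx
        have h2 := ev_pred_ne u (i := x + 1) (by omega)
        simp only [Nat.add_sub_cancel] at this h2
        simp only [zero_add]; omega
      | succ d ih =>
        intro x hx
        have h1 := ih x (by omega)
        have := hc (x + (d + 1) + 1) (by omega) hx
        have h2 := ev_pred_ne u (i := x + (d + 1) + 1) (by omega)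
        simp only [Nat.add_sub_cancel] at this h2
        rw [show x + (d + 1 + 1) = x + (d + 1) + 1 by omega]; omega
    have hxy' : x.val < y.val := hxy
    have := this (y.val - x.val - 1) x.val (by omega)
    rw [show x.val + (y.val - x.val - 1 + 1) = y.val by omega, ev_val, ev_val] at this
    exact this
  have h2 : ⇑u = id := by
    have := hmono.range_inj (g := id) strictMono_id
    rw [← this, Set.range_id, u.surjective.range_eq]
  ext x; simp [h2]

theorem inv_eq_zero {u : Equiv.Perm (Fin n)} (h : inv u = 0) : u = 1 := by
  by_contra hu
  obtain ⟨i, h0, h1, h2⟩ := exists_descent hu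
  have := inv_mul_sw_of_gt h0 h1 h2
  omega

/-- The permutation spelled by a word, the head of the list being the last letter. -/
def wp (n : ℕ) : List ℕ → Equiv.Perm (Fin n)
  | [] => 1
  | i :: l => wp n l * sw n i

/-- `l` is a word of minimal length for `u`. -/
def IsRed (l : List ℕ) (u : Equiv.Perm (Fin n)) : Prop :=
  wp n l = u ∧ (∀ i ∈ l, 0 < i ∧ i < n) ∧ l.length = inv u

/-- Each letter changes the number of inversions by one. Together with `exists_isRed` this
identifies `inv` with the Coxeter length. -/
theorem inv_wp_le (l : List ℕ) (hl : ∀ i ∈ l, 0 < i ∧ i < n) : inv (wp n l) ≤ l.length := by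
  induction l with
  | nil => simp [wp]
  | cons i l ih =>
    have hi := hl i List.mem_cons_self
    have := ih fun j hj => hl j (List.mem_cons_of_mem _ hj)
    rw [wp, List.length_cons]
    rcases lt_or_gt_of_ne (ev_pred_ne (wp n l) hi.1) with h | h
    · rw [inv_mul_sw hi.1 hi.2 h]; omega
    · have := inv_mul_sw_of_gt hi.1 hi.2 h; omega

theorem IsRed.cons {l : List ℕ} {u : Equiv.Perm (Fin n)} {i : ℕ} (h0 : 0 < i) (h1 : i < n)
    (h : ev u i < ev u (i - 1)) (hl : IsRed l (u * sw n i)) : IsRed (i :: l) u := by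
  obtain ⟨h2, h3, h4⟩ := hl
  refine ⟨?_, ?_, ?_⟩
  · rw [wp, h2, mul_assoc, sw_mul_self, mul_one]
  · intro j hj
    rcases List.mem_cons.1 hj with rfl | hj
    · exact ⟨h0, h1⟩
    · exact h3 j hj
  · rw [List.length_cons, h4, ← inv_mul_sw_of_gt h0 h1 h]

/-- The last letter of a reduced word is a descent: at an ascent the remaining word would be shorter
than the number of inversions of the permutation it spells. -/
theorem IsRed.of_cons {l : List ℕ} {u : Equiv.Perm (Fin n)} {i : ℕ} (hl : IsRed (i :: l) u) :
    0 < i ∧ i < n ∧ ev u i < ev u (i - 1) ∧ IsRed l (u * sw n i) := by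
  obtain ⟨h2, h3, h4⟩ := hl
  have hi := h3 i List.mem_cons_self
  have h3' : ∀ j ∈ l, 0 < j ∧ j < n := fun j hj => h3 j (List.mem_cons_of_mem _ hj)
  have h5 : wp n l = u * sw n i := by rw [← h2, wp, mul_assoc, sw_mul_self, mul_one]
  have h6 := inv_wp_le l h3'
  rw [h5] at h6
  rw [List.length_cons] at h4
  rcases lt_or_gt_of_ne (ev_pred_ne u hi.1) with h | h
  · rw [inv_mul_sw hi.1 hi.2 h] at h6; omega
  · refine ⟨hi.1, hi.2, h, h5, h3', ?_⟩
    have := inv_mul_sw_of_gt hi.1 hi.2 h; omega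

theorem exists_isRed (u : Equiv.Perm (Fin n)) : ∃ l, IsRed l u := by
  induction hk : inv u generalizing u with
  | zero => exact ⟨[], by rw [inv_eq_zero hk]; rfl, by simp, by simp [hk]⟩
  | succ k ih =>
    obtain ⟨i, h0, h1, h2⟩ := exists_descent (u := u) (by rintro rfl; simp at hk)
    have h3 := inv_mul_sw_of_gt h0 h1 h2
    obtain ⟨l, hl⟩ := ih (u * sw n i) (by omega)
    exact ⟨i :: l, hl.cons h0 h1 h2⟩

theorem wp_append (l l' : List ℕ) : wp n (l ++ l') = wp n l' * wp n l := by
  induction l with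
  | nil => simp [wp]
  | cons i l ih => rw [List.cons_append, wp, ih, wp, mul_assoc]

theorem wp_reverse (l : List ℕ) : wp n l.reverse = (wp n l)⁻¹ := by
  induction l with
  | nil => simp [wp]
  | cons i l ih => rw [List.reverse_cons, wp_append, ih]; simp [wp, mul_inv_rev, sw_inv]

theorem IsRed.reverse {l : List ℕ} {u : Equiv.Perm (Fin n)} (h : IsRed l u) :
    IsRed l.reverse u⁻¹ :=
  ⟨by rw [wp_reverse, h.1], by simpa using h.2.1, by rw [List.length_reverse, h.2.2, inv_perm_inv]⟩

end Perm

end ArikiKoike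

namespace ArikiKoike

/-! ### Algebras with generators satisfying the type `A` Hecke relations -/

/-- Elements `T 1, …, T (n-1)` of an `R`-algebra that satisfy the relations of the Hecke algebra
of the symmetric group. -/
structure FinHecke (R A : Type*) [CommRing R] [Ring A] [Algebra R A] (n : ℕ) where
  q : R
  T : ℕ → A
  quad : ∀ i, 0 < i → i < n → T i * T i = (q - 1) • T i + q • 1
  braid : ∀ i, 0 < i → i + 1 < n → T i * T (i + 1) * T i = T (i + 1) * T i * T (i + 1)
  comm : ∀ i j, 0 < i → i + 2 ≤ j → j < n → Commute (T i) (T j)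

namespace FinHecke

variable {R A : Type*} [CommRing R] [Ring A] [Algebra R A] {n : ℕ} (D : FinHecke R A n)

/-- The same generators in the opposite algebra. -/
def op : FinHecke R Aᵐᵒᵖ n where
  q := D.q
  T i := MulOpposite.op (D.T i)
  quad i h0 h1 := by
    rw [← MulOpposite.op_mul, D.quad i h0 h1]; rfl
  braid i h0 h1 := by
    simp only [← MulOpposite.op_mul, ← mul_assoc]; rw [D.braid i h0 h1]
  comm i j h0 h1 h2 := by
    have := D.comm i j h0 h1 h2
    change _ * _ = _ * _
    rw [← MulOpposite.op_mul, ← MulOpposite.op_mul, this.eq]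

/-- The product of generators spelled by a word, the head of the list being the last factor. -/
def tp : List ℕ → A
  | [] => 1
  | i :: l => tp l * D.T i

theorem tp_append (l l' : List ℕ) : D.tp (l ++ l') = D.tp l' * D.tp l := by
  induction l with
  | nil => simp [tp]
  | cons i l ih => rw [List.cons_append, tp, ih, tp, mul_assoc]

theorem op_tp (l : List ℕ) : D.op.tp l.reverse = MulOpposite.op (D.tp l) := by
  induction l with
  | nil => simp [tp]
  | cons i l ih => rw [List.reverse_cons, tp_append, ih]; simp [tp, op]

/-- Matsumoto's theorem: the product over a reduced word only depends on the permutation. -/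
theorem tp_eq_of_isRed {u : Equiv.Perm (Fin n)} {l l' : List ℕ} (hl : IsRed l u)
    (hl' : IsRed l' u) : D.tp l = D.tp l' := by
  induction hk : inv u using Nat.strong_induction_on generalizing u l l' with
  | _ k ih =>
  subst hk
  have main : ∀ (i j : ℕ) (l l' : List ℕ), i < j → IsRed (i :: l) u → IsRed (j :: l') u →
      D.tp (i :: l) = D.tp (j :: l') := by
    intro i j l l' hij hl hl'
    obtain ⟨hi0, hi1, hi2, hi3⟩ := hl.of_cons
    obtain ⟨hj0, hj1, hj2, hj3⟩ := hl'.of_cons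
    have ei := inv_mul_sw_of_gt hi0 hi1 hi2
    have ej := inv_mul_sw_of_gt hj0 hj1 hj2
    -- Both last letters are descents of `u`, so `u` also has reduced words ending in either form of
    -- the longest word in `s_i` and `s_j`. Induction compares each given word with one of these,
    -- and the commutation or braid relation compares the two with each other.
    rcases Nat.lt_or_ge (i + 1) j with h | h
    · have hij' : ev (u * sw n i) j < ev (u * sw n i) (j - 1) := by
        rw [ev_mul_sw_of_ne hi0 hi1 (by omega) (by omega),
          ev_mul_sw_of_ne hi0 hi1 (by omega) (by omega)]; exact hj2
      have hji' : ev (u * sw n j) i < ev (u * sw n j) (i - 1) := by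
        rw [ev_mul_sw_of_ne hj0 hj1 (by omega) (by omega),
          ev_mul_sw_of_ne hj0 hj1 (by omega) (by omega)]; exact hi2
      have hcomm : u * sw n i * sw n j = u * sw n j * sw n i := by
        rw [mul_assoc, mul_assoc, sw_comm hi0 h hj1]
      obtain ⟨l₀, h₀⟩ := exists_isRed (u * sw n i * sw n j)
      have r1 := ih _ (by omega) hi3 (h₀.cons hj0 hj1 hij') rfl
      have r2 := ih _ (by omega) hj3 ((hcomm ▸ h₀).cons hi0 hi1 hji') rfl
      simp only [tp] at r1 r2 ⊢
      rw [r1, r2, mul_assoc, mul_assoc, (D.comm i j hi0 h hj1).eq]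
    · obtain rfl : j = i + 1 := by omega
      simp only [Nat.add_sub_cancel] at hj2
      have e1 := ev_mul_sw_self (u := u) hi0 hi1
      have e2 := ev_mul_sw_of_ne (u := u) (x := i + 1) hi0 hi1 (by omega) (by omega)
      have e3 := ev_mul_sw_pred (u := u) hi0 hi1
      have f1 := ev_mul_sw_self (u := u) hj0 hj1
      have f2 := ev_mul_sw_of_ne (u := u) (x := i - 1) hj0 hj1 (by omega) (by omega)
      have f3 := ev_mul_sw_pred (u := u) hj0 hj1
      have e4 := ev_mul_sw_pred (u := u * sw n i) hj0 hj1
      have e5 := ev_mul_sw_of_ne (u := u * sw n i) (x := i - 1) hj0 hj1 (by omega) (by omega)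
      have f4 := ev_mul_sw_self (u := u * sw n (i + 1)) hi0 hi1
      have f5 := ev_mul_sw_of_ne (u := u * sw n (i + 1)) (x := i + 1) hi0 hi1 (by omega)
        (by omega)
      simp only [Nat.add_sub_cancel] at f1 f3 e4
      have a1 : ev (u * sw n i) (i + 1) < ev (u * sw n i) (i + 1 - 1) := by
        rw [Nat.add_sub_cancel, e1, e2]; omega
      have a2 : ev (u * sw n i * sw n (i + 1)) i < ev (u * sw n i * sw n (i + 1)) (i - 1) := by
        rw [e4, e5, e2, e3]; exact hj2
      have b1 : ev (u * sw n (i + 1)) i < ev (u * sw n (i + 1)) (i - 1) := by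
        rw [f3, f2]; omega
      have b2 : ev (u * sw n (i + 1) * sw n i) (i + 1) <
          ev (u * sw n (i + 1) * sw n i) (i + 1 - 1) := by
        rw [Nat.add_sub_cancel, f4, f5, f1, f2]; exact hi2
      have hb : u * sw n i * sw n (i + 1) * sw n i = u * sw n (i + 1) * sw n i * sw n (i + 1) := by
        simp only [mul_assoc]; rw [sw_braid hi0 hj1]
      obtain ⟨l₀, h₀⟩ := exists_isRed (u * sw n i * sw n (i + 1) * sw n i)
      have r1 := ih _ (by omega) hi3 ((h₀.cons hi0 hi1 a2).cons hj0 hj1 a1) rfl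
      have r2 := ih _ (by omega) hj3 (((hb ▸ h₀).cons hj0 hj1 b2).cons hi0 hi1 b1) rfl
      have := D.braid i hi0 hj1
      simp only [tp] at r1 r2 ⊢
      rw [r1, r2]
      simp only [mul_assoc] at this ⊢
      rw [this]
  cases l with
  | nil =>
    have h0 : inv u = 0 := by rw [← hl.2.2]; rfl
    have h1 : l'.length = 0 := by rw [hl'.2.2, h0]
    rw [List.length_eq_zero_iff.1 h1]
  | cons i l =>
    cases l' with
    | nil =>
      have h0 : inv u = 0 := by rw [← hl'.2.2]; rfl
      have h1 := hl.2.2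
      simp [h0] at h1
    | cons j l' =>
      rcases lt_trichotomy i j with h | rfl | h
      · exact main i j l l' h hl hl'
      · obtain ⟨hi0, hi1, hi2, hi3⟩ := hl.of_cons
        have ei := inv_mul_sw_of_gt hi0 hi1 hi2
        rw [tp, tp, ih _ (by omega) hi3 hl'.of_cons.2.2.2 rfl]
      · exact (main j i l' l h hl' hl).symm

/-- The element `T_u`, with `T_{u s_i} = T_u T_i` if `u s_i` is longer than `u`. -/
noncomputable def tw (u : Equiv.Perm (Fin n)) : A := D.tp (Classical.choose (exists_isRed u))

theorem tw_eq {u : Equiv.Perm (Fin n)} {l : List ℕ} (h : IsRed l u) : D.tw u = D.tp l :=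
  D.tp_eq_of_isRed (Classical.choose_spec (exists_isRed u)) h

@[simp] theorem tw_one : D.tw (1 : Equiv.Perm (Fin n)) = 1 :=
  D.tw_eq (l := []) ⟨rfl, by simp, by simp⟩

/-- The reversal of a reduced word is a reduced word of the inverse. Through this, statements about
right multiplication by generators give those about left multiplication. -/
theorem op_tw (u : Equiv.Perm (Fin n)) : D.op.tw u = MulOpposite.op (D.tw u⁻¹) := by
  obtain ⟨l, hl⟩ := exists_isRed u⁻¹
  have := hl.reverse
  rw [inv_inv_eq] at this
  rw [D.tw_eq hl, D.op.tw_eq this, op_tp]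
where inv_inv_eq : (u⁻¹)⁻¹ = u := by simp

theorem tw_of_gt {u : Equiv.Perm (Fin n)} {i : ℕ} (h0 : 0 < i) (h1 : i < n)
    (h : ev u i < ev u (i - 1)) : D.tw u = D.tw (u * sw n i) * D.T i := by
  obtain ⟨l, hl⟩ := exists_isRed (u * sw n i)
  rw [D.tw_eq hl, D.tw_eq (hl.cons h0 h1 h), tp]

theorem tw_mul_sw {u : Equiv.Perm (Fin n)} {i : ℕ} (h0 : 0 < i) (h1 : i < n)
    (h : ev u (i - 1) < ev u i) : D.tw (u * sw n i) = D.tw u * D.T i := by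
  rw [D.tw_of_gt h0 h1, mul_assoc u, sw_mul_self, mul_one]
  rwa [ev_mul_sw_pred h0 h1, ev_mul_sw_self h0 h1]

theorem tw_mul_T_of_gt {u : Equiv.Perm (Fin n)} {i : ℕ} (h0 : 0 < i) (h1 : i < n)
    (h : ev u i < ev u (i - 1)) :
    D.tw u * D.T i = (D.q - 1) • D.tw u + D.q • D.tw (u * sw n i) := by
  rw [D.tw_of_gt h0 h1 h, mul_assoc, D.quad i h0 h1, mul_add, mul_smul_comm, mul_smul_comm,
    mul_one]

/-! ### The length filtration -/

/-- The span of the `T_u` with `u` of length less than `k`. -/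
noncomputable def G (k : ℕ) : Submodule R A :=
  Submodule.span R {x | ∃ u : Equiv.Perm (Fin n), inv u < k ∧ x = D.tw u}

theorem tw_mem_G {u : Equiv.Perm (Fin n)} {k : ℕ} (h : inv u < k) : D.tw u ∈ D.G k :=
  Submodule.subset_span ⟨u, h, rfl⟩

theorem G_mono {k l : ℕ} (h : k ≤ l) : D.G k ≤ D.G l := by
  apply Submodule.span_mono
  rintro x ⟨u, hu, rfl⟩
  exact ⟨u, by omega, rfl⟩

theorem mul_T_mem_G {k i : ℕ} (h0 : 0 < i) (h1 : i < n) {x : A} (hx : x ∈ D.G k) :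
    x * D.T i ∈ D.G (k + 1) := by
  induction hx using Submodule.span_induction with
  | mem x hx =>
    obtain ⟨u, hu, rfl⟩ := hx
    rcases lt_or_gt_of_ne (ev_pred_ne u h0) with h | h
    · rw [← D.tw_mul_sw h0 h1 h]
      exact D.tw_mem_G (by rw [inv_mul_sw h0 h1 h]; omega)
    · rw [D.tw_mul_T_of_gt h0 h1 h]
      have := inv_mul_sw_of_gt h0 h1 h
      exact add_mem (Submodule.smul_mem _ _ (D.tw_mem_G (by omega)))
        (Submodule.smul_mem _ _ (D.tw_mem_G (by omega)))
  | zero => rw [zero_mul]; exact zero_mem _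
  | add x y _ _ hx hy => rw [add_mul]; exact add_mem hx hy
  | smul c x _ hx => rw [smul_mul_assoc]; exact Submodule.smul_mem _ _ hx

/-! ### Runs, symmetrizers and shuffles -/

/-- `T (p+1) ⋯ T (p+a)`. -/
def U (p : ℕ) : ℕ → A
  | 0 => 1
  | a + 1 => U p a * D.T (p + a + 1)

theorem U_add (p a b : ℕ) : D.U p (a + b) = D.U p a * D.U (p + a) b := by
  induction b with
  | zero => simp [U]
  | succ b ih => rw [← add_assoc, U, ih, U, mul_assoc]; congr 3; omega

/-- `1 + T (p+1) + ⋯ + T (p+1) ⋯ T (p+l)`. -/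
def Y (p l : ℕ) : A := ∑ j ∈ Finset.range (l + 1), D.U p j

/-- The symmetrizer of the positions `p, …, p+l-1`. -/
def X : ℕ → ℕ → A
  | _, 0 => 1
  | p, l + 1 => X (p + 1) l * D.Y p l

/-- The summands of `Y` belong to the cycles that send `p + j` to `p`, and the other factor to the
permutations fixing `p`. That the product is the sum of the `T_u` over the block is shown in
`sum_labelStab_succ`. -/
theorem X_succ (p l : ℕ) : D.X p (l + 1) = D.X (p + 1) l * D.Y p l := by rw [X]

/-- The sum of the `T_v` over the shuffles of `a` positions from `p` on with the next `b`. -/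
def Sh : ℕ → ℕ → ℕ → A
  | _, 0, _ => 1
  | _, _ + 1, 0 => 1
  | p, a + 1, b + 1 => Sh (p + 1) a (b + 1) + Sh (p + 1) (a + 1) b * D.U p (a + 1)

/-- The longest shuffle: it moves the first `a` positions from `p` on past the next `b`. -/
def Lead : ℕ → ℕ → ℕ → A
  | _, _, 0 => 1
  | p, a, b + 1 => Lead (p + 1) a b * D.U p a

theorem Sh_zero_left (p b : ℕ) : D.Sh p 0 b = 1 := by unfold Sh; rfl

theorem Sh_zero_right (p a : ℕ) : D.Sh p a 0 = 1 := by cases a <;> (unfold Sh; rfl)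

/-- The smallest value `p` of a shuffle is taken at the first position of the first or of the second
block. In the second case the cycle that moves this position to the front splits off on the right.
-/
theorem Sh_succ (p a b : ℕ) : D.Sh p (a + 1) (b + 1) =
    D.Sh (p + 1) a (b + 1) + D.Sh (p + 1) (a + 1) b * D.U p (a + 1) := by
  rw [Sh]

theorem Lead_zero_left (p b : ℕ) : D.Lead p 0 b = 1 := by
  induction b generalizing p with
  | zero => rfl
  | succ b ih => rw [Lead, ih, U, mul_one]

section Semiconj

variable {D} {C : A} {p p' l : ℕ}

/-- Here and in the next three lemmas the element is built by sums and products from consecutive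
generators, so whatever intertwines the generators with shifted ones intertwines these elements too.
-/
theorem semiconj_U (h : ∀ j, 0 < j → j ≤ l → SemiconjBy C (D.T (p + j)) (D.T (p' + j))) :
    SemiconjBy C (D.U p l) (D.U p' l) := by
  induction l with
  | zero => exact SemiconjBy.one_right C
  | succ l ih =>
    exact (ih fun j h0 h1 => h j h0 (by omega)).mul_right (h (l + 1) (by omega) le_rfl)

theorem semiconj_Y (h : ∀ j, 0 < j → j ≤ l → SemiconjBy C (D.T (p + j)) (D.T (p' + j))) :
    SemiconjBy C (D.Y p l) (D.Y p' l) := by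
  unfold SemiconjBy Y
  rw [Finset.mul_sum, Finset.sum_mul]
  refine Finset.sum_congr rfl fun j hj => ?_
  rw [Finset.mem_range] at hj
  exact semiconj_U fun i h0 h1 => h i h0 (by omega)

theorem semiconj_X (h : ∀ j, 0 < j → j < l → SemiconjBy C (D.T (p + j)) (D.T (p' + j))) :
    SemiconjBy C (D.X p l) (D.X p' l) := by
  induction l generalizing p p' with
  | zero => unfold X; exact SemiconjBy.one_right C
  | succ l ih =>
    rw [X, X]
    refine (ih fun j h0 h1 => ?_).mul_right (semiconj_Y fun j h0 h1 => h j h0 (by omega))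
    have := h (j + 1) (by omega) (by omega)
    rwa [show p + (j + 1) = p + 1 + j by omega, show p' + (j + 1) = p' + 1 + j by omega] at this

theorem semiconj_Sh {a b : ℕ}
    (h : ∀ j, 0 < j → j < a + b → SemiconjBy C (D.T (p + j)) (D.T (p' + j))) :
    SemiconjBy C (D.Sh p a b) (D.Sh p' a b) := by
  induction hk : a + b generalizing a b p p' with
  | zero =>
    obtain ⟨rfl, rfl⟩ : a = 0 ∧ b = 0 := by omega
    rw [Sh_zero_left, Sh_zero_left]; exact SemiconjBy.one_right C
  | succ k ih =>
    have h' : ∀ j, 0 < j → j < k → SemiconjBy C (D.T (p + 1 + j)) (D.T (p' + 1 + j)) := by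
      intro j h0 h1
      have := h (j + 1) (by omega) (by omega)
      rwa [show p + (j + 1) = p + 1 + j by omega,
        show p' + (j + 1) = p' + 1 + j by omega] at this
    match a, b with
    | 0, b => rw [Sh_zero_left, Sh_zero_left]; exact SemiconjBy.one_right C
    | a + 1, 0 => rw [Sh_zero_right, Sh_zero_right]; exact SemiconjBy.one_right C
    | a + 1, b + 1 =>
      rw [Sh_succ, Sh_succ]
      refine (ih (fun j h0 h1 => h' j h0 (by omega)) (by omega)).add_right
        ((ih (fun j h0 h1 => h' j h0 (by omega)) (by omega)).mul_right
          (semiconj_U fun j h0 h1 => h j h0 (by omega)))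

theorem commute_X (h : ∀ i, p < i → i < p + l → Commute C (D.T i)) : Commute C (D.X p l) :=
  semiconj_X fun _ _ _ => h _ (by omega) (by omega)

theorem commute_U (h : ∀ i, p < i → i ≤ p + l → Commute C (D.T i)) : Commute C (D.U p l) :=
  semiconj_U fun _ _ _ => h _ (by omega) (by omega)

theorem commute_Y (h : ∀ i, p < i → i ≤ p + l → Commute C (D.T i)) : Commute C (D.Y p l) :=
  semiconj_Y fun _ _ _ => h _ (by omega) (by omega)

end Semiconj

/-- The braid relation lets `T i` pass leftwards through `T i * T (i + 1)`, where it becomes `T (i +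
1)`. All other factors commute with the letter that passes them. -/
theorem semiconj_U_T {p a i : ℕ} (h : p + a < n) (h0 : p < i) (h1 : i < p + a) :
    SemiconjBy (D.U p a) (D.T i) (D.T (i + 1)) := by
  obtain ⟨b, rfl⟩ : ∃ b, i = p + b + 1 := ⟨i - p - 1, by omega⟩
  obtain ⟨c, rfl⟩ : ∃ c, a = b + (2 + c) := ⟨a - b - 2, by omega⟩
  have c1 : Commute (D.U (p + b + 2) c) (D.T (p + b + 1)) :=
    (commute_U fun i h2 h3 => D.comm _ _ (by omega) (by omega) (by omega)).symm
  have c2 : Commute (D.T (p + b + 1 + 1)) (D.U p b) :=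
    commute_U fun i h2 h3 => (D.comm _ _ (by omega) (by omega) (by omega)).symm
  have hb := D.braid (p + b + 1) (by omega) (by omega)
  unfold SemiconjBy
  rw [U_add, U_add, show D.U (p + b) 2 = D.T (p + b + 1) * D.T (p + b + 1 + 1) by simp [U],
    ← mul_assoc (D.T (p + b + 1 + 1)) (D.U p b), c2.eq]
  simp only [mul_assoc] at hb ⊢
  rw [c1.eq]
  simp only [← mul_assoc] at hb ⊢
  rw [mul_assoc (D.U p b), mul_assoc (D.U p b), hb]
  simp only [mul_assoc]

theorem semiconj_U_X {p a : ℕ} (h : p + a < n) :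
    SemiconjBy (D.U p a) (D.X p a) (D.X (p + 1) a) :=
  semiconj_X fun j h0 h1 => by
    have := D.semiconj_U_T h (i := p + j) (by omega) (by omega)
    rwa [show p + j + 1 = p + 1 + j by omega] at this

theorem Y_add (p a b : ℕ) :
    D.Y p (a + 1 + b) = D.Y p a + D.U p (a + 1) * D.Y (p + a + 1) b := by
  unfold Y
  rw [show a + 1 + b + 1 = (a + 1) + (b + 1) by omega, Finset.sum_range_add, Finset.mul_sum]
  congr 1
  exact Finset.sum_congr rfl fun j _ => by rw [U_add]; rfl

/-- This is the decomposition of a symmetric group into shuffles times the Young subgroup of two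
blocks, on the level of sums. `Y_add` splits the last factor into the two cases of `Sh_succ`. -/
theorem X_add (p a b : ℕ) (h : p + (a + b) ≤ n) :
    D.X p (a + b) = D.Sh p a b * D.X p a * D.X (p + a) b := by
  induction hk : a + b generalizing a b p with
  | zero =>
    obtain ⟨rfl, rfl⟩ : a = 0 ∧ b = 0 := by omega
    simp [Sh_zero_left, X]
  | succ k ih =>
    match a, b with
    | 0, b => rw [← hk]; simp [Sh_zero_left, X]
    | a + 1, 0 => rw [← hk]; simp [Sh_zero_right, X]
    | a + 1, b + 1 =>
      have e1 : Commute (D.Y p a) (D.X (p + (a + 1)) (b + 1)) :=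
        commute_X fun i h0 h1 => (commute_Y fun j h2 h3 =>
          (D.comm j i (by omega) (by omega) (by omega)).symm).symm
      have e2 : Commute (D.U p (a + 1)) (D.X (p + (a + 1) + 1) b) :=
        commute_X fun i h0 h1 => (commute_U fun j h2 h3 =>
          (D.comm j i (by omega) (by omega) (by omega)).symm).symm
      have e3 := D.semiconj_U_X (p := p) (a := a + 1) (by omega)
      have i1 := ih (p + 1) a (b + 1) (by omega) (by omega)
      have i2 := ih (p + 1) (a + 1) b (by omega) (by omega)
      rw [show p + 1 + a = p + (a + 1) by omega] at i1
      rw [show p + 1 + (a + 1) = p + (a + 1) + 1 by omega] at i2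
      obtain rfl : k = a + 1 + b := by omega
      rw [Sh_succ, add_mul, add_mul, X, Y_add, mul_add]
      congr 1
      · rw [i1, D.X_succ p a]
        simp only [mul_assoc]
        rw [e1.eq]
      · rw [i2, D.X_succ (p + (a + 1)) b, mul_assoc _ (D.U p (a + 1)), e3.eq]
        simp only [mul_assoc]
        rw [← mul_assoc (D.U p (a + 1)) (D.X _ _), e2.eq]
        simp only [mul_assoc]
        rfl

theorem mul_U_mem_G {k p a : ℕ} (h : p + a < n) {x : A} (hx : x ∈ D.G k) :
    x * D.U p a ∈ D.G (k + a) := by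
  induction a with
  | zero => simpa [U] using hx
  | succ a ih =>
    rw [U, ← mul_assoc]
    exact D.mul_T_mem_G (by omega) (by omega) (ih (by omega))

theorem mul_Sh_mem_G {k p a b : ℕ} (h : p + (a + b) ≤ n) {x : A} (hx : x ∈ D.G k) :
    x * D.Sh p a b ∈ D.G (k + a * b) := by
  induction hm : a + b generalizing a b p k x with
  | zero =>
    obtain ⟨rfl, rfl⟩ : a = 0 ∧ b = 0 := by omega
    simpa [Sh_zero_left] using hx
  | succ m ih =>
    match a, b with
    | 0, b => simpa [Sh_zero_left] using hx
    | a + 1, 0 => simpa [Sh_zero_right] using hx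
    | a + 1, b + 1 =>
      rw [Sh_succ, mul_add x]
      have h1 := ih (a := a) (b := b + 1) (p := p + 1) (by omega) hx (by omega)
      refine add_mem (D.G_mono ?_ h1) ?_
      · nlinarith
      rw [← mul_assoc]
      refine D.G_mono (le_of_eq ?_) (D.mul_U_mem_G (p := p) (a := a + 1) (by omega)
        (ih (a := a + 1) (b := b) (p := p + 1) (by omega) hx (by omega)))
      ring

/-- Every shuffle except the longest has fewer than `a * b` inversions, so replacing `Sh` by `Lead`
changes a product only by shorter elements. This turns the Garnir relations into a straightening
rule. -/
theorem mul_Sh_sub_Lead_mem_G {k p a b : ℕ} (h : p + (a + b) ≤ n) {x : A}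
    (hx : x ∈ D.G (k + 1)) : x * (D.Sh p a b - D.Lead p a b) ∈ D.G (k + a * b) := by
  induction b generalizing p k x with
  | zero => simp [Sh_zero_right, Lead]
  | succ b ih =>
    match a with
    | 0 => simp [Sh_zero_left, Lead_zero_left]
    | a + 1 =>
      rw [Sh_succ, Lead, add_sub_assoc, ← sub_mul, mul_add x]
      have h1 := D.mul_Sh_mem_G (p := p + 1) (a := a) (b := b + 1) (by omega) hx
      refine add_mem (D.G_mono ?_ h1) ?_
      · nlinarith
      rw [← mul_assoc]
      refine D.G_mono (le_of_eq ?_) (D.mul_U_mem_G (p := p) (a := a + 1) (by omega)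
        (ih (p := p + 1) (by omega) hx))
      ring

end FinHecke

end ArikiKoike

/-! ### Cycles and factorizations of the elements `T_u` -/

namespace ArikiKoike

section Cycle

variable {n : ℕ}

/-- The cycle `s (p+1) ⋯ s (p+j)`, which maps `p + j` to `p`. -/
def cyc (n p : ℕ) : ℕ → Equiv.Perm (Fin n)
  | 0 => 1
  | j + 1 => cyc n p j * sw n (p + j + 1)

theorem ev_cyc {p j : ℕ} (h : p + j < n) (x : ℕ) :
    ev (cyc n p j) x = if x = p + j then p else if p ≤ x ∧ x < p + j then x + 1 else x := by
  induction j generalizing x with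
  | zero => rw [cyc, ev_one]; split_ifs <;> omega
  | succ j ih =>
    rw [cyc, ev_mul_sw (by omega) (by omega), Nat.add_sub_cancel, ih (by omega), ih (by omega),
      ih (by omega)]
    split_ifs <;> omega

theorem ev_mul_cyc_inv {u : Equiv.Perm (Fin n)} {p j x y : ℕ}
    (hxy : ev (cyc n p j) y = x) : ev (u * (cyc n p j)⁻¹) x = ev u y := by
  rw [ev_mul, ← hxy, ev_inv_ev]

/-- The permutations that preserve the labelling `f` and fix the letters below `p`. -/
noncomputable def labelStab (n : ℕ) (f : ℕ → ℕ) (p : ℕ) : Finset (Equiv.Perm (Fin n)) := by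
  classical
  exact Finset.univ.filter fun u => (∀ x < n, f (ev u x) = f x) ∧ ∀ x < p, ev u x = x

theorem mem_labelStab {f : ℕ → ℕ} {p : ℕ} {u : Equiv.Perm (Fin n)} :
    u ∈ labelStab n f p ↔ (∀ x < n, f (ev u x) = f x) ∧ ∀ x < p, ev u x = x := by
  simp [labelStab]

theorem labelStab_of_le {f : ℕ → ℕ} {p : ℕ} (h : n ≤ p) : labelStab n f p = {1} := by
  ext u
  rw [mem_labelStab, Finset.mem_singleton]
  constructor
  · rintro ⟨-, hu⟩
    exact perm_ext fun x hx => by rw [hu x (by omega), ev_one]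
  · rintro rfl
    simp

theorem inv_mem_labelStab {f : ℕ → ℕ} {p : ℕ} {u : Equiv.Perm (Fin n)}
    (h : u ∈ labelStab n f p) : u⁻¹ ∈ labelStab n f p := by
  rw [mem_labelStab] at h ⊢
  refine ⟨fun x hx => ?_, fun x hx => ?_⟩
  · rw [← h.1 _ (ev_lt _ hx), ev_ev_inv]
  · conv_lhs => rw [← h.2 x hx, ev_inv_ev]

end Cycle

namespace FinHecke

variable {R A : Type*} [CommRing R] [Ring A] [Algebra R A] {n : ℕ} (D : FinHecke R A n)

/-- Each letter of the cycle moves the value `ev u p` one place to the right, past a larger value,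
and so lengthens the permutation by one. -/
theorem tw_mul_cyc {u : Equiv.Perm (Fin n)} {p j : ℕ} (h : p + j < n)
    (hu : ∀ i, 0 < i → i ≤ j → ev u p < ev u (p + i)) :
    D.tw (u * cyc n p j) = D.tw u * D.U p j ∧ inv (u * cyc n p j) = inv u + j := by
  induction j with
  | zero => simp [cyc, U]
  | succ j ih =>
    obtain ⟨h1, h2⟩ := ih (by omega) fun i h0 h1 => hu i h0 (by omega)
    have hasc : ev (u * cyc n p j) (p + j + 1 - 1) < ev (u * cyc n p j) (p + j + 1) := by
      rw [Nat.add_sub_cancel, ev_mul, ev_mul, ev_cyc (by omega), ev_cyc (by omega), if_pos rfl,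
        if_neg (by omega), if_neg (by omega)]
      exact hu (j + 1) (by omega) le_rfl
    rw [cyc, ← mul_assoc]
    constructor
    · rw [D.tw_mul_sw (by omega) (by omega) hasc, h1, U, mul_assoc]
    · rw [inv_mul_sw (by omega) (by omega) hasc, h2]; omega

theorem tw_peel_cyc {u : Equiv.Perm (Fin n)} {p a : ℕ} (h : p + a < n)
    (hu : ∀ x, p ≤ x → x < p + a → ev u (p + a) < ev u x) :
    D.tw u = D.tw (u * (cyc n p a)⁻¹) * D.U p a ∧ inv u = inv (u * (cyc n p a)⁻¹) + a := by
  have := D.tw_mul_cyc (u := u * (cyc n p a)⁻¹) h (fun i h0 h1 => by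
    rw [ev_mul_cyc_inv (y := p + a) (by rw [ev_cyc h, if_pos rfl]),
      ev_mul_cyc_inv (y := p + i - 1) (by
        rw [ev_cyc h, if_neg (by omega), if_pos (by omega)]; omega)]
    exact hu _ (by omega) (by omega))
  rwa [inv_mul_cancel_right] at this

/-- If all values on the first block exceed those on the second, the values on the second block can
be moved to the front one by one, and each move splits off a run of length `a`. -/
theorem tw_peel_Lead {u : Equiv.Perm (Fin n)} {p a b : ℕ} (h : p + (a + b) ≤ n)
    (hu : ∀ x y, p ≤ x → x < p + a → p + a ≤ y → y < p + a + b → ev u y < ev u x) :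
    ∃ v, D.tw u = D.tw v * D.Lead p a b ∧ inv u = inv v + a * b := by
  induction b generalizing u p with
  | zero => exact ⟨u, by simp [Lead], by simp⟩
  | succ b ih =>
    obtain ⟨h1, h2⟩ := D.tw_peel_cyc (u := u) (p := p) (a := a) (by omega)
      fun x h0 h1 => hu x _ h0 h1 le_rfl (by omega)
    obtain ⟨v, h3, h4⟩ := ih (u := u * (cyc n p a)⁻¹) (p := p + 1) (by omega) (by
      intro x y hx0 hx1 hy0 hy1
      rw [ev_mul_cyc_inv (x := x) (y := x - 1) (by
          rw [ev_cyc (by omega), if_neg (by omega), if_pos (by omega)]; omega),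
        ev_mul_cyc_inv (x := y) (y := y) (by
          rw [ev_cyc (by omega), if_neg (by omega), if_neg (by omega)])]
      exact hu _ _ (by omega) (by omega) (by omega) (by omega))
    exact ⟨v, by rw [h1, h3, Lead, mul_assoc], by rw [h2, h4]; ring⟩

/-! ### Sums over Young subgroups -/

/-- Each `u` is uniquely a permutation fixing `p` times a cycle, whose length is the distance from
`p` to the preimage of `p`. The labels bound this distance by `m`, and `tw_mul_cyc` makes `T_u`
factor accordingly. -/
theorem sum_labelStab_succ {f : ℕ → ℕ} {p m : ℕ} (hp : p + m < n)
    (hf : ∀ x, p ≤ x → x < n → (f x = f p ↔ x ≤ p + m)) :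
    ∑ u ∈ labelStab n f p, D.tw u = (∑ u ∈ labelStab n f (p + 1), D.tw u) * D.Y p m := by
  rw [Y, Finset.sum_mul_sum, ← Finset.sum_product']
  symm
  have hk : ∀ u ∈ labelStab n f p, p ≤ ev u⁻¹ p ∧ ev u⁻¹ p ≤ p + m := by
    intro u hu
    have hu' := inv_mem_labelStab hu
    rw [mem_labelStab] at hu hu'
    have h1 : p ≤ ev u⁻¹ p := by
      by_contra hc
      have := hu.2 _ (not_le.1 hc)
      rw [ev_ev_inv] at this
      omega
    exact ⟨h1, (hf _ h1 (ev_lt _ (by omega))).1 (hu'.1 p (by omega))⟩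
  refine Finset.sum_bij' (fun a _ => a.1 * cyc n p a.2)
    (fun u _ => (u * (cyc n p (ev u⁻¹ p - p))⁻¹, ev u⁻¹ p - p)) ?_ ?_ ?_ ?_ ?_
  · rintro ⟨u, j⟩ ha
    rw [Finset.mem_product, Finset.mem_range, mem_labelStab] at ha
    obtain ⟨⟨h1, h2⟩, h3⟩ := ha
    simp only at h1 h2 h3 ⊢
    rw [mem_labelStab]
    have e := ev_cyc (n := n) (p := p) (j := j) (by omega)
    refine ⟨fun x hx => ?_, fun x hx => ?_⟩
    · rw [ev_mul, h1 _ (ev_lt _ hx), e]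
      split_ifs with hx1 hx2
      · rw [(hf x (by omega) hx).2 (by omega)]
      · rw [(hf x (by omega) hx).2 (by omega), (hf (x + 1) (by omega) (by omega)).2 (by omega)]
      · rfl
    · rw [ev_mul, e, if_neg (by omega), if_neg (by omega), h2 x (by omega)]
  · intro u hu
    obtain ⟨hk1, hk2⟩ := hk u hu
    rw [mem_labelStab] at hu
    rw [Finset.mem_product, Finset.mem_range, mem_labelStab]
    simp only
    set j := ev u⁻¹ p - p with hj
    have e := ev_cyc (n := n) (p := p) (j := j) (by omega)
    have e1 : ev (u * (cyc n p j)⁻¹) p = p := by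
      rw [ev_mul_cyc_inv (y := p + j) (by rw [e, if_pos rfl]), hj,
        show p + (ev u⁻¹ p - p) = ev u⁻¹ p by omega, ev_ev_inv]
    refine ⟨⟨fun x hx => ?_, fun x hx => ?_⟩, by omega⟩
    · rcases lt_trichotomy x p with h | rfl | h
      · rw [ev_mul_cyc_inv (y := x) (by rw [e, if_neg (by omega), if_neg (by omega)]),
          hu.1 x hx]
      · rw [e1]
      · by_cases h2 : x ≤ p + j
        · rw [ev_mul_cyc_inv (y := x - 1) (by
            rw [e, if_neg (by omega), if_pos (by omega)]; omega), hu.1 _ (by omega),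
            (hf x (by omega) hx).2 (by omega), (hf (x - 1) (by omega) (by omega)).2 (by omega)]
        · rw [ev_mul_cyc_inv (y := x) (by
            rw [e, if_neg (by omega), if_neg (by omega)]), hu.1 x hx]
    · rcases Nat.lt_or_ge x p with h | h
      · rw [ev_mul_cyc_inv (y := x) (by rw [e, if_neg (by omega), if_neg (by omega)]),
          hu.2 x h]
      · obtain rfl : x = p := by omega
        exact e1
  · rintro ⟨u, j⟩ ha
    rw [Finset.mem_product, Finset.mem_range, mem_labelStab] at ha
    obtain ⟨⟨h1, h2⟩, h3⟩ := ha
    simp only at h1 h2 h3 ⊢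
    have e := ev_cyc (n := n) (p := p) (j := j) (by omega)
    have : ev (u * cyc n p j)⁻¹ p = p + j := by
      have : ev (u * cyc n p j) (p + j) = p := by
        rw [ev_mul, e, if_pos rfl, h2 p (by omega)]
      rw [← ev_inv_ev (u * cyc n p j) (p + j), this]
    rw [this, Nat.add_sub_cancel_left, mul_inv_cancel_right]
  · intro u hu
    simp
  · rintro ⟨u, j⟩ ha
    rw [Finset.mem_product, Finset.mem_range, mem_labelStab] at ha
    obtain ⟨⟨h1, h2⟩, h3⟩ := ha
    simp only at h1 h2 h3 ⊢
    rw [(D.tw_mul_cyc (by omega) _).1]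
    intro i hi0 hi1
    rw [h2 p (by omega)]
    by_contra hc
    have h4 := h2 (ev u (p + i)) (by omega)
    have := ev_injective u h4
    rcases Nat.lt_or_ge (ev u (p + i)) (p + 1) with h5 | h5 <;> omega

theorem sum_labelStab_row {f : ℕ → ℕ} {p l : ℕ} (hp : p + l ≤ n)
    (hf : ∀ y, p ≤ y → y < p + l → ∀ x, y ≤ x → x < n → (f x = f y ↔ x < p + l)) :
    ∑ u ∈ labelStab n f p, D.tw u = (∑ u ∈ labelStab n f (p + l), D.tw u) * D.X p l := by
  induction l generalizing p with
  | zero => simp [X]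
  | succ l ih =>
    rw [D.sum_labelStab_succ (m := l) (by omega) (fun x h0 h1 => by
      rw [hf p le_rfl (by omega) x h0 h1]; omega), ih (by omega) (fun y h0 h1 x h2 h3 => by
      rw [hf y (by omega) (by omega) x h2 h3]; omega), X_succ, mul_assoc,
      show p + 1 + l = p + (l + 1) by omega]

/-- If the block has one common label and every other position its own, the label stabilizer is the
symmetric group of the block. The same labelling serves the opposite algebra, as `op_X` requires. -/
theorem X_eq_sum {p l : ℕ} (hp : p + l ≤ n) :
    ∃ f : ℕ → ℕ, D.X p l = ∑ u ∈ labelStab n f 0, D.tw u ∧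
      D.op.X p l = ∑ u ∈ labelStab n f 0, D.op.tw u := by
  let f : ℕ → ℕ := fun x => if p ≤ x ∧ x < p + l then p else x
  have hf : ∀ x, f x = if p ≤ x ∧ x < p + l then p else x := fun x => rfl
  have h1 : labelStab n f 0 = labelStab n f p := by
    ext u
    rw [mem_labelStab, mem_labelStab]
    refine ⟨fun h => ⟨h.1, fun x hx => ?_⟩, fun h => ⟨h.1, by simp⟩⟩
    by_cases hx' : x < n
    · have := h.1 x hx'
      rw [hf, hf] at this
      split_ifs at this <;> omega
    · rw [ev_of_le _ (not_lt.1 hx')]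
  have h2 : labelStab n f (p + l) = {1} := by
    ext u
    rw [mem_labelStab, Finset.mem_singleton]
    constructor
    · rintro ⟨h3, h4⟩
      apply perm_ext
      intro x hx
      rw [ev_one]
      rcases Nat.lt_or_ge x (p + l) with h | h
      · exact h4 x h
      · have h5 := h3 x hx
        rw [hf, hf] at h5
        by_contra h6
        split_ifs at h5 <;> omega
    · rintro rfl
      simp
  refine ⟨f, ?_, ?_⟩
  · rw [h1, D.sum_labelStab_row hp, h2]
    · simp
    · intro y h3 h4 x h5 h6
      rw [hf, hf]; split_ifs <;> omega
  · rw [h1, D.op.sum_labelStab_row hp, h2]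
    · simp
    · intro y h3 h4 x h5 h6
      rw [hf, hf]; split_ifs <;> omega

/-- A sum over a group is invariant under inversion. The recursion for `X` is one-sided, so this
symmetry is visible only through `X_eq_sum`. -/
theorem op_X {p l : ℕ} (hp : p + l ≤ n) : D.op.X p l = MulOpposite.op (D.X p l) := by
  obtain ⟨f, h1, h2⟩ := D.X_eq_sum hp
  rw [h1, h2, Finset.op_sum]
  refine Finset.sum_bij' (fun u _ => u⁻¹) (fun u _ => u⁻¹) (fun _ => inv_mem_labelStab)
    (fun _ => inv_mem_labelStab) (by simp) (by simp) ?_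
  intro u _
  rw [op_tw]

/-- Two uses of `X_add` isolate a factor `1 + T i` to the right of which stands only an element
commuting with `T i`. -/
theorem X_mul_T {p l i : ℕ} (h : p + l ≤ n) (h0 : p < i) (h1 : i < p + l) :
    D.X p l * D.T i = D.q • D.X p l := by
  obtain ⟨a, rfl⟩ : ∃ a, i = p + a + 1 := ⟨i - p - 1, by omega⟩
  obtain ⟨c, rfl⟩ : ∃ c, l = a + (2 + c) := ⟨l - a - 2, by omega⟩
  have h2 : D.X (p + a) 2 = 1 + D.T (p + a + 1) := by
    simp [X, Y, Finset.sum_range_succ, U]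
  have h3 : Commute (D.T (p + a + 1)) (D.X (p + a + 2) c) :=
    commute_X fun i _ _ => D.comm _ _ (by omega) (by omega) (by omega)
  have h4 : (1 + D.T (p + a + 1)) * D.T (p + a + 1) = D.q • (1 + D.T (p + a + 1)) := by
    rw [add_mul, D.quad _ (by omega) (by omega), sub_smul, smul_add]
    simp only [one_mul, one_smul]; abel
  rw [X_add _ _ _ _ h, X_add _ _ 2 c (by omega), h2]
  simp only [mul_assoc]
  rw [← h3.eq, ← mul_assoc (1 + D.T (p + a + 1)), h4]
  simp only [smul_mul_assoc, mul_smul_comm]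

theorem T_mul_X {p l i : ℕ} (h : p + l ≤ n) (h0 : p < i) (h1 : i < p + l) :
    D.T i * D.X p l = D.q • D.X p l := by
  have := D.op.X_mul_T h h0 h1
  rw [D.op_X h] at this
  exact MulOpposite.op_injective this

/-- The reflected shuffle sum. -/
def Shr (p a b : ℕ) : A := MulOpposite.unop (D.op.Sh p a b)

theorem X_add' (p a b : ℕ) (h : p + (a + b) ≤ n) :
    D.X p (a + b) = D.X (p + a) b * D.X p a * D.Shr p a b := by
  have := D.op.X_add p a b h
  rw [D.op_X h, D.op_X (by omega), D.op_X (by omega)] at this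
  have := congrArg MulOpposite.unop this
  simpa [Shr, mul_assoc] using this

/-! ### Exchanging two blocks -/

theorem semiconj_Lead_left {p a b j : ℕ} (h : p + (a + b) ≤ n) (h0 : 0 < j) (h1 : j < a) :
    SemiconjBy (D.Lead p a b) (D.T (p + j)) (D.T (p + b + j)) := by
  induction b generalizing p with
  | zero => exact SemiconjBy.one_left _
  | succ b ih =>
    rw [Lead]
    refine SemiconjBy.mul_left ?_ (D.semiconj_U_T (by omega) (by omega) (by omega))
    have := ih (p := p + 1) (by omega)
    rwa [show p + 1 + j = p + j + 1 by omega, show p + 1 + b + j = p + (b + 1) + j by omega] at this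

/-- The product regroups into pairs `T (i + 1) * T i`, each of which lowers by one the index of the
letter that passes through it from the right. -/
theorem semiconj_U_mul_U {p a : ℕ} (h : p + a + 1 < n) :
    SemiconjBy (D.U (p + 1) a * D.U p a) (D.T (p + a + 1)) (D.T (p + 1)) := by
  induction a with
  | zero => exact SemiconjBy.one_left _ |>.mul_left (SemiconjBy.one_left _)
  | succ a ih =>
    have c1 : Commute (D.T (p + a + 2)) (D.U p a) :=
      commute_U fun i _ _ => (D.comm _ _ (by omega) (by omega) (by omega)).symm
    have e : D.U (p + 1) (a + 1) * D.U p (a + 1) =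
        D.U (p + 1) a * D.U p a * (D.T (p + a + 2) * D.T (p + a + 1)) := by
      rw [U, U, show p + 1 + a + 1 = p + a + 2 by omega]
      simp only [mul_assoc]
      rw [← mul_assoc (D.T _) (D.U p a), c1.eq, mul_assoc]
    rw [e]
    refine SemiconjBy.mul_left (ih (by omega)) ?_
    have hb := D.braid (p + a + 1) (by omega) (by omega)
    unfold SemiconjBy
    rw [← mul_assoc]
    exact hb.symm

theorem semiconj_Lead_right {p a b j : ℕ} (h : p + (a + b) ≤ n) (h0 : 0 < j) (h1 : j < b) :
    SemiconjBy (D.Lead p a b) (D.T (p + a + j)) (D.T (p + j)) := by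
  induction b generalizing p j with
  | zero => omega
  | succ b ih =>
    rcases Nat.lt_or_ge 1 j with hj | hj
    · rw [Lead]
      have := ih (p := p + 1) (j := j - 1) (by omega) (by omega) (by omega)
      rw [show p + 1 + a + (j - 1) = p + a + j by omega,
        show p + 1 + (j - 1) = p + j by omega] at this
      refine this.mul_left (Commute.symm (commute_U fun i _ _ => ?_))
      exact (D.comm _ _ (by omega) (by omega) (by omega)).symm
    · obtain rfl : j = 1 := by omega
      obtain ⟨b, rfl⟩ : ∃ c, b = c + 1 := ⟨b - 1, by omega⟩
      rw [Lead, Lead, mul_assoc]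
      refine SemiconjBy.mul_left ?_ (D.semiconj_U_mul_U (by omega))
      have : ∀ (b p' : ℕ), p + 2 ≤ p' → p' + (a + b) ≤ n →
          Commute (D.Lead p' a b) (D.T (p + 1)) := by
        intro b
        induction b with
        | zero => intro p' _ _; exact Commute.one_left _
        | succ b ih2 =>
          intro p' h2 h3
          rw [Lead]
          exact (ih2 _ (by omega) (by omega)).mul_left
            (commute_U fun i _ _ => D.comm _ _ (by omega) (by omega) (by omega)).symm
      exact this b _ (by omega) (by omega)

theorem commute_Lead {C : A} {p a b : ℕ} (h : ∀ i, p < i → i < p + a + b → Commute C (D.T i)) :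
    Commute C (D.Lead p a b) := by
  induction b generalizing p with
  | zero => exact Commute.one_right _
  | succ b ih =>
    rw [Lead]
    exact (ih fun i _ _ => h i (by omega) (by omega)).mul_right
      (commute_U fun i _ _ => h i (by omega) (by omega))

/-- The longest shuffle carries the generators of each block to those of the same block in its new
place, hence also the symmetrizers. -/
theorem Lead_exchange {p a b : ℕ} (h : p + (a + b) ≤ n) :
    D.Lead p a b * (D.X (p + a) b * D.X p a) =
      D.X (p + b) a * D.X p b * D.Lead p a b := by
  have h1 : SemiconjBy (D.Lead p a b) (D.X p a) (D.X (p + b) a) :=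
    semiconj_X fun j h0 h1 => D.semiconj_Lead_left h h0 h1
  have h2 : SemiconjBy (D.Lead p a b) (D.X (p + a) b) (D.X p b) :=
    semiconj_X fun j h0 h1 => D.semiconj_Lead_right h h0 h1
  have h3 : Commute (D.X p b) (D.X (p + b) a) :=
    commute_X fun i _ _ => (commute_X fun j _ _ =>
      (D.comm _ _ (by omega) (by omega) (by omega)).symm).symm
  rw [← h3.eq, (h2.mul_right h1).eq]

theorem X_commute {p a p' b : ℕ} (h : p + a ≤ p') (h' : p' + b ≤ n) :
    Commute (D.X p a) (D.X p' b) :=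
  commute_X fun i _ _ => (commute_X fun j _ _ =>
    (D.comm _ _ (by omega) (by omega) (by omega)).symm).symm

end FinHecke

end ArikiKoike

/-! ### The relations of type `G(r,1,n)` -/

namespace ArikiKoike

/-- Elements `T 0, …, T (n-1)` of an `R`-algebra that satisfy the relations of the Hecke algebra
of `G(r,1,n)` with parameters `q` and `Q 0, …, Q (r-1)`. -/
structure HeckeDatum (R A : Type*) [CommRing R] [Ring A] [Algebra R A] (n r : ℕ)
    extends FinHecke R A n where
  qi : R
  q_mul_qi : q * qi = 1
  Q : ℕ → R
  cyclo : 0 < n → ((List.range r).map fun k => T 0 - algebraMap R A (Q k)).prod = 0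
  braidFour : 1 < n → T 0 * T 1 * T 0 * T 1 = T 1 * T 0 * T 1 * T 0
  comm_zero : ∀ j, 2 ≤ j → j < n → Commute (T 0) (T j)

namespace HeckeDatum

variable {R A : Type*} [CommRing R] [Ring A] [Algebra R A] {n r : ℕ} (D : HeckeDatum R A n r)

theorem qi_smul_q_smul (x : A) : D.qi • D.q • x = x := by
  rw [smul_smul, mul_comm, D.q_mul_qi, one_smul]

theorem isUnit_T {i : ℕ} (h0 : 0 < i) (h1 : i < n) : IsUnit (D.T i) := by
  have h := D.quad i h0 h1
  have h2 : D.T i * (D.qi • (D.T i - (D.q - 1) • 1)) = 1 := by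
    rw [mul_smul_comm, mul_sub, h, mul_smul_comm, mul_one, add_sub_cancel_left,
      D.qi_smul_q_smul]
  have h3 : (D.qi • (D.T i - (D.q - 1) • 1)) * D.T i = 1 := by
    rw [smul_mul_assoc, sub_mul, h, smul_mul_assoc, one_mul, add_sub_cancel_left,
      D.qi_smul_q_smul]
  exact ⟨⟨_, _, h2, h3⟩, rfl⟩

theorem isUnit_U {p a : ℕ} (h : p + a < n) : IsUnit (D.U p a) := by
  induction a with
  | zero => exact isUnit_one
  | succ a ih => exact (ih (by omega)).mul (D.isUnit_T (by omega) (by omega))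

theorem isUnit_Lead {p a b : ℕ} (h : p + (a + b) ≤ n) : IsUnit (D.Lead p a b) := by
  induction b generalizing p with
  | zero => exact isUnit_one
  | succ b ih => exact (ih (by omega)).mul (D.isUnit_U (by omega))

/-! ### Jucys–Murphy elements -/

/-- `L m = q^{-m} T m ⋯ T 1 T 0 T 1 ⋯ T m`. -/
def L : ℕ → A
  | 0 => D.T 0
  | m + 1 => D.qi • (D.T (m + 1) * L m * D.T (m + 1))

theorem commute_T_L_of_gt {i m : ℕ} (h : m + 2 ≤ i) (hi : i < n) :
    Commute (D.T i) (D.L m) := by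
  induction m with
  | zero => exact (D.comm_zero i h hi).symm
  | succ m ih =>
    have h1 : Commute (D.T i) (D.T (m + 1)) := (D.comm (m + 1) i (by omega) (by omega) hi).symm
    rw [L]
    exact ((h1.mul_right (ih (by omega))).mul_right h1).smul_right _

theorem commute_T_zero_L {m : ℕ} (h : 0 < m) (hm : m < n) : Commute (D.T 0) (D.L m) := by
  induction m with
  | zero => omega
  | succ m ih =>
    rw [L]
    refine Commute.smul_right ?_ _
    rcases Nat.eq_zero_or_pos m with rfl | hm0
    · have := D.braidFour (by omega)
      unfold Commute SemiconjBy
      simp only [L, zero_add, ← mul_assoc] at this ⊢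
      exact this
    · have h1 := D.comm_zero (m + 1) (by omega) hm
      exact (h1.mul_right (ih hm0 (by omega))).mul_right h1

/-- Only `m = i + 1` needs an argument. With two layers of `L` written out, a braid move turns `T i`
into `T (i + 1)`, which commutes with the inner `L (i - 1)`, and a second braid move on the other
side turns it back. -/
theorem commute_T_L_of_lt {i m : ℕ} (h0 : 0 < i) (h : i < m) (hm : m < n) :
    Commute (D.T i) (D.L m) := by
  induction m with
  | zero => omega
  | succ m ih =>
    rcases Nat.lt_or_ge i m with him | him
    · rw [L]
      have h1 : Commute (D.T i) (D.T (m + 1)) := D.comm i (m + 1) h0 (by omega) hm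
      exact ((h1.mul_right (ih him (by omega))).mul_right h1).smul_right _
    · obtain rfl : m = i := by omega
      obtain ⟨k, rfl⟩ : ∃ k, m = k + 1 := ⟨m - 1, by omega⟩
      rw [L, L]
      simp only [mul_smul_comm, smul_mul_assoc]
      refine Commute.smul_right (Commute.smul_right ?_ _) _
      have hb := D.braid (k + 1) (by omega) hm
      have hc := D.commute_T_L_of_gt (i := k + 1 + 1) (m := k) (by omega) hm
      unfold Commute SemiconjBy
      calc D.T (k + 1) * (D.T (k + 1 + 1) * (D.T (k + 1) * D.L k * D.T (k + 1)) *
            D.T (k + 1 + 1))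
          = (D.T (k + 1) * D.T (k + 1 + 1) * D.T (k + 1)) * D.L k * D.T (k + 1) *
            D.T (k + 1 + 1) := by simp only [mul_assoc]
        _ = D.T (k + 1 + 1) * D.T (k + 1) * (D.T (k + 1 + 1) * D.L k) * D.T (k + 1) *
            D.T (k + 1 + 1) := by rw [hb]; simp only [mul_assoc]
        _ = D.T (k + 1 + 1) * D.T (k + 1) * D.L k * (D.T (k + 1 + 1) * D.T (k + 1) *
            D.T (k + 1 + 1)) := by rw [hc.eq]; simp only [mul_assoc]
        _ = _ := by rw [← hb]; simp only [mul_assoc]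

theorem commute_L_L {l m : ℕ} (hl : l < n) (hm : m < n) : Commute (D.L l) (D.L m) := by
  have key : ∀ l m, l < m → m < n → Commute (D.L l) (D.L m) := by
    intro l
    induction l with
    | zero => intro m h hm; exact D.commute_T_zero_L h hm
    | succ l ih =>
      intro m h hm
      rw [L]
      have h1 := D.commute_T_L_of_lt (i := l + 1) (by omega) h hm
      exact ((h1.mul_left (ih m (by omega) hm)).mul_left h1).smul_left _
  rcases lt_trichotomy l m with h | rfl | h
  · exact key l m h hm
  · exact Commute.refl _
  · exact (key m l h hl).symm

theorem L_succ_mul_T {m : ℕ} (h : m + 1 < n) :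
    D.L (m + 1) * D.T (m + 1) = D.T (m + 1) * D.L m + (D.q - 1) • D.L (m + 1) := by
  rw [L, smul_mul_assoc, mul_assoc _ (D.T (m + 1)) (D.T (m + 1)), D.quad _ (by omega) h, mul_add,
    mul_smul_comm, mul_smul_comm, mul_one, smul_add, D.qi_smul_q_smul,
    smul_comm D.qi (D.q - 1), add_comm]

theorem T_mul_L_succ {m : ℕ} (h : m + 1 < n) :
    D.T (m + 1) * D.L (m + 1) = D.L m * D.T (m + 1) + (D.q - 1) • D.L (m + 1) := by
  rw [L, mul_smul_comm, ← mul_assoc, ← mul_assoc, D.quad _ (by omega) h, add_mul, add_mul,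
    smul_mul_assoc, smul_mul_assoc, smul_mul_assoc, smul_mul_assoc, one_mul, smul_add,
    D.qi_smul_q_smul, smul_comm D.qi (D.q - 1), add_comm]

/-- `T (m + 1)` commutes with the sum and with the product of `L m` and `L (m + 1)`, hence with this
symmetric polynomial in them. -/
theorem commute_T_sub_mul_sub {m : ℕ} (h : m + 1 < n) (c : R) :
    Commute (D.T (m + 1))
      ((D.L m - algebraMap R A c) * (D.L (m + 1) - algebraMap R A c)) := by
  have h1 := D.L_succ_mul_T h
  have h2 := D.T_mul_L_succ h
  have h3 := (D.commute_L_L (l := m) (m := m + 1) (by omega) h).eq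
  have hs : Commute (D.T (m + 1)) (D.L m + D.L (m + 1)) := by
    unfold Commute SemiconjBy
    rw [mul_add, add_mul, h1, h2]; abel
  have hp : Commute (D.T (m + 1)) (D.L m * D.L (m + 1)) := by
    unfold Commute SemiconjBy
    have h4 : D.T (m + 1) * D.L m = D.L (m + 1) * D.T (m + 1) - (D.q - 1) • D.L (m + 1) := by
      rw [h1]; abel
    rw [← mul_assoc, h4, sub_mul, mul_assoc, h2, mul_add, h3, mul_smul_comm, smul_mul_assoc,
      add_sub_cancel_right, mul_assoc]
  have e : (D.L m - algebraMap R A c) * (D.L (m + 1) - algebraMap R A c) =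
      D.L m * D.L (m + 1) - algebraMap R A c * (D.L m + D.L (m + 1)) +
        algebraMap R A c * algebraMap R A c := by
    rw [sub_mul, mul_sub, mul_sub, mul_add, ← Algebra.commutes c (D.L m)]; abel
  rw [e]
  have hc : Commute (D.T (m + 1)) (algebraMap R A c) := (Algebra.commutes c _).symm
  exact (hp.sub_right (hc.mul_right hs)).add_right (hc.mul_right hc)

/-- `(L 0 - c) ⋯ (L (a-1) - c)`. -/
def v (c : R) : ℕ → A
  | 0 => 1
  | a + 1 => v c a * (D.L a - algebraMap R A c)

theorem commute_v {C : A} {a : ℕ} (c : R) (h : ∀ m < a, Commute C (D.L m)) :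
    Commute C (D.v c a) := by
  induction a with
  | zero => exact Commute.one_right _
  | succ a ih =>
    exact (ih fun m hm => h m (by omega)).mul_right
      ((h a (by omega)).sub_right (Algebra.commutes c C).symm)

/-- The factors with `L (i - 1)` and `L i` are both present or both absent unless `a = i`. If
present, they commute with `T i` as a pair. -/
theorem commute_T_v {i a : ℕ} (c : R) (h0 : 0 < i) (h1 : i < n) (ha : a ≤ n) (hi : i ≠ a) :
    Commute (D.T i) (D.v c a) := by
  rcases Nat.lt_or_ge a i with h | h
  · exact D.commute_v c fun m hm => D.commute_T_L_of_gt (by omega) h1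
  · obtain ⟨j, rfl⟩ : ∃ j, i = j + 1 := ⟨i - 1, by omega⟩
    obtain ⟨b, rfl⟩ : ∃ b, a = j + 2 + b := ⟨a - (j + 2), by omega⟩
    induction b with
    | zero =>
      rw [add_zero, v, v, mul_assoc]
      exact (D.commute_v c fun m hm => D.commute_T_L_of_gt (by omega) h1).mul_right
        (D.commute_T_sub_mul_sub h1 c)
    | succ b ih =>
      rw [← add_assoc, v]
      exact (ih (by omega) (by omega) (by omega)).mul_right
        ((D.commute_T_L_of_lt (by omega) (by omega) (by omega)).sub_right
          (Algebra.commutes c _).symm)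

/-- The product of `v (Q j) (a j)` over `j < k`. -/
def uu (a : ℕ → ℕ) : ℕ → A
  | 0 => 1
  | k + 1 => uu a k * D.v (D.Q k) (a k)

theorem commute_uu {C : A} {a : ℕ → ℕ} {k : ℕ} (h : ∀ j < k, Commute C (D.v (D.Q j) (a j))) :
    Commute C (D.uu a k) := by
  induction k with
  | zero => exact Commute.one_right _
  | succ k ih => exact (ih fun j hj => h j (by omega)).mul_right (h k (by omega))

theorem commute_L_uu {m : ℕ} {a : ℕ → ℕ} {k : ℕ} (hm : m < n) (ha : ∀ j < k, a j ≤ n) :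
    Commute (D.L m) (D.uu a k) :=
  D.commute_uu fun j hj => D.commute_v _ fun l hl =>
    D.commute_L_L hm (by have := ha j hj; omega)

theorem commute_T_uu {i : ℕ} {a : ℕ → ℕ} {k : ℕ} (h0 : 0 < i) (h1 : i < n)
    (ha : ∀ j < k, a j ≤ n) (hi : ∀ j < k, i ≠ a j) : Commute (D.T i) (D.uu a k) :=
  D.commute_uu fun j hj => D.commute_T_v _ h0 h1 (ha j hj) (hi j hj)

theorem uu_congr {a a' : ℕ → ℕ} {k : ℕ} (h : ∀ j < k, a j = a' j) : D.uu a k = D.uu a' k := by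
  induction k with
  | zero => rfl
  | succ k ih => rw [uu, uu, ih fun j hj => h j (by omega), h k (by omega)]

theorem L_sub_mul_uu {a a' : ℕ → ℕ} {K k : ℕ} (hk : k < K) (ha : ∀ j < K, a j ≤ n)
    (hak : a k < n) (h : ∀ j, j ≠ k → a' j = a j) (h' : a' k = a k + 1) :
    (D.L (a k) - algebraMap R A (D.Q k)) * D.uu a K = D.uu a' K := by
  induction K with
  | zero => omega
  | succ K ih =>
    rcases Nat.lt_or_ge k K with hk' | hk'
    · rw [uu, uu, ← mul_assoc, ih hk' fun j hj => ha j (by omega), h K (by omega)]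
    · obtain rfl : K = k := by omega
      have h1 := (D.commute_L_uu (m := a K) (a := a) (k := K) hak fun j hj =>
        ha j (by omega)).sub_left (Algebra.commutes (D.Q K) (D.uu a K))
      have h2 : Commute (D.L (a K) - algebraMap R A (D.Q K)) (D.v (D.Q K) (a K)) :=
        Commute.sub_left (D.commute_v _ fun m hm => D.commute_L_L hak (by omega))
          (Algebra.commutes _ _)
      rw [uu, uu, ← mul_assoc, h1.eq, mul_assoc, h2.eq, h', v,
        D.uu_congr (a := a') (a' := a) fun j hj => h j (by omega)]

/-- Each `v (Q j) (a j)` with `j > 0` contains `L 0 - Q j`, and the extra factor supplies `L 0 - Q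
0`. So the cyclotomic polynomial in `T 0` divides the product. -/
theorem L_zero_sub_mul_uu {a : ℕ → ℕ} (hn : 0 < n) (hr : 0 < r) (ha : ∀ j < r, a j ≤ n)
    (h0 : a 0 = 0) (h1 : ∀ j, 0 < j → j < r → 0 < a j) :
    (D.L 0 - algebraMap R A (D.Q 0)) * D.uu a r = 0 := by
  have hv : ∀ c a, 0 < a → a ≤ n → ∃ w, D.v c a = (D.L 0 - algebraMap R A c) * w := by
    intro c a h0 h1
    obtain ⟨b, rfl⟩ : ∃ b, a = b + 1 := ⟨a - 1, by omega⟩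
    clear h0
    induction b with
    | zero => exact ⟨1, by simp [v]⟩
    | succ b ih =>
      obtain ⟨w, hw⟩ := ih (by omega)
      exact ⟨w * (D.L (b + 1) - algebraMap R A c), by rw [v, hw, mul_assoc]⟩
  have key : ∀ k, k < r → ∃ w, (D.L 0 - algebraMap R A (D.Q 0)) * D.uu a (k + 1) =
      ((List.range (k + 1)).map fun k => D.T 0 - algebraMap R A (D.Q k)).prod * w := by
    intro k
    induction k with
    | zero => intro _; exact ⟨1, by simp [uu, h0, v, L, List.range_succ]⟩
    | succ k ih =>
      intro hk
      obtain ⟨w, hw⟩ := ih (by omega)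
      obtain ⟨w', hw'⟩ := hv (D.Q (k + 1)) (a (k + 1)) (h1 _ (by omega) hk) (ha _ hk)
      have hc : Commute (D.L 0 - algebraMap R A (D.Q (k + 1)))
          ((D.L 0 - algebraMap R A (D.Q 0)) * D.uu a (k + 1)) := by
        refine Commute.sub_left ?_ (Algebra.commutes _ _)
        exact ((Commute.refl _).sub_right (Algebra.commutes (D.Q 0) (D.L 0)).symm).mul_right
          (D.commute_L_uu hn fun j hj => ha j (by omega))
      have hc2 : Commute (D.T 0 - algebraMap R A (D.Q (k + 1)))
          ((List.range (k + 1)).map fun k => D.T 0 - algebraMap R A (D.Q k)).prod := by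
        apply Commute.list_prod_right
        intro x hx
        obtain ⟨j, -, rfl⟩ := List.mem_map.1 hx
        exact Commute.sub_left ((Commute.refl _).sub_right (Algebra.commutes (D.Q j) (D.T 0)).symm)
          (Algebra.commutes _ _)
      refine ⟨w * w', ?_⟩
      rw [uu, ← mul_assoc, hw', ← mul_assoc, ← hc.eq, hw, List.range_succ (n := k + 1),
        List.map_append, List.prod_append, List.map_singleton, List.prod_singleton, ← hc2.eq]
      simp only [L, mul_assoc]
  obtain ⟨k, rfl⟩ : ∃ k, r = k + 1 := ⟨r - 1, by omega⟩
  obtain ⟨w, hw⟩ := key k (by omega)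
  rw [hw, D.cyclo hn, zero_mul]

end HeckeDatum

end ArikiKoike

namespace ArikiKoike

/-! ### Rows of multicompositions -/

/-- The number of boxes before row `s`. -/
def start (ρ : ℕ → ℕ) (s : ℕ) : ℕ := ∑ i ∈ Finset.range s, ρ i

@[simp] theorem start_zero (ρ : ℕ → ℕ) : start ρ 0 = 0 := rfl

theorem start_succ (ρ : ℕ → ℕ) (s : ℕ) : start ρ (s + 1) = start ρ s + ρ s :=
  Finset.sum_range_succ ρ s

theorem start_mono (ρ : ℕ → ℕ) : Monotone (start ρ) :=
  monotone_nat_of_le_succ fun s => by rw [start_succ]; omega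

theorem start_congr {ρ ρ' : ℕ → ℕ} {s : ℕ} (h : ∀ i < s, ρ i = ρ' i) :
    start ρ s = start ρ' s :=
  Finset.sum_congr rfl fun i hi => h i (Finset.mem_range.1 hi)

/-- The rows `s` and `s + 1` replaced by rows of lengths `a` and `b`. -/
def setRows (ρ : ℕ → ℕ) (s a b : ℕ) : ℕ → ℕ :=
  fun i => if i = s then a else if i = s + 1 then b else ρ i

section setRows

variable {ρ : ℕ → ℕ} {s a b : ℕ}

@[simp] theorem setRows_self : setRows ρ s a b s = a := if_pos rfl

@[simp] theorem setRows_succ : setRows ρ s a b (s + 1) = b := by simp [setRows]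

theorem setRows_of_ne {i : ℕ} (h : i ≠ s) (h' : i ≠ s + 1) : setRows ρ s a b i = ρ i := by
  simp [setRows, h, h']

theorem start_setRows_of_le {t : ℕ} (h : t ≤ s) : start (setRows ρ s a b) t = start ρ t :=
  start_congr fun i hi => setRows_of_ne (by omega) (by omega)

theorem start_setRows_succ : start (setRows ρ s a b) (s + 1) = start ρ s + a := by
  rw [start_succ, start_setRows_of_le le_rfl, setRows_self]

theorem start_setRows_of_ge (hab : a + b = ρ s + ρ (s + 1)) {t : ℕ} (h : s + 2 ≤ t) :
    start (setRows ρ s a b) t = start ρ t := by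
  obtain ⟨d, rfl⟩ : ∃ d, t = s + 2 + d := ⟨t - (s + 2), by omega⟩
  clear h
  induction d with
  | zero =>
    rw [add_zero, start_succ, start_setRows_succ, setRows_succ, start_succ, start_succ]; omega
  | succ d ih =>
    rw [← add_assoc, start_succ, ih, start_succ, setRows_of_ne (by omega) (by omega)]

theorem start_setRows (hab : a + b = ρ s + ρ (s + 1)) (t : ℕ) :
    start (setRows ρ s a b) t = if t = s + 1 then start ρ s + a else start ρ t := by
  split_ifs with h
  · rw [h, start_setRows_succ]
  · rcases Nat.lt_or_ge t (s + 1) with h1 | h1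
    · exact start_setRows_of_le (by omega)
    · exact start_setRows_of_ge hab (by omega)

end setRows

namespace FinHecke

variable {R A : Type*} [CommRing R] [Ring A] [Algebra R A] {n : ℕ} (D : FinHecke R A n)

/-- The product of the symmetrizers of the rows `s, …, s+t-1`, the last row first. -/
def P (ρ : ℕ → ℕ) (s : ℕ) : ℕ → A
  | 0 => 1
  | t + 1 => D.X (start ρ (s + t)) (ρ (s + t)) * P ρ s t

theorem P_add (ρ : ℕ → ℕ) (s t t' : ℕ) :
    D.P ρ s (t + t') = D.P ρ (s + t) t' * D.P ρ s t := by
  induction t' with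
  | zero => simp [P]
  | succ t' ih => rw [← add_assoc, P, ih, P, mul_assoc, add_assoc]

theorem P_congr {ρ ρ' : ℕ → ℕ} {s t : ℕ} (h : start ρ s = start ρ' s)
    (h' : ∀ i, s ≤ i → i < s + t → ρ i = ρ' i) : D.P ρ s t = D.P ρ' s t := by
  have key : ∀ j, j ≤ t → start ρ (s + j) = start ρ' (s + j) := by
    intro j
    induction j with
    | zero => intro _; exact h
    | succ j ih =>
      intro hj
      rw [← add_assoc, start_succ, start_succ, ih (by omega), h' _ (by omega) (by omega)]
  induction t with
  | zero => rfl
  | succ t ih =>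
    rw [P, P, key t (by omega), h' _ (by omega) (by omega),
      ih (fun i h0 h1 => h' i h0 (by omega)) fun j hj => key j (by omega)]

theorem commute_P {C : A} {ρ : ℕ → ℕ} {s t : ℕ}
    (h : ∀ j, start ρ s < j → j < start ρ (s + t) → Commute C (D.T j)) :
    Commute C (D.P ρ s t) := by
  induction t with
  | zero => exact Commute.one_right _
  | succ t ih =>
    have h1 := start_succ ρ (s + t)
    have h2 := start_mono ρ (show s ≤ s + t by omega)
    rw [← add_assoc] at h
    exact (commute_X fun j _ _ => h j (by omega) (by omega)).mul_right
      (ih fun j _ _ => h j (by omega) (by omega))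

theorem P_split (ρ : ℕ → ℕ) {s M : ℕ} (h : s + 2 ≤ M) :
    D.P ρ 0 M = D.P ρ (s + 2) (M - (s + 2)) * D.P ρ s 2 * D.P ρ 0 s := by
  have h1 := D.P_add ρ 0 (s + 2) (M - (s + 2))
  have h2 := D.P_add ρ 0 s 2
  rw [show s + 2 + (M - (s + 2)) = M by omega, zero_add] at h1
  rw [zero_add] at h2
  rw [h1, h2, mul_assoc]

theorem P_two (ρ : ℕ → ℕ) (s : ℕ) :
    D.P ρ s 2 = D.X (start ρ s + ρ s) (ρ (s + 1)) * D.X (start ρ s) (ρ s) := by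
  simp [P, start_succ]

theorem P_setRows_split {ρ : ℕ → ℕ} {s a b M : ℕ} (h : s + 2 ≤ M)
    (hab : a + b = ρ s + ρ (s + 1)) :
    D.P (setRows ρ s a b) 0 M = D.P ρ (s + 2) (M - (s + 2)) *
      (D.X (start ρ s + a) b * D.X (start ρ s) a) * D.P ρ 0 s := by
  rw [D.P_split _ h, P_two, start_setRows_of_le le_rfl, setRows_self, setRows_succ]
  congr 1
  · congr 1
    exact D.P_congr (start_setRows_of_ge hab le_rfl) fun i _ _ =>
      setRows_of_ne (by omega) (by omega)
  · exact D.P_congr rfl fun i _ _ => setRows_of_ne (by omega) (by omega)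

theorem T_mul_P {ρ : ℕ → ℕ} {s M i : ℕ} (hM : start ρ M ≤ n) (hs : s < M)
    (h0 : start ρ s < i) (h1 : i < start ρ s + ρ s) :
    D.T i * D.P ρ 0 M = D.q • D.P ρ 0 M := by
  have h2 := D.P_add ρ 0 (s + 1) (M - (s + 1))
  rw [show s + 1 + (M - (s + 1)) = M by omega, zero_add] at h2
  have h3 := start_mono ρ (show s + 1 ≤ M by omega)
  rw [start_succ] at h3
  have hc : Commute (D.T i) (D.P ρ (s + 1) (M - (s + 1))) := by
    refine D.commute_P fun j hj0 hj1 => ?_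
    rw [start_succ] at hj0
    rw [show s + 1 + (M - (s + 1)) = M by omega] at hj1
    exact D.comm _ _ (by omega) (by omega) (by omega)
  rw [h2, ← mul_assoc, hc.eq, mul_assoc, P, zero_add, ← mul_assoc (D.T i),
    D.T_mul_X (by omega) h0 h1]
  simp only [smul_mul_assoc, mul_smul_comm]

theorem commute_Sh {C : A} {p a b : ℕ} (h : ∀ i, p < i → i < p + (a + b) → Commute C (D.T i)) :
    Commute C (D.Sh p a b) :=
  semiconj_Sh fun _ _ _ => h _ (by omega) (by omega)

theorem commute_Shr {C : A} {p a b : ℕ} (h : ∀ i, p < i → i < p + (a + b) → Commute C (D.T i)) :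
    Commute C (D.Shr p a b) := by
  have : Commute (MulOpposite.op C) (D.op.Sh p a b) :=
    D.op.commute_Sh fun i h0 h1 => (h i h0 h1).op
  exact this.unop

end FinHecke

/-! ### Relations between the elements `m_ρ` -/

namespace HeckeDatum

variable {R A : Type*} [CommRing R] [Ring A] [Algebra R A] {n r : ℕ} (D : HeckeDatum R A n r)

/-- The element `m_ρ` of a multicomposition with `N` rows in each component. -/
def m (N : ℕ) (ρ : ℕ → ℕ) : A := D.uu (fun k => start ρ (k * N)) r * D.P ρ 0 (r * N)

variable {N : ℕ} {ρ : ℕ → ℕ}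

theorem before_le_of_start (h : start ρ (r * N) ≤ n) : ∀ k < r, start ρ (k * N) ≤ n :=
  fun k hk => (start_mono ρ (Nat.mul_le_mul_right N (by omega))).trans h

theorem start_ne_of_mem_row {s i : ℕ} (h0 : start ρ s < i) (h1 : i < start ρ s + ρ s) (t : ℕ) :
    i ≠ start ρ t := by
  rcases Nat.lt_or_ge s t with h | h
  · have := start_mono ρ (show s + 1 ≤ t from h)
    rw [start_succ] at this; omega
  · have := start_mono ρ h; omega

theorem T_mul_m (h : start ρ (r * N) ≤ n) {s i : ℕ} (hs : s < r * N) (h0 : start ρ s < i)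
    (h1 : i < start ρ s + ρ s) : D.T i * D.m N ρ = D.q • D.m N ρ := by
  have h2 : start ρ s + ρ s ≤ n := by
    rw [← start_succ]; exact (start_mono ρ (show s + 1 ≤ r * N from hs)).trans h
  have hc : Commute (D.T i) (D.uu (fun k => start ρ (k * N)) r) :=
    D.commute_T_uu (by omega) (by omega) (before_le_of_start h)
      fun j _ => start_ne_of_mem_row h0 h1 _
  rw [m, ← mul_assoc, hc.eq, mul_assoc, D.T_mul_P h hs h0 h1, mul_smul_comm]

theorem start_two (ρ : ℕ → ℕ) (s : ℕ) : start ρ (s + 2) = start ρ s + ρ s + ρ (s + 1) := by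
  rw [start_succ, start_succ]

/-- The rows of all components form one list, in which row `s` is row `s % N` of component `s / N`.
The condition `(s + 1) % N ≠ 0` says that rows `s` and `s + 1` belong to the same component, so no
component begins strictly inside their union. -/
theorem start_mul_ne {s i : ℕ} (hN : (s + 1) % N ≠ 0) (h0 : start ρ s < i)
    (h1 : i < start ρ (s + 2)) (k : ℕ) : i ≠ start ρ (k * N) := by
  have : k * N ≠ s + 1 := by rintro h; rw [← h] at hN; simp at hN
  rcases Nat.lt_or_ge s (k * N) with h | h
  · have := start_mono ρ (show s + 2 ≤ k * N by omega); omega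
  · have := start_mono ρ h; omega

theorem m_setRows {s a b : ℕ} (hs : s + 1 < r * N) (hN : (s + 1) % N ≠ 0)
    (hab : a + b = ρ s + ρ (s + 1)) :
    D.m N (setRows ρ s a b) = D.uu (fun k => start ρ (k * N)) r *
      (D.P ρ (s + 2) (r * N - (s + 2)) *
        (D.X (start ρ s + a) b * D.X (start ρ s) a) * D.P ρ 0 s) := by
  rw [m, D.P_setRows_split hs hab]
  congr 1
  refine D.uu_congr fun k _ => ?_
  rw [start_setRows hab, if_neg]
  rintro h; rw [← h] at hN; simp at hN

theorem m_split {s : ℕ} (hs : s + 1 < r * N) :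
    D.m N ρ = D.uu (fun k => start ρ (k * N)) r * (D.P ρ (s + 2) (r * N - (s + 2)) *
        (D.X (start ρ s + ρ s) (ρ (s + 1)) * D.X (start ρ s) (ρ s)) * D.P ρ 0 s) := by
  rw [m, D.P_split ρ hs, D.P_two]

theorem commute_T_uu_start (hn : start ρ (r * N) ≤ n) {s i : ℕ} (hs : s + 1 < r * N)
    (hN : (s + 1) % N ≠ 0) (h0 : start ρ s < i) (h1 : i < start ρ (s + 2)) :
    Commute (D.T i) (D.uu (fun k => start ρ (k * N)) r) := by
  have := start_mono ρ (show s + 2 ≤ r * N from hs)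
  exact D.commute_T_uu (by omega) (by omega) (before_le_of_start hn)
      fun j _ => start_mul_ne hN h0 h1 _

theorem commute_T_P_above (hn : start ρ (r * N) ≤ n) {s i : ℕ} (hs : s + 1 < r * N)
    (h0 : 0 < i) (h1 : i < start ρ (s + 2)) :
    Commute (D.T i) (D.P ρ (s + 2) (r * N - (s + 2))) := by
  refine D.commute_P fun j hj0 hj1 => ?_
  rw [show s + 2 + (r * N - (s + 2)) = r * N by omega] at hj1
  exact D.comm _ _ h0 (by omega) (by omega)

theorem commute_T_P_below {s i : ℕ} (h0 : start ρ s < i) (h1 : i < n) :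
    Commute (D.T i) (D.P ρ 0 s) := by
  refine D.commute_P fun j hj0 hj1 => ?_
  rw [zero_add] at hj1
  rw [start_zero] at hj0
  exact (D.comm _ _ (by omega) (by omega) (by omega)).symm

/-- A relation for moving boxes from a row to the previous one, within a component. -/
theorem Sh_mul_m (hn : start ρ (r * N) ≤ n) {s t : ℕ} (hs : s + 1 < r * N)
    (hN : (s + 1) % N ≠ 0) (ht : t ≤ ρ (s + 1))
    (h : D.m N (setRows ρ s (ρ s + t) (ρ (s + 1) - t)) = 0) :
    D.Sh (start ρ s) (ρ s) t * D.m N ρ = 0 := by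
  obtain ⟨b, hb⟩ : ∃ b, ρ (s + 1) = t + b := ⟨ρ (s + 1) - t, by omega⟩
  have h2 := start_two ρ s
  have h3 := (start_mono ρ (show s + 2 ≤ r * N from hs)).trans hn
  rw [D.m_setRows hs hN (by omega), hb, Nat.add_sub_cancel_left] at h
  have hX := D.X_add' (start ρ s + ρ s) t b (by omega)
  have hX2 := D.X_add (start ρ s) (ρ s) t (by omega)
  have c1 : Commute (D.Sh (start ρ s) (ρ s) t) (D.uu (fun k => start ρ (k * N)) r) :=
    (D.commute_Sh fun i h0 h1 =>
      (D.commute_T_uu_start hn hs hN h0 (by omega)).symm).symm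
  have c2 : Commute (D.Sh (start ρ s) (ρ s) t) (D.P ρ (s + 2) (r * N - (s + 2))) :=
    (D.commute_Sh fun i h0 h1 => (D.commute_T_P_above hn hs (by omega) (by omega)).symm).symm
  have c3 : Commute (D.Sh (start ρ s) (ρ s) t) (D.X (start ρ s + (ρ s + t)) b) :=
    FinHecke.commute_X fun i _ _ => (D.commute_Sh fun j _ _ =>
      (D.comm _ _ (by omega) (by omega) (by omega)).symm).symm
  have c4 : Commute (D.Shr (start ρ s + ρ s) t b) (D.P ρ 0 s) :=
    (D.commute_Shr fun i h0 h1 => (D.commute_T_P_below (by omega) (by omega)).symm).symm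
  have c5 : Commute (D.Shr (start ρ s + ρ s) t b) (D.X (start ρ s) (ρ s)) :=
    FinHecke.commute_X fun i _ _ => (D.commute_Shr fun j _ _ =>
      D.comm _ _ (by omega) (by omega) (by omega)).symm
  have c6 := D.X_commute (p := start ρ s) (a := ρ s) (p' := start ρ s + ρ s) (b := t) le_rfl
    (by omega)
  -- The symmetrizer of row `s + 1` is split after its first `t` boxes. The shuffle sum fuses these
  -- boxes with row `s`, and the remaining shuffles leave as a factor on the right.
  have e1 : D.Sh (start ρ s) (ρ s) t *
      (D.X (start ρ s + ρ s) (ρ (s + 1)) * D.X (start ρ s) (ρ s)) =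
      D.X (start ρ s + (ρ s + t)) b * D.X (start ρ s) (ρ s + t) *
        D.Shr (start ρ s + ρ s) t b := by
    rw [hb, hX, hX2, add_assoc (start ρ s)]
    calc _ = (D.Sh (start ρ s) (ρ s) t * D.X (start ρ s + (ρ s + t)) b) *
          D.X (start ρ s + ρ s) t * (D.Shr (start ρ s + ρ s) t b * D.X (start ρ s) (ρ s)) := by
            simp only [mul_assoc]
      _ = D.X (start ρ s + (ρ s + t)) b * D.Sh (start ρ s) (ρ s) t *
          (D.X (start ρ s + ρ s) t * D.X (start ρ s) (ρ s)) * D.Shr (start ρ s + ρ s) t b := by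
            rw [c3.eq, c5.eq]; simp only [mul_assoc]
      _ = _ := by rw [← c6.eq]; simp only [mul_assoc]
  calc D.Sh (start ρ s) (ρ s) t * D.m N ρ
      = D.uu (fun k => start ρ (k * N)) r * (D.P ρ (s + 2) (r * N - (s + 2)) *
        (D.Sh (start ρ s) (ρ s) t *
          (D.X (start ρ s + ρ s) (ρ (s + 1)) * D.X (start ρ s) (ρ s))) * D.P ρ 0 s) := by
        rw [D.m_split hs, ← mul_assoc, c1.eq]
        simp only [mul_assoc]
        rw [← mul_assoc (D.Sh _ _ _) (D.P _ _ _), c2.eq]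
        simp only [mul_assoc]
    _ = (D.uu (fun k => start ρ (k * N)) r * (D.P ρ (s + 2) (r * N - (s + 2)) *
        (D.X (start ρ s + (ρ s + t)) b * D.X (start ρ s) (ρ s + t)) * D.P ρ 0 s)) *
        D.Shr (start ρ s + ρ s) t b := by
        rw [e1]
        simp only [mul_assoc]
        rw [c4.eq]
    _ = 0 := by rw [h, zero_mul]

/-- Exchanging two rows of a component conjugates `m_ρ`. -/
theorem Lead_mul_m (hn : start ρ (r * N) ≤ n) {s : ℕ} (hs : s + 1 < r * N)
    (hN : (s + 1) % N ≠ 0) :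
    D.Lead (start ρ s) (ρ s) (ρ (s + 1)) * D.m N ρ =
      D.m N (setRows ρ s (ρ (s + 1)) (ρ s)) * D.Lead (start ρ s) (ρ s) (ρ (s + 1)) := by
  have h2 := start_two ρ s
  have h3 := (start_mono ρ (show s + 2 ≤ r * N from hs)).trans hn
  have hX := D.Lead_exchange (p := start ρ s) (a := ρ s) (b := ρ (s + 1)) (by omega)
  have c1 : Commute (D.Lead (start ρ s) (ρ s) (ρ (s + 1)))
      (D.uu (fun k => start ρ (k * N)) r) :=
    (D.commute_Lead fun i h0 h1 =>
      (D.commute_T_uu_start hn hs hN h0 (by omega)).symm).symm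
  have c2 : Commute (D.Lead (start ρ s) (ρ s) (ρ (s + 1)))
      (D.P ρ (s + 2) (r * N - (s + 2))) :=
    (D.commute_Lead fun i h0 h1 => (D.commute_T_P_above hn hs (by omega) (by omega)).symm).symm
  have c4 : Commute (D.Lead (start ρ s) (ρ s) (ρ (s + 1))) (D.P ρ 0 s) :=
    (D.commute_Lead fun i h0 h1 => (D.commute_T_P_below (by omega) (by omega)).symm).symm
  rw [D.m_setRows hs hN (by omega), D.m_split hs, ← mul_assoc, c1.eq]
  simp only [mul_assoc] at hX ⊢
  rw [← c4.eq, ← mul_assoc (D.Lead _ _ _) (D.P _ _ _), c2.eq]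
  simp only [mul_assoc]
  congr 2
  simp only [← mul_assoc] at hX ⊢
  rw [hX]

/-- A relation for moving the first box of a component to a new row of the previous component. -/
theorem L_sub_mul_m (hn : start ρ (r * N) ≤ n) {s k : ℕ} (hk : k < r) (hs : s + 1 = k * N)
    (h0 : ρ s = 0) (h1 : 0 < ρ (s + 1))
    (h : D.m N (setRows ρ s 1 (ρ (s + 1) - 1)) = 0) (hN : 0 < N) :
    (D.L (start ρ (k * N)) - algebraMap R A (D.Q k)) * D.m N ρ = 0 := by
  have hs' : s + 1 < r * N := by rw [hs]; exact Nat.mul_lt_mul_of_pos_right hk hN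
  obtain ⟨b, hb⟩ : ∃ b, ρ (s + 1) = b + 1 := ⟨ρ (s + 1) - 1, by omega⟩
  have h2 := start_two ρ s
  have h3 := (start_mono ρ (show s + 2 ≤ r * N from hs')).trans hn
  have h4 : start ρ (k * N) = start ρ s := by rw [← hs, start_succ, h0, add_zero]
  have hab : 1 + (ρ (s + 1) - 1) = ρ s + ρ (s + 1) := by omega
  -- The moved box now precedes component `k`, so `a_k` grows by one, and `L - Q k` is exactly the
  -- additional factor in the product for the new shape.
  have hu := D.L_sub_mul_uu (a := fun k => start ρ (k * N))
    (a' := fun k => start (setRows ρ s 1 (ρ (s + 1) - 1)) (k * N)) hk (before_le_of_start hn)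
    (by omega) (fun j hj => by
      rw [start_setRows hab, if_neg]
      rw [hs]
      exact fun h => hj (Nat.eq_of_mul_eq_mul_right hN h)) (by
      rw [start_setRows hab, if_pos hs.symm, h4])
  have c4 : Commute (D.Y (start ρ s) b) (D.P ρ 0 s) :=
    (FinHecke.commute_Y fun i _ _ => (D.commute_T_P_below (by omega) (by omega)).symm).symm
  rw [m, D.P_setRows_split hs' hab, hb, Nat.add_sub_cancel] at h
  simp only [hb, Nat.add_sub_cancel] at hu
  have hX1 : D.X (start ρ s) 1 = 1 := by simp [FinHecke.X, FinHecke.Y, FinHecke.U]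
  have hX0 : D.X (start ρ s) 0 = 1 := by simp [FinHecke.X]
  rw [D.m_split hs', ← mul_assoc, hu, h0, hb, hX0, mul_one, add_zero, D.X_succ]
  rw [hX1, mul_one] at h
  simp only [mul_assoc] at h ⊢
  rw [c4.eq]
  calc _ = (D.uu (fun k => start (setRows ρ s 1 b) (k * N)) r *
      (D.P ρ (s + 2) (r * N - (s + 2)) * (D.X (start ρ s + 1) b * D.P ρ 0 s))) *
        D.Y (start ρ s) b := by simp only [mul_assoc]
    _ = 0 := by rw [h, zero_mul]

theorem L_zero_sub_mul_m (hn : start ρ (r * N) ≤ n) (hr : 0 < r) (hN : 0 < N) (h : 0 < ρ 0) :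
    (D.L 0 - algebraMap R A (D.Q 0)) * D.m N ρ = 0 := by
  have h1 : ∀ j, 0 < j → 0 < start ρ (j * N) := fun j hj => by
    have := start_mono ρ (show 0 + 1 ≤ j * N from Nat.mul_pos hj hN)
    rw [start_succ] at this; omega
  have h2 := h1 r hr
  rw [m, ← mul_assoc, D.L_zero_sub_mul_uu (by omega) hr (before_le_of_start hn) (by simp)
    fun j h0 _ => h1 j h0, zero_mul]

/-- If `m_ρ = 0` for the multipartitions above `σ`, then also for the multicompositions. -/
theorem m_eq_zero_of_forall {σ : ℕ → ℕ} (hpart : ∀ ρ : ℕ → ℕ, start ρ (r * N) = n →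
      (∀ s, s + 1 < r * N → (s + 1) % N ≠ 0 → ρ (s + 1) ≤ ρ s) →
      (∀ s ≤ r * N, start σ s ≤ start ρ s) → (∃ s ≤ r * N, start σ s < start ρ s) →
      D.m N ρ = 0)
    (ρ : ℕ → ℕ) (hn : start ρ (r * N) = n) (h1 : ∀ s ≤ r * N, start σ s ≤ start ρ s)
    (h2 : ∃ s ≤ r * N, start σ s < start ρ s) : D.m N ρ = 0 := by
  -- The partial sums are bounded by `n`. Exchanging two rows that are in the wrong order raises one
  -- of them, so the total defect drops.
  induction hk : ∑ s ∈ Finset.range (r * N), (n - start ρ s) using Nat.strong_induction_on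
    generalizing ρ with
  | _ k ih =>
  by_cases hp : ∀ s, s + 1 < r * N → (s + 1) % N ≠ 0 → ρ (s + 1) ≤ ρ s
  · exact hpart ρ hn hp h1 h2
  · push Not at hp
    obtain ⟨s, hs, hN, hlt⟩ := hp
    have hst := start_setRows (ρ := ρ) (s := s) (a := ρ (s + 1)) (b := ρ s) (by omega)
    have h3 : ∀ t, start ρ t ≤ start (setRows ρ s (ρ (s + 1)) (ρ s)) t := by
      intro t
      rw [hst]
      split_ifs with h
      · rw [h, start_succ]; omega
      · exact le_rfl
    have h4 := start_two ρ s
    have h5 := (start_mono ρ (show s + 2 ≤ r * N from hs)).trans hn.le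
    have h0 : D.m N (setRows ρ s (ρ (s + 1)) (ρ s)) = 0 := by
      refine ih _ ?_ _ ?_ (fun t ht => (h1 t ht).trans (h3 t)) ?_ rfl
      · rw [← hk]
        refine Finset.sum_lt_sum (fun t _ => by have := h3 t; omega)
          ⟨s + 1, Finset.mem_range.2 hs, ?_⟩
        rw [hst, if_pos rfl, start_succ]; omega
      · rw [hst, if_neg (by omega), hn]
      · obtain ⟨t, ht, ht'⟩ := h2
        exact ⟨t, ht, ht'.trans_le (h3 t)⟩
    -- `m_ρ` is conjugate by the unit `Lead` to the element of the exchanged rows, which vanishes by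
    -- induction.
    have h6 := D.Lead_mul_m hn.le hs hN
    rw [h0, zero_mul] at h6
    exact (D.isUnit_Lead (by omega)).mul_right_eq_zero.1 h6

end HeckeDatum

end ArikiKoike

/-! ### Garnir relations, contents and straightening -/

namespace ArikiKoike

namespace FinHecke

variable {R A : Type*} [CommRing R] [Ring A] [Algebra R A] {n : ℕ} (D : FinHecke R A n)

/-- `T (p+a) ⋯ T (p+1)`. -/
def Dn (p a : ℕ) : A := MulOpposite.unop (D.op.U p a)

@[simp] theorem Dn_zero (p : ℕ) : D.Dn p 0 = 1 := rfl

theorem Dn_succ (p a : ℕ) : D.Dn p (a + 1) = D.T (p + a + 1) * D.Dn p a := rfl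

theorem semiconj_Dn_T {p a i : ℕ} (h : p + a < n) (h0 : p < i) (h1 : i < p + a) :
    SemiconjBy (D.Dn p a) (D.T (i + 1)) (D.T i) := by
  have := D.op.semiconj_U_T h h0 h1
  exact (congrArg MulOpposite.unop this).symm

theorem Sh_succ_one (p a : ℕ) : D.Sh p (a + 1) 1 = D.Sh (p + 1) a 1 + D.U p (a + 1) := by
  rw [Sh_succ, Sh_zero_right, one_mul]

theorem Sh_succ_one' (p a : ℕ) : D.Sh p (a + 1) 1 = 1 + D.Sh p a 1 * D.T (p + a + 1) := by
  induction a generalizing p with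
  | zero => simp [Sh_succ, Sh_zero_left, Sh_zero_right, U]
  | succ a ih =>
    rw [Sh_succ_one, ih, Sh_succ_one, add_mul, U, show p + 1 + a + 1 = p + (a + 1) + 1 by omega]
    abel

theorem T_mul_tw (u : Equiv.Perm (Fin n)) {i : ℕ} (h0 : 0 < i) (h1 : i < n) :
    D.T i * D.tw u = D.tw (sw n i * u) ∨
      D.T i * D.tw u = (D.q - 1) • D.tw u + D.q • D.tw (sw n i * u) := by
  rcases lt_or_gt_of_ne (ev_pred_ne u⁻¹ h0) with h | h
  · left
    have := congrArg MulOpposite.unop (D.op.tw_mul_sw h0 h1 h)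
    simp only [op_tw, mul_inv_rev, sw_inv, inv_inv] at this
    exact this.symm
  · right
    have := congrArg MulOpposite.unop (D.op.tw_mul_T_of_gt h0 h1 h)
    simp only [op_tw, mul_inv_rev, sw_inv, inv_inv] at this
    exact this

theorem T_mul_tw_of_lt {u : Equiv.Perm (Fin n)} {i : ℕ} (h0 : 0 < i) (h1 : i < n)
    (h : ev u⁻¹ (i - 1) < ev u⁻¹ i) : D.T i * D.tw u = D.tw (sw n i * u) := by
  have := congrArg MulOpposite.unop (D.op.tw_mul_sw h0 h1 h)
  simp only [op_tw, mul_inv_rev, sw_inv, inv_inv] at this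
  exact this.symm

end FinHecke

/-! ### Standardness -/

/-- `u` increases along the rows and down the columns of the diagram with rows `σ`
(`N` rows in each of `r` components), whose boxes are numbered along the rows. -/
structure RowColIncreasing {n : ℕ} (r N : ℕ) (σ : ℕ → ℕ) (u : Equiv.Perm (Fin n)) : Prop where
  row : ∀ s < r * N, ∀ c, c + 1 < σ s → ev u (start σ s + c) < ev u (start σ s + c + 1)
  col : ∀ s, s + 1 < r * N → (s + 1) % N ≠ 0 → ∀ c < σ (s + 1),
    ev u (start σ s + c) < ev u (start σ (s + 1) + c)

namespace HeckeDatum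

variable {R A : Type*} [CommRing R] [Ring A] [Algebra R A] {n r : ℕ} (D : HeckeDatum R A n r)

/-- The elements `m_ρ` vanish for the multicompositions `ρ` above `σ`. -/
def Vanishes (N : ℕ) (σ : ℕ → ℕ) : Prop :=
  ∀ ρ : ℕ → ℕ, start ρ (r * N) = n → (∀ s ≤ r * N, start σ s ≤ start ρ s) →
    (∃ s ≤ r * N, start σ s < start ρ s) → D.m N ρ = 0

/-- The rows `σ` form a multipartition of `n`, with an empty last row in each component. -/
structure IsRows (n r N : ℕ) (σ : ℕ → ℕ) : Prop where
  pos : 0 < N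
  total : start σ (r * N) = n
  anti : ∀ s, s + 1 < r * N → (s + 1) % N ≠ 0 → σ (s + 1) ≤ σ s
  last : ∀ s, s + 1 < r * N → (s + 1) % N = 0 → σ s = 0

variable {D} {N : ℕ} {σ : ℕ → ℕ}

/-- Moving `t > 0` boxes up by one row raises a single partial sum and changes no other, so the new
shape lies above `σ`. -/
theorem Vanishes.setRows (hv : D.Vanishes N σ) (hσ : IsRows n r N σ) {s t : ℕ}
    (hs : s + 1 < r * N) (h0 : 0 < t) (ht : t ≤ σ (s + 1)) :
    D.m N (setRows σ s (σ s + t) (σ (s + 1) - t)) = 0 := by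
  have h := start_setRows (ρ := σ) (s := s) (a := σ s + t) (b := σ (s + 1) - t) (by omega)
  refine hv _ ?_ ?_ ⟨s + 1, hs.le, ?_⟩
  · rw [h, if_neg (by omega), hσ.total]
  · intro i _
    rw [h]
    split_ifs with h1
    · rw [h1, start_succ]; omega
    · exact le_rfl
  · rw [h, if_pos rfl, start_succ]; omega

theorem IsRows.start_two_le (hσ : IsRows n r N σ) {s : ℕ} (hs : s + 1 < r * N) :
    start σ s + σ s + σ (s + 1) ≤ n := by
  rw [← start_two]
  exact (start_mono σ (show s + 2 ≤ r * N from hs)).trans hσ.total.le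

theorem IsRows.start_add_le (hσ : IsRows n r N σ) {s : ℕ} (hs : s < r * N) :
    start σ s + σ s ≤ n := by
  rw [← start_succ]
  exact (start_mono σ (show s + 1 ≤ r * N from hs)).trans hσ.total.le

theorem U_mul_m (hσ : IsRows n r N σ) {s p y : ℕ} (hs : s < r * N) (h0 : start σ s ≤ p)
    (h1 : y = 0 ∨ p + y < start σ s + σ s) :
    D.U p y * D.m N σ = D.q ^ y • D.m N σ := by
  induction y with
  | zero => simp [FinHecke.U]
  | succ y ih =>
    rw [FinHecke.U, mul_assoc, D.T_mul_m hσ.total.le hs (by omega) (by omega), mul_smul_comm,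
      ih (by omega), smul_smul, pow_succ, mul_comm]

theorem Dn_mul_m (hσ : IsRows n r N σ) {s p y : ℕ} (hs : s < r * N) (h0 : start σ s ≤ p)
    (h1 : y = 0 ∨ p + y < start σ s + σ s) :
    D.Dn p y * D.m N σ = D.q ^ y • D.m N σ := by
  induction y with
  | zero => simp
  | succ y ih =>
    rw [FinHecke.Dn_succ, mul_assoc, ih (by omega), mul_smul_comm,
      D.T_mul_m hσ.total.le hs (by omega) (by omega), smul_smul, pow_succ]

/-- Garnir relations. -/
theorem Garnir (hσ : IsRows n r N σ) (hv : D.Vanishes N σ) {s : ℕ} (hs : s + 1 < r * N)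
    (hN : (s + 1) % N ≠ 0) {x y : ℕ} (hxy : x < y) (hx : x ≤ σ s) (hy : y ≤ σ (s + 1)) :
    D.Sh (start σ s + x) (σ s - x) y * D.m N σ = 0 := by
  have hle := hσ.start_two_le hs
  induction x generalizing y with
  | zero =>
    exact D.Sh_mul_m hσ.total.le hs hN hy (hv.setRows hσ hs (by omega) hy)
  | succ x ih =>
    obtain ⟨z, rfl⟩ : ∃ z, y = z + 1 := ⟨y - 1, by omega⟩
    obtain ⟨a, ha⟩ : ∃ a, σ s = x + 1 + a := ⟨σ s - (x + 1), by omega⟩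
    have h1 := ih (y := z + 1) (by omega) (by omega) hy
    have h2 := ih (y := z) (by omega) (by omega) (by omega)
    rw [show σ s - x = a + 1 by omega] at h1 h2
    rw [show σ s - (x + 1) = a by omega, ← add_assoc]
    rw [FinHecke.Sh_succ, add_mul] at h1
    -- `h1` is the wanted relation plus a term containing `U`, and this term vanishes. Indeed the
    -- longer run, whose last `z` letters act on `m` by `q`, carries the shuffle sum of `h2` to the
    -- one in that term, and `h2` holds by induction because `x < z`.
    have h3 : SemiconjBy (D.U (start σ s + x) (a + 1 + z)) (D.Sh (start σ s + x) (a + 1) z)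
        (D.Sh (start σ s + x + 1) (a + 1) z) :=
      FinHecke.semiconj_Sh fun j h0 h1 => by
        have := D.semiconj_U_T (p := start σ s + x) (a := a + 1 + z) (i := start σ s + x + j)
          (by omega) (by omega) (by omega)
        rwa [show start σ s + x + j + 1 = start σ s + x + 1 + j by omega] at this
    have h4 : D.U (start σ s + x) (a + 1 + z) * D.m N σ =
        D.q ^ z • (D.U (start σ s + x) (a + 1) * D.m N σ) := by
      rw [FinHecke.U_add, mul_assoc, U_mul_m hσ (s := s + 1) hs
        (by rw [start_succ]; omega) (by rw [start_succ]; omega), mul_smul_comm]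
    have h5 : D.Sh (start σ s + x + 1) (a + 1) z * D.U (start σ s + x) (a + 1) * D.m N σ = 0 := by
      have h6 : D.q ^ z • (D.Sh (start σ s + x + 1) (a + 1) z * D.U (start σ s + x) (a + 1) *
          D.m N σ) = 0 := by
        rw [mul_assoc, ← mul_smul_comm, ← h4, ← mul_assoc, ← h3.eq, mul_assoc, h2, mul_zero]
      have h7 := congrArg (fun w => D.qi ^ z • w) h6
      simpa only [smul_smul, ← mul_pow, mul_comm D.qi, D.q_mul_qi, one_pow, one_smul,
        smul_zero] using h7
    rwa [h5, add_zero] at h1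

/-! ### Contents -/

variable (D) in
/-- The content of the box in column `c` of row `s`. -/
def cont (N s c : ℕ) : R := D.Q (s / N) * D.q ^ c * D.qi ^ (s % N)

theorem L_eq_Dn_mul (p l : ℕ) :
    D.L (p + l) = D.qi ^ l • (D.Dn p l * D.L p * D.U p l) := by
  induction l with
  | zero => simp [FinHecke.U]
  | succ l ih =>
    rw [← add_assoc, L, ih, FinHecke.Dn_succ, FinHecke.U]
    simp only [mul_smul_comm, smul_mul_assoc, smul_smul, mul_assoc, pow_succ, mul_comm D.qi]

/-- At the first row of a component this is the cyclotomic relation or the relation that moves a box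
to the previous component. In later rows the Garnir relation for `x = 0`, `y = 1` expresses `U * m`
through elements that commute with the `L` of the previous row. So that `L` acts on `U * m` by the
previous content, and the sandwich `L_eq_Dn_mul` contributes the factor `qi`. -/
theorem L_start_mul_m (hσ : IsRows n r N σ) (hv : D.Vanishes N σ) {s : ℕ} (hs : s < r * N)
    (h0 : 0 < σ s) : D.L (start σ s) * D.m N σ = D.cont N s 0 • D.m N σ := by
  have hfin : ∀ (x : A) (c : R), (x - algebraMap R A c) * D.m N σ = 0 →
      x * D.m N σ = c • D.m N σ := by
    intro x c h
    rw [sub_mul, sub_eq_zero, ← Algebra.smul_def] at h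
    exact h
  have hr : 0 < r := by
    rcases Nat.eq_zero_or_pos r with rfl | h
    · simp at hs
    · exact h
  induction s with
  | zero =>
    rw [start_zero, show D.cont N 0 0 = D.Q 0 by simp [cont]]
    exact hfin _ _ (D.L_zero_sub_mul_m hσ.total.le hr hσ.pos h0)
  | succ s ih =>
    by_cases hN : (s + 1) % N = 0
    · obtain ⟨k, hk⟩ : ∃ k, s + 1 = k * N := ⟨(s + 1) / N, by
        rw [Nat.div_mul_cancel (Nat.dvd_of_mod_eq_zero hN)]⟩
      have h1 := hσ.last s hs hN
      have hkr : k < r := by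
        rw [hk] at hs; exact Nat.lt_of_mul_lt_mul_right hs
      have h2 := hv.setRows hσ hs (t := 1) (by omega) h0
      rw [h1, zero_add] at h2
      have := D.L_sub_mul_m hσ.total.le hkr hk h1 h0 h2 hσ.pos
      have e : D.cont N (s + 1) 0 = D.Q k := by
        rw [cont, hN, hk, Nat.mul_div_cancel _ hσ.pos]; simp
      rw [e, hk]
      exact hfin _ _ this
    · have h1 := hσ.anti s hs hN
      have hle := hσ.start_two_le hs
      obtain ⟨l, hl⟩ : ∃ l, σ s = l + 1 := ⟨σ s - 1, by omega⟩
      have hi := ih (by omega) (by omega)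
      have hG := Garnir hσ hv hs hN (x := 0) (y := 1) (by omega) (by omega) h0
      rw [add_zero, Nat.sub_zero, hl] at hG
      have hG' := hG
      rw [FinHecke.Sh_succ_one, add_mul] at hG
      rw [FinHecke.Sh_succ_one', add_mul, one_mul] at hG'
      have hU : D.U (start σ s) (l + 1) * D.m N σ =
          -(D.Sh (start σ s + 1) l 1 * D.m N σ) := eq_neg_of_add_eq_zero_right hG
      have hT : D.Sh (start σ s) l 1 * D.T (start σ s + l + 1) * D.m N σ = -D.m N σ :=
        eq_neg_of_add_eq_zero_right hG'
      have hc : Commute (D.L (start σ s)) (D.Sh (start σ s + 1) l 1) :=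
        D.commute_Sh fun i _ _ => (D.commute_T_L_of_gt (by omega) (by omega)).symm
      have hLU : D.L (start σ s) * (D.U (start σ s) (l + 1) * D.m N σ) =
          D.cont N s 0 • (D.U (start σ s) (l + 1) * D.m N σ) := by
        rw [hU, mul_neg, ← mul_assoc, hc.eq, mul_assoc, hi, mul_smul_comm, smul_neg]
      have hS : SemiconjBy (D.Dn (start σ s) (l + 1)) (D.Sh (start σ s + 1) l 1)
          (D.Sh (start σ s) l 1) :=
        FinHecke.semiconj_Sh fun j h0 h1 => by
          have := D.semiconj_Dn_T (p := start σ s) (a := l + 1) (i := start σ s + j)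
            (by omega) (by omega) (by omega)
          rwa [show start σ s + j + 1 = start σ s + 1 + j by omega] at this
      -- The same Garnir relation is used twice: expanded at its left end it rewrites `U * m`, and
      -- expanded at its right end, by `Sh_succ_one'`, it evaluates the result.
      have hDU : D.Dn (start σ s) (l + 1) * (D.U (start σ s) (l + 1) * D.m N σ) =
          D.q ^ l • D.m N σ := by
        rw [hU, mul_neg, ← mul_assoc, hS.eq, mul_assoc, FinHecke.Dn_succ,
          mul_assoc (D.T _) (D.Dn _ _),
          Dn_mul_m hσ (s := s) (by omega) le_rfl (by omega), mul_smul_comm, mul_smul_comm,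
          ← mul_assoc, hT, smul_neg, neg_neg]
      have hm : (s + 1) / N = s / N ∧ (s + 1) % N = s % N + 1 := by
        have h2 : (s + 1) / N = s / N := by
          rw [Nat.succ_div, if_neg (fun h => hN (Nat.mod_eq_zero_of_dvd h)), add_zero]
        have h3 := Nat.div_add_mod s N
        have h4 := Nat.div_add_mod (s + 1) N
        rw [h2] at h4
        exact ⟨h2, by omega⟩
      have e : D.cont N (s + 1) 0 = D.qi * D.cont N s 0 := by
        rw [cont, cont, hm.1, hm.2]; ring
      have eq : D.qi ^ (l + 1) * D.cont N s 0 * D.q ^ l = D.qi * D.cont N s 0 := by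
        have : D.qi ^ l * D.q ^ l = 1 := by rw [← mul_pow, mul_comm, D.q_mul_qi, one_pow]
        rw [pow_succ]
        linear_combination D.qi * D.cont N s 0 * this
      rw [start_succ, hl, L_eq_Dn_mul, smul_mul_assoc, mul_assoc, mul_assoc, hLU, mul_smul_comm,
        hDU, smul_smul, smul_smul, e, ← eq, mul_assoc]

theorem L_mul_m (hσ : IsRows n r N σ) (hv : D.Vanishes N σ) {s c : ℕ} (hs : s < r * N)
    (hc : c < σ s) : D.L (start σ s + c) * D.m N σ = D.cont N s c • D.m N σ := by
  induction c with
  | zero => exact L_start_mul_m hσ hv hs hc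
  | succ c ih =>
    have h1 := D.T_mul_m hσ.total.le hs (i := start σ s + c + 1) (by omega) (by omega)
    have e : D.cont N s (c + 1) = D.qi * (D.q * (D.cont N s c * D.q)) := by
      rw [cont, cont]
      have := D.q_mul_qi
      linear_combination -(D.Q (s / N) * D.q ^ (c + 1) * D.qi ^ (s % N)) * this
    rw [← add_assoc, L, smul_mul_assoc, mul_assoc, h1, mul_smul_comm, mul_assoc,
      ih (by omega), mul_smul_comm, h1, smul_smul, smul_smul, smul_smul, e]
    congr 1; ring

theorem IsRows.exists_row (hσ : IsRows n r N σ) {x : ℕ} (hx : x < n) :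
    ∃ s c, s < r * N ∧ c < σ s ∧ x = start σ s + c := by
  have key : ∀ M, x < start σ M → ∃ s c, s < M ∧ c < σ s ∧ x = start σ s + c := by
    intro M
    induction M with
    | zero => intro h; simp at h
    | succ M ih =>
      intro h
      rcases Nat.lt_or_ge x (start σ M) with h1 | h1
      · obtain ⟨s, c, h2, h3⟩ := ih h1
        exact ⟨s, c, by omega, h3⟩
      · rw [start_succ] at h
        exact ⟨M, x - start σ M, by omega, by omega, by omega⟩
  exact key _ (by rw [hσ.total]; exact hx)

/-! ### Spanning by standard tableaux -/

variable (D) in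
/-- The span of the `T_u m_σ` for the standard `u`. -/
noncomputable def stdSpan (N : ℕ) (σ : ℕ → ℕ) : Submodule R A :=
  Submodule.span R {x | ∃ u : Equiv.Perm (Fin n), RowColIncreasing r N σ u ∧
    x = D.tw u * D.m N σ}

/-- Induction on the length. A descent inside a row is absorbed by `m`. If the rows increase and
column `c` fails between rows `s` and `s + 1`, then all entries of row `s` from column `c` on exceed
the first `c + 1` entries of row `s + 1`. So `T_u` ends in `Lead`, and the Garnir relation with `x =
c`, `y = c + 1` replaces it by shorter elements. -/
theorem tw_mul_m_mem (hσ : IsRows n r N σ) (hv : D.Vanishes N σ) (u : Equiv.Perm (Fin n)) :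
    D.tw u * D.m N σ ∈ D.stdSpan N σ := by
  induction hk : inv u using Nat.strong_induction_on generalizing u with
  | _ k ih =>
  subst hk
  have hG : ∀ x ∈ D.G (inv u), x * D.m N σ ∈ D.stdSpan N σ := by
    intro x hx
    induction hx using Submodule.span_induction with
    | mem x hx =>
      obtain ⟨v, hv, rfl⟩ := hx
      exact ih _ hv v rfl
    | zero => rw [zero_mul]; exact zero_mem _
    | add x y _ _ hx hy => rw [add_mul]; exact add_mem hx hy
    | smul c x _ hx => rw [smul_mul_assoc]; exact Submodule.smul_mem _ _ hx
  by_cases hstd : RowColIncreasing r N σ u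
  · exact Submodule.subset_span ⟨u, hstd, rfl⟩
  · by_cases hrow : ∀ s < r * N, ∀ c, c + 1 < σ s →
        ev u (start σ s + c) < ev u (start σ s + c + 1)
    · have hcol : ¬ ∀ s, s + 1 < r * N → (s + 1) % N ≠ 0 → ∀ c < σ (s + 1),
          ev u (start σ s + c) < ev u (start σ (s + 1) + c) := fun h => hstd ⟨hrow, h⟩
      push Not at hcol
      obtain ⟨s, hs, hN, c, hc, hle⟩ := hcol
      have hσs := hσ.anti s hs hN
      have hsn := hσ.start_two_le hs
      rw [start_succ] at hle
      have hinc : ∀ s < r * N, ∀ d c, c + d < σ s →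
          ev u (start σ s + c) ≤ ev u (start σ s + (c + d)) := by
        intro s hs d
        induction d with
        | zero => intro c _; exact le_rfl
        | succ d ih =>
          intro c hc
          exact (ih c (by omega)).trans (hrow s hs (c + d) (by omega)).le
      have hne : ev u (start σ s + σ s + c) ≠ ev u (start σ s + c) := fun h => by
        have := ev_injective u h; omega
      obtain ⟨v, h1, h2⟩ := D.tw_peel_Lead (u := u) (p := start σ s + c) (a := σ s - c)
        (b := c + 1) (by omega) (by
          intro x y hx0 hx1 hy0 hy1
          have hx := hinc s (by omega) (x - (start σ s + c)) c (by omega)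
          have hy := hinc (s + 1) hs (start σ s + σ s + c - y) (y - (start σ s + σ s)) (by omega)
          rw [show start σ s + (c + (x - (start σ s + c))) = x by omega] at hx
          rw [start_succ, show start σ s + σ s + (y - (start σ s + σ s)) = y by omega,
            show start σ s + σ s + (y - (start σ s + σ s) + (start σ s + σ s + c - y)) =
              start σ s + σ s + c by omega] at hy
          omega)
      have h3 := Garnir hσ hv hs hN (x := c) (y := c + 1) (by omega) (by omega) (by omega)
      have h4 := D.mul_Sh_sub_Lead_mem_G (k := inv v) (p := start σ s + c) (a := σ s - c)
        (b := c + 1) (by omega) (D.tw_mem_G (Nat.lt_succ_self _))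
      rw [← h2] at h4
      have h5 := hG _ h4
      rw [mul_sub, sub_mul, mul_assoc, h3, mul_zero, zero_sub, ← h1] at h5
      simpa using (Submodule.neg_mem_iff _).1 h5
    · push Not at hrow
      obtain ⟨s, hs, c, hc, hle⟩ := hrow
      have hn := hσ.start_add_le hs
      have hlt : ev u (start σ s + c + 1) < ev u (start σ s + c + 1 - 1) := by
        rw [Nat.add_sub_cancel]
        refine lt_of_le_of_ne hle fun h => ?_
        have := ev_injective u h; omega
      rw [D.tw_of_gt (by omega) (by omega) hlt, mul_assoc,
        D.T_mul_m hσ.total.le hs (by omega) (by omega), mul_smul_comm]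
      refine Submodule.smul_mem _ _ (ih _ ?_ _ rfl)
      have := inv_mul_sw_of_gt (by omega) (by omega) hlt
      omega

theorem T_mul_mem_stdSpan (hσ : IsRows n r N σ) (hv : D.Vanishes N σ) {i : ℕ} (h0 : 0 < i)
    (h1 : i < n) {x : A} (hx : x ∈ D.stdSpan N σ) : D.T i * x ∈ D.stdSpan N σ := by
  induction hx using Submodule.span_induction with
  | mem x hx =>
    obtain ⟨u, -, rfl⟩ := hx
    rw [← mul_assoc]
    rcases D.T_mul_tw u h0 h1 with h | h
    · rw [h]; exact tw_mul_m_mem hσ hv _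
    · rw [h, add_mul, smul_mul_assoc, smul_mul_assoc]
      exact add_mem (Submodule.smul_mem _ _ (tw_mul_m_mem hσ hv _))
        (Submodule.smul_mem _ _ (tw_mul_m_mem hσ hv _))
  | zero => rw [mul_zero]; exact zero_mem _
  | add x y _ _ hx hy => rw [mul_add]; exact add_mem hx hy
  | smul c x _ hx => rw [mul_smul_comm]; exact Submodule.smul_mem _ _ hx

/-- A Jucys–Murphy element moves to the right through the letters of `T_u`, changing its index and
leaving correction terms with shorter permutations, until it reaches `m` and acts by a content. -/
theorem L_mul_tw_mul_m_mem (hσ : IsRows n r N σ) (hv : D.Vanishes N σ)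
    (u : Equiv.Perm (Fin n)) {m : ℕ} (hm : m < n) :
    D.L m * (D.tw u * D.m N σ) ∈ D.stdSpan N σ := by
  induction hk : inv u generalizing u m with
  | zero =>
    rw [inv_eq_zero hk, FinHecke.tw_one, one_mul]
    obtain ⟨s, c, h1, h2, rfl⟩ := hσ.exists_row hm
    rw [L_mul_m hσ hv h1 h2]
    refine Submodule.smul_mem _ _ ?_
    simpa using tw_mul_m_mem hσ hv (1 : Equiv.Perm (Fin n))
  | succ k ih =>
    obtain ⟨i, h0, h1, h2⟩ := exists_descent (u := u⁻¹) (by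
      intro h; rw [inv_eq_one] at h; subst h; simp at hk)
    have h3 := inv_mul_sw_of_gt h0 h1 h2
    set w := sw n i * u with hw
    have e1 : (u⁻¹ * sw n i) = w⁻¹ := by rw [hw, mul_inv_rev, sw_inv]
    have e2 : u = sw n i * w := by rw [hw, ← mul_assoc, sw_mul_self, one_mul]
    rw [e1, inv_perm_inv, inv_perm_inv] at h3
    have hwk : inv w = k := by omega
    have hlt : ev w⁻¹ (i - 1) < ev w⁻¹ i := by
      rw [← e1, ev_mul_sw_pred h0 h1, ev_mul_sw_self h0 h1]; exact h2
    rw [e2, ← D.T_mul_tw_of_lt h0 h1 hlt, mul_assoc, ← mul_assoc (D.L m)]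
    set y := D.tw w * D.m N σ with hy
    have hLy : ∀ l, l < n → D.L l * y ∈ D.stdSpan N σ := fun l hl => ih w hl hwk
    obtain ⟨j, rfl⟩ : ∃ j, i = j + 1 := ⟨i - 1, by omega⟩
    by_cases hmi : m = j + 1
    · subst hmi
      rw [D.L_succ_mul_T h1, add_mul, smul_mul_assoc, mul_assoc]
      exact add_mem (T_mul_mem_stdSpan hσ hv h0 h1 (hLy _ (by omega)))
        (Submodule.smul_mem _ _ (hLy _ hm))
    · by_cases hmj : m = j
      · subst hmj
        have e3 : D.L m * D.T (m + 1) =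
            D.T (m + 1) * D.L (m + 1) - (D.q - 1) • D.L (m + 1) := by
          rw [D.T_mul_L_succ h1]; abel
        rw [e3, sub_mul, smul_mul_assoc, mul_assoc]
        exact sub_mem (T_mul_mem_stdSpan hσ hv h0 h1 (hLy _ h1))
          (Submodule.smul_mem _ _ (hLy _ h1))
      · have hc : Commute (D.T (j + 1)) (D.L m) := by
          rcases Nat.lt_or_ge m j with h | h
          · exact D.commute_T_L_of_gt (by omega) h1
          · exact D.commute_T_L_of_lt h0 (by omega) hm
        rw [← hc.eq, mul_assoc]
        exact T_mul_mem_stdSpan hσ hv h0 h1 (hLy _ hm)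

/-- For the generators `T i` with `i > 0` this is straightening. The generator `T 0` is the
Jucys–Murphy element `L 0`. -/
theorem adjoin_mul_m_mem (hσ : IsRows n r N σ) (hv : D.Vanishes N σ) {h : A}
    (hh : h ∈ Algebra.adjoin R (D.T '' Set.Iio n)) : h * D.m N σ ∈ D.stdSpan N σ := by
  have key : ∀ x ∈ D.stdSpan N σ, h * x ∈ D.stdSpan N σ := by
    induction hh using Algebra.adjoin_induction with
    | mem y hy =>
      obtain ⟨i, hi, rfl⟩ := hy
      intro x hx
      rcases Nat.eq_zero_or_pos i with rfl | h0
      · induction hx using Submodule.span_induction with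
        | mem x hx =>
          obtain ⟨u, -, rfl⟩ := hx
          exact L_mul_tw_mul_m_mem hσ hv u (m := 0) hi
        | zero => rw [mul_zero]; exact zero_mem _
        | add x y _ _ hx hy => rw [mul_add]; exact add_mem hx hy
        | smul c x _ hx => rw [mul_smul_comm]; exact Submodule.smul_mem _ _ hx
      · exact T_mul_mem_stdSpan hσ hv h0 hi hx
    | algebraMap c =>
      intro x hx
      rw [← Algebra.smul_def]
      exact Submodule.smul_mem _ _ hx
    | add a b _ _ ha hb => intro x hx; rw [add_mul]; exact add_mem (ha x hx) (hb x hx)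
    | mul a b _ _ ha hb => intro x hx; rw [mul_assoc]; exact ha _ (hb x hx)
  refine key _ ?_
  simpa using tw_mul_m_mem hσ hv (1 : Equiv.Perm (Fin n))

end HeckeDatum

end ArikiKoike

namespace ArikiKoike

/-! ### Boxes and standard fillings -/

/-- The row, among the first `M`, of the box with number `x`. -/
def rowOf (M : ℕ) (σ : ℕ → ℕ) (x : ℕ) : ℕ := Nat.findGreatest (fun s => start σ s ≤ x) M

theorem rowOf_start_add {M : ℕ} {σ : ℕ → ℕ} {s c : ℕ} (hs : s < M) (hc : c < σ s) :
    rowOf M σ (start σ s + c) = s := by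
  rw [rowOf, Nat.findGreatest_eq_iff]
  refine ⟨hs.le, fun _ => by omega, fun t ht _ h => ?_⟩
  have := start_mono σ (show s + 1 ≤ t from ht)
  rw [start_succ] at this
  omega

theorem start_add_inj {M : ℕ} {σ : ℕ → ℕ} {s c s' c' : ℕ} (hs : s < M) (hc : c < σ s)
    (hs' : s' < M) (hc' : c' < σ s') (h : start σ s + c = start σ s' + c') : s = s' ∧ c = c' := by
  have h1 := rowOf_start_add hs hc
  rw [h, rowOf_start_add hs' hc'] at h1
  subst h1
  exact ⟨rfl, by omega⟩

theorem succ_mod_ne_of_div_eq {N s : ℕ} (h : s / N = (s + 1) / N) :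
    (s + 1) % N ≠ 0 := by
  intro h0
  have h1 := Nat.div_add_mod (s + 1) N
  have h2 := Nat.div_add_mod s N
  rw [h] at h2
  omega

namespace HeckeDatum

section Boxes

variable {n r N : ℕ} {σ : ℕ → ℕ} {u : Equiv.Perm (Fin n)}

theorem IsRows.le_of_le (hσ : IsRows n r N σ) {s s' : ℕ} (h : s ≤ s') (hs : s' < r * N)
    (hd : s / N = s' / N) : σ s' ≤ σ s := by
  induction s', h using Nat.le_induction with
  | base => exact le_rfl
  | succ t ht ih =>
    have h1 : s / N ≤ t / N := Nat.div_le_div_right ht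
    have h2 : t / N ≤ (t + 1) / N := Nat.div_le_div_right (Nat.le_succ t)
    have := hσ.anti t hs (succ_mod_ne_of_div_eq (by omega))
    exact this.trans (ih (by omega) (by omega))

theorem IsRows.row_le (hu : RowColIncreasing r N σ u) {s c c' : ℕ} (hs : s < r * N)
    (h : c ≤ c') (hc : c' < σ s) : ev u (start σ s + c) ≤ ev u (start σ s + c') := by
  induction c', h using Nat.le_induction with
  | base => exact le_rfl
  | succ t ht ih => exact (ih (by omega)).trans (hu.row s hs t hc).le

theorem IsRows.col_le (hσ : IsRows n r N σ) (hu : RowColIncreasing r N σ u) {s s' c : ℕ}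
    (h : s ≤ s') (hs : s' < r * N) (hd : s / N = s' / N) (hc : c < σ s') :
    ev u (start σ s + c) ≤ ev u (start σ s' + c) := by
  induction s', h using Nat.le_induction with
  | base => exact le_rfl
  | succ t ht ih =>
    have h1 : s / N ≤ t / N := Nat.div_le_div_right ht
    have h2 : t / N ≤ (t + 1) / N := Nat.div_le_div_right (Nat.le_succ t)
    have h3 := succ_mod_ne_of_div_eq (show t / N = (t + 1) / N by omega)
    have h4 := hσ.anti t hs h3
    exact (ih (by omega) (by omega) (by omega)).trans (hu.col t hs h3 c hc).le

theorem IsRows.box_le (hσ : IsRows n r N σ) (hu : RowColIncreasing r N σ u) {s s' c c' : ℕ}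
    (h : s ≤ s') (hs : s' < r * N) (hd : s / N = s' / N) (hcc : c ≤ c') (hc : c' < σ s') :
    ev u (start σ s + c) ≤ ev u (start σ s' + c') :=
  (IsRows.row_le hu (h.trans_lt hs) hcc (hc.trans_le (hσ.le_of_le h hs hd))).trans
    (hσ.col_le hu h hs hd hc)

theorem IsRows.box_lt (hσ : IsRows n r N σ) (hu : RowColIncreasing r N σ u) {s s' c c' : ℕ}
    (h : s ≤ s') (hs : s' < r * N) (hd : s / N = s' / N) (hcc : c ≤ c') (hc : c' < σ s')
    (hne : s ≠ s' ∨ c ≠ c') : ev u (start σ s + c) < ev u (start σ s' + c') := by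
  refine lt_of_le_of_ne (hσ.box_le hu h hs hd hcc hc) fun he => ?_
  have := start_add_inj (h.trans_lt hs) (hcc.trans_lt (hc.trans_le (hσ.le_of_le h hs hd))) hs hc
    (ev_injective u he)
  omega

/-- The entries of two boxes on the same diagonal differ by at least three. -/
theorem IsRows.diagonal_lt (hσ : IsRows n r N σ) (hu : RowColIncreasing r N σ u)
    {s s' c c' : ℕ} (h : s < s') (hs : s' < r * N) (hd : s / N = s' / N) (hc : c' < σ s')
    (he : c + s' = c' + s) : ev u (start σ s + c) + 2 < ev u (start σ s' + c') := by
  have h0 := hσ.le_of_le h.le hs hd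
  have h1 : s / N ≤ (s + 1) / N := Nat.div_le_div_right (Nat.le_succ s)
  have h2 : (s + 1) / N ≤ s' / N := Nat.div_le_div_right h
  have h3 := hσ.le_of_le (show s + 1 ≤ s' from h) hs (by omega)
  have a1 := hσ.box_lt hu (c := c) (c' := c + 1) le_rfl (h.trans hs) rfl (by omega) (by omega)
    (by omega)
  have a2 := hσ.box_lt hu (c := c) (c' := c) (show s ≤ s + 1 by omega) (by omega) (by omega)
    le_rfl (by omega) (by omega)
  have a3 := hσ.box_lt hu (c := c + 1) (c' := c') h.le hs hd (by omega) hc (by omega)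
  have a4 := hσ.box_lt hu (c := c) (c' := c') (show s + 1 ≤ s' from h) hs (by omega) (by omega)
    hc (by omega)
  -- The boxes to the right of and below the first box are different, and both of their entries lie
  -- strictly between the two on the diagonal.
  have a5 : ev u (start σ s + (c + 1)) ≠ ev u (start σ (s + 1) + c) := fun h5 => by
    have := start_add_inj (h.trans hs) (show c + 1 < σ s by omega) (by omega) (by omega)
      (ev_injective u h5)
    omega
  omega

theorem IsRows.exists_box (hσ : IsRows n r N σ) (w : Equiv.Perm (Fin n)) {j : ℕ} (hj : j < n) :
    ∃ s c, s < r * N ∧ c < σ s ∧ ev w j = start σ s + c ∧ ev w⁻¹ (start σ s + c) = j := by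
  obtain ⟨s, c, h1, h2, h3⟩ := hσ.exists_row (ev_lt w hj)
  exact ⟨s, c, h1, h2, h3, by rw [← h3, ev_inv_ev]⟩

theorem IsRows.length_le (hσ : IsRows n r N σ) {s : ℕ} (hs : s < r * N) : σ s ≤ n := by
  have := hσ.start_add_le hs
  omega

end Boxes

end HeckeDatum

open HeckeDatum

/-- Parameters for which the contents of distinct diagonals are different. -/
structure GenericParams (K : Type*) [Field K] (n r N : ℕ) where
  q : K
  qi : K
  Q : ℕ → K
  q_mul_qi : q * qi = 1
  generic : ∀ k k' a b a' b', k < r → k' < r → a ≤ n → b < N → a' ≤ n → b' < N →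
    Q k * q ^ a * qi ^ b = Q k' * q ^ a' * qi ^ b' → k = k' ∧ a + b' = a' + b

namespace GenericParams

variable {K : Type*} [Field K] {n r N : ℕ} (G : GenericParams K n r N) (σ : ℕ → ℕ)

/-- The content of the box with number `x`. -/
def content (x : ℕ) : K :=
  G.Q (rowOf (r * N) σ x / N) * G.q ^ (x - start σ (rowOf (r * N) σ x)) *
    G.qi ^ (rowOf (r * N) σ x % N)

variable {σ}

theorem content_start_add {s c : ℕ} (hs : s < r * N) (hc : c < σ s) :
    G.content σ (start σ s + c) = G.Q (s / N) * G.q ^ c * G.qi ^ (s % N) := by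
  rw [content, rowOf_start_add hs hc, Nat.add_sub_cancel_left]

theorem eq_of_content_eq (hσ : IsRows n r N σ) {τ : ℕ → ℕ} (hτ : IsRows n r N τ)
    {s c s' c' : ℕ} (hs : s < r * N) (hc : c < σ s) (hs' : s' < r * N) (hc' : c' < τ s')
    (h : G.content σ (start σ s + c) = G.content τ (start τ s' + c')) :
    s / N = s' / N ∧ c + s' = c' + s := by
  rw [content_start_add G hs hc, content_start_add G hs' hc'] at h
  have h1 := hσ.length_le hs
  have h2 := hτ.length_le hs'
  obtain ⟨h3, h4⟩ := G.generic _ _ _ _ _ _ (Nat.div_lt_of_lt_mul (by rwa [mul_comm]))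
    (Nat.div_lt_of_lt_mul (by rwa [mul_comm])) (by omega) (Nat.mod_lt _ hσ.pos) (by omega)
    (Nat.mod_lt _ hσ.pos) h
  have h5 := Nat.div_add_mod s N
  have h6 := Nat.div_add_mod s' N
  rw [h3] at h5
  exact ⟨h3, by omega⟩

/-- Entries of a standard filling that differ by at most two have different contents. -/
theorem content_ne (hσ : IsRows n r N σ) {w : Equiv.Perm (Fin n)}
    (hw : RowColIncreasing r N σ w⁻¹) {i j : ℕ} (hij : i < j) (hj : j ≤ i + 2) (hn : j < n) :
    G.content σ (ev w i) ≠ G.content σ (ev w j) := by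
  intro h
  obtain ⟨s, c, h1, h2, h3, h4⟩ := hσ.exists_box w (hij.trans hn)
  obtain ⟨s', c', h1', h2', h3', h4'⟩ := hσ.exists_box w hn
  rw [h3, h3'] at h
  obtain ⟨h5, h6⟩ := G.eq_of_content_eq hσ hσ h1 h2 h1' h2' h
  rcases lt_trichotomy s s' with h7 | h7 | h7
  · have := hσ.diagonal_lt hw h7 h1' h5 h2' h6
    omega
  · subst h7
    obtain rfl : c = c' := by omega
    omega
  · have := hσ.diagonal_lt hw h7 h1 h5.symm h2 h6.symm
    omega

/-- If exchanging `i - 1` and `i` destroys standardness, the two are adjacent. -/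
theorem adjacent_of_not (hσ : IsRows n r N σ) {w : Equiv.Perm (Fin n)}
    (hw : RowColIncreasing r N σ w⁻¹) {i : ℕ} (h0 : 0 < i) (h1 : i < n)
    (h : ¬ RowColIncreasing r N σ (w * sw n i)⁻¹) :
    ev w (i - 1) < ev w i ∧
      (G.content σ (ev w i) = G.q * G.content σ (ev w (i - 1)) ∨
        G.content σ (ev w (i - 1)) = G.q * G.content σ (ev w i)) := by
  have hev : ∀ x, ev (w * sw n i)⁻¹ x = ev (sw n i) (ev w⁻¹ x) := fun x => by
    rw [mul_inv_rev, sw_inv, ev_mul]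
  -- Exchanging `i - 1` and `i` reverses the order of two entries only if they are these two.
  have key : ∀ x y, ev w⁻¹ x < ev w⁻¹ y → ev (w * sw n i)⁻¹ y ≤ ev (w * sw n i)⁻¹ x →
      ev w (i - 1) = x ∧ ev w i = y := by
    intro x y hx hy
    have hne : ev (w * sw n i)⁻¹ y ≠ ev (w * sw n i)⁻¹ x := fun h => by
      rw [ev_injective _ h] at hx
      omega
    rw [hev, hev, ev_sw h0 h1, ev_sw h0 h1] at hy hne
    have hxy : ev w⁻¹ x = i - 1 ∧ ev w⁻¹ y = i := by split_ifs at hy hne <;> omega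
    rw [← hxy.1, ← hxy.2, ev_ev_inv, ev_ev_inv]
    exact ⟨rfl, rfl⟩
  by_cases hrow : ∀ s < r * N, ∀ c, c + 1 < σ s →
      ev (w * sw n i)⁻¹ (start σ s + c) < ev (w * sw n i)⁻¹ (start σ s + c + 1)
  · have hcol : ¬ ∀ s, s + 1 < r * N → (s + 1) % N ≠ 0 → ∀ c < σ (s + 1),
        ev (w * sw n i)⁻¹ (start σ s + c) < ev (w * sw n i)⁻¹ (start σ (s + 1) + c) :=
      fun h' => h ⟨hrow, h'⟩
    push Not at hcol
    obtain ⟨s, hs, hN, c, hc, hle⟩ := hcol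
    obtain ⟨e1, e2⟩ := key _ _ (hw.col s hs hN c hc) hle
    have h2 := hσ.anti s hs hN
    rw [e1, e2, content_start_add G hs hc,
      content_start_add G (s := s) (c := c) (by omega) (by omega)]
    refine ⟨by rw [start_succ]; omega, Or.inr ?_⟩
    have h3 : (s + 1) / N = s / N := by
      rw [Nat.succ_div, if_neg (fun h => hN (Nat.mod_eq_zero_of_dvd h)), add_zero]
    have h4 : (s + 1) % N = s % N + 1 := by
      have h3' := Nat.div_add_mod s N
      have h4' := Nat.div_add_mod (s + 1) N
      rw [h3] at h4'
      omega
    rw [h3, h4, pow_succ]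
    linear_combination -(G.Q (s / N) * G.q ^ c * G.qi ^ (s % N)) * G.q_mul_qi
  · push Not at hrow
    obtain ⟨s, hs, c, hc, hle⟩ := hrow
    obtain ⟨e1, e2⟩ := key _ _ (hw.row s hs c hc) hle
    rw [e1, e2, content_start_add G hs (by omega), add_assoc, content_start_add G hs hc]
    exact ⟨by omega, Or.inl (by ring)⟩

/-- The content of the first entry of a standard filling. -/
theorem content_zero (hσ : IsRows n r N σ) {w : Equiv.Perm (Fin n)}
    (hw : RowColIncreasing r N σ w⁻¹) (hn : 0 < n) : ∃ k < r, G.content σ (ev w 0) = G.Q k := by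
  obtain ⟨s, c, h1, h2, h3, h4⟩ := hσ.exists_box w hn
  have hc : c = 0 := by
    by_contra hc
    have := hσ.box_lt hw (c := 0) (c' := c) le_rfl h1 rfl (by omega) h2 (by omega)
    omega
  have hs : s % N = 0 := by
    by_contra hs
    have h5 := Nat.div_add_mod s N
    have h6 : (s - 1) / N = s / N := by
      have := Nat.mod_lt s hσ.pos
      rw [Nat.div_eq_iff hσ.pos]
      rw [mul_comm] at h5
      omega
    have := hσ.box_lt hw (c := c) (c' := c) (show s - 1 ≤ s by omega) h1 h6 le_rfl h2 (by omega)
    omega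
  refine ⟨s / N, Nat.div_lt_of_lt_mul (by rwa [mul_comm]), ?_⟩
  rw [h3, content_start_add G h1 h2, hc, hs]
  simp

/-- The contents of the entries determine a standard filling. -/
theorem box_eq_of_content_eq (hσ : IsRows n r N σ) {τ : ℕ → ℕ} (hτ : IsRows n r N τ)
    {w v : Equiv.Perm (Fin n)} (hw : RowColIncreasing r N σ w⁻¹)
    (hv : RowColIncreasing r N τ v⁻¹)
    (h : ∀ j < n, G.content σ (ev w j) = G.content τ (ev v j)) {j : ℕ} (hj : j < n) :
    ∃ s c, s < r * N ∧ c < σ s ∧ c < τ s ∧ ev w j = start σ s + c ∧ ev v j = start τ s + c := by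
  induction j using Nat.strong_induction_on with
  | _ j ih =>
  obtain ⟨s, c, h1, h2, h3, h4⟩ := hσ.exists_box w hj
  obtain ⟨s', c', h1', h2', h3', h4'⟩ := hτ.exists_box v hj
  have h5 := h j hj
  rw [h3, h3'] at h5
  obtain ⟨h6, h7⟩ := G.eq_of_content_eq hσ hτ h1 h2 h1' h2' h5
  -- Equal contents put the two boxes of `j` on the same diagonal. If the one in `τ` were farther
  -- down, then `τ` would have an earlier entry in the box that `j` occupies in `σ`, and by
  -- induction `σ` would have that same entry there.
  rcases lt_trichotomy s s' with h8 | h8 | h8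
  · exfalso
    have a1 := hτ.box_lt hv (c := c) (c' := c') h8.le h1' h6 (by omega) h2' (by omega)
    rw [h4'] at a1
    obtain ⟨s₁, c₁, b1, b2, b3, b4, b5⟩ := ih _ a1 (a1.trans hj)
    rw [ev_ev_inv] at b5
    obtain ⟨rfl, rfl⟩ := start_add_inj h1 (show c < τ s from
      lt_of_lt_of_le (by omega) (hτ.le_of_le h8.le h1' h6)) b1 b3 b5
    rw [← h3] at b4
    have := ev_injective _ b4
    omega
  · subst h8
    obtain rfl : c = c' := by omega
    exact ⟨s, c, h1, h2, h2', h3, h3'⟩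
  · exfalso
    have a1 := hσ.box_lt hw (c := c') (c' := c) h8.le h1 h6.symm (by omega) h2 (by omega)
    rw [h4] at a1
    obtain ⟨s₁, c₁, b1, b2, b3, b4, b5⟩ := ih _ a1 (a1.trans hj)
    rw [ev_ev_inv] at b4
    obtain ⟨rfl, rfl⟩ := start_add_inj h1' (show c' < σ s' from
      lt_of_lt_of_le (by omega) (hσ.le_of_le h8.le h1 h6.symm)) b1 b2 b4
    rw [← h3'] at b5
    have := ev_injective _ b5
    omega

theorem rowColIncreasing_one (hσ : IsRows n r N σ) :
    RowColIncreasing r N σ (1 : Equiv.Perm (Fin n)) := by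
  refine ⟨fun s _ c _ => ?_, fun s hs hN c hc => ?_⟩
  · simp only [ev_one]; omega
  · have := hσ.anti s hs hN
    simp only [ev_one, start_succ]; omega

end GenericParams

end ArikiKoike

namespace ArikiKoike

open HeckeDatum

namespace GenericParams

variable {K : Type*} [Field K] {n r N : ℕ} (G : GenericParams K n r N) (σ : ℕ → ℕ)

/-! ### Young's seminormal form -/

/-- The diagonal coefficient for contents `x`, `y`. -/
def diagCoeff (x y : K) : K := (G.q - 1) * y / (y - x)

/-- The off-diagonal coefficient for the boxes with numbers `p`, `p'`. -/
noncomputable def offCoeff (p p' : ℕ) : K :=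
  if p < p' then (G.q * G.content σ p - G.content σ p') * (G.content σ p - G.q * G.content σ p') /
    (G.content σ p - G.content σ p') ^ 2 else 1

/-- The seminormal operators, on functions on all fillings `w` (as maps from entries to boxes). -/
noncomputable def preOp (i : ℕ) :
    (Equiv.Perm (Fin n) → K) →ₗ[K] (Equiv.Perm (Fin n) → K) where
  toFun F w := if i = 0 then G.content σ (ev w 0) * F w else
    G.diagCoeff (G.content σ (ev w (i - 1))) (G.content σ (ev w i)) * F w +
      G.offCoeff σ (ev w (i - 1)) (ev w i) * F (w * sw n i)
  map_add' F F' := by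
    funext w
    simp only [Pi.add_apply]
    split_ifs <;> ring
  map_smul' c F := by
    funext w
    simp only [Pi.smul_apply, smul_eq_mul, RingHom.id_apply]
    split_ifs <;> ring

theorem preOp_zero (F : Equiv.Perm (Fin n) → K) (w : Equiv.Perm (Fin n)) :
    G.preOp σ 0 F w = G.content σ (ev w 0) * F w := rfl

theorem preOp_succ (i : ℕ) (F : Equiv.Perm (Fin n) → K) (w : Equiv.Perm (Fin n)) :
    G.preOp σ (i + 1) F w =
      G.diagCoeff (G.content σ (ev w i)) (G.content σ (ev w (i + 1))) * F w +
      G.offCoeff σ (ev w i) (ev w (i + 1)) * F (w * sw n (i + 1)) := rfl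

variable {σ}

/-- Only the product of the two off-diagonal entries enters the Hecke relations. The normalization
puts all of it on one side, where it vanishes for adjacent boxes; the entry `1` on the other side is
what makes the initial vector cyclic in `exists_adjoin_apply`. -/
theorem offCoeff_mul_offCoeff {p p' : ℕ} (h : p ≠ p')
    (hc : G.content σ p ≠ G.content σ p') :
    G.offCoeff σ p p' * G.offCoeff σ p' p =
      G.q + G.diagCoeff (G.content σ p) (G.content σ p') *
        G.diagCoeff (G.content σ p') (G.content σ p) := by
  have h1 := sub_ne_zero.2 hc
  have h2 := sub_ne_zero.2 hc.symm
  unfold offCoeff diagCoeff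
  rcases lt_or_gt_of_ne h with h3 | h3
  · rw [if_pos h3, if_neg h3.not_gt]
    field_simp
    ring
  · rw [if_pos h3, if_neg h3.not_gt]
    field_simp
    ring

theorem diagCoeff_add {x y : K} (h : x ≠ y) :
    G.diagCoeff x y + G.diagCoeff y x = G.q - 1 := by
  have h1 := sub_ne_zero.2 h
  have h2 := sub_ne_zero.2 h.symm
  unfold diagCoeff
  field_simp
  ring

theorem diagCoeff_mul {x y z : K} (hxy : x ≠ y) (hxz : x ≠ z) (hyz : y ≠ z) :
    G.diagCoeff x y * G.diagCoeff y z + G.diagCoeff x z * G.diagCoeff y x =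
      G.diagCoeff y z * G.diagCoeff x z := by
  have h1 := sub_ne_zero.2 hxy
  have h2 := sub_ne_zero.2 hxz
  have h3 := sub_ne_zero.2 hyz
  have h1' := sub_ne_zero.2 hxy.symm
  have h2' := sub_ne_zero.2 hxz.symm
  have h3' := sub_ne_zero.2 hyz.symm
  unfold diagCoeff
  field_simp
  ring

theorem ev_mul_sw_succ {w : Equiv.Perm (Fin n)} {i : ℕ} (h : i + 1 < n) (x : ℕ) :
    ev (w * sw n (i + 1)) x =
      if x = i then ev w (i + 1) else if x = i + 1 then ev w i else ev w x := by
  rw [ev_mul_sw (Nat.succ_pos i) h]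
  change (if x + 1 = i + 1 then _ else if x = i + 1 then ev w i else _) = _
  simp only [Nat.add_right_cancel_iff]

theorem ev_mul_mul_sw_succ {w v : Equiv.Perm (Fin n)} {i : ℕ} (h : i + 1 < n) (x : ℕ) :
    ev (w * (v * sw n (i + 1))) x =
      if x = i then ev (w * v) (i + 1) else if x = i + 1 then ev (w * v) i else ev (w * v) x := by
  rw [← mul_assoc, ev_mul_sw_succ h]

theorem ev_ne (w : Equiv.Perm (Fin n)) {i j : ℕ} (h : i ≠ j) : ev w i ≠ ev w j :=
  fun h' => h (ev_injective w h')

/-- The relations are checked at one filling at a time. They need only that the entries involved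
have different contents there, not that the neighbouring fillings are standard. -/
theorem preOp_quad {i : ℕ} (h : i + 1 < n) (F : Equiv.Perm (Fin n) → K)
    {w : Equiv.Perm (Fin n)} (hc : G.content σ (ev w i) ≠ G.content σ (ev w (i + 1))) :
    G.preOp σ (i + 1) (G.preOp σ (i + 1) F) w =
      (G.q - 1) * G.preOp σ (i + 1) F w + G.q * F w := by
  have h1 := G.diagCoeff_add hc
  have h2 := G.offCoeff_mul_offCoeff (ev_ne w (show i ≠ i + 1 by omega)) hc
  simp only [preOp_succ, ev_mul_sw_succ h, mul_assoc w, sw_mul_self, mul_one, if_true,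
    show i + 1 ≠ i by omega, if_false]
  linear_combination (G.diagCoeff (G.content σ (ev w i)) (G.content σ (ev w (i + 1))) * F w +
    G.offCoeff σ (ev w i) (ev w (i + 1)) * F (w * sw n (i + 1))) * h1 + F w * h2

theorem preOp_braid {i : ℕ} (h : i + 2 < n) (F : Equiv.Perm (Fin n) → K)
    {w : Equiv.Perm (Fin n)} (h01 : G.content σ (ev w i) ≠ G.content σ (ev w (i + 1)))
    (h02 : G.content σ (ev w i) ≠ G.content σ (ev w (i + 2)))
    (h12 : G.content σ (ev w (i + 1)) ≠ G.content σ (ev w (i + 2))) :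
    G.preOp σ (i + 1) (G.preOp σ (i + 2) (G.preOp σ (i + 1) F)) w =
      G.preOp σ (i + 2) (G.preOp σ (i + 1) (G.preOp σ (i + 2) F)) w := by
  have e1 := G.diagCoeff_mul h01 h02 h12
  have e2 := G.diagCoeff_mul h02 h01 h12.symm
  have b1 := G.offCoeff_mul_offCoeff (ev_ne w (show i ≠ i + 1 by omega)) h01
  have b2 := G.offCoeff_mul_offCoeff (ev_ne w (show i + 1 ≠ i + 2 by omega)) h12
  have s1 := G.diagCoeff_add h01
  have s2 := G.diagCoeff_add h12
  have s3 := G.diagCoeff_add h02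
  have hb := sw_braid (n := n) (Nat.succ_pos i) (show i + 1 + 1 < n from h)
  rw [Nat.succ_eq_add_one] at hb
  simp only [preOp_succ, ev_mul_sw_succ (show i + 1 < n by omega),
    ev_mul_sw_succ (show i + 1 + 1 < n by omega), ev_mul_mul_sw_succ (show i + 1 < n by omega),
    ev_mul_mul_sw_succ (show i + 1 + 1 < n by omega), mul_assoc (_ : Equiv.Perm (Fin n)), sw_mul_self, mul_one, if_true,
    show i + 1 ≠ i by omega, show i + 2 ≠ i by omega, show i + 2 ≠ i + 1 by omega,
    show i + 1 + 1 = i + 2 by omega, show i ≠ i + 1 by omega, show i ≠ i + 2 by omega,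
    show i + 1 ≠ i + 2 by omega, if_false]
  simp only [show i + 1 + 1 = i + 2 by omega] at hb
  rw [hb]
  generalize G.content σ (ev w i) = x at *
  generalize G.content σ (ev w (i + 1)) = y at *
  generalize G.content σ (ev w (i + 2)) = z at *
  linear_combination F w * (G.diagCoeff x z * (b1 - b2) +
      (G.diagCoeff x y - G.diagCoeff y z) * e1 + G.diagCoeff x z * G.diagCoeff y z * (s1 - s2)) +
    G.offCoeff σ (ev w i) (ev w (i + 1)) * F (w * sw n (i + 1)) * e1 +
    G.offCoeff σ (ev w (i + 1)) (ev w (i + 2)) * F (w * sw n (i + 2)) *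
      (-e2 + G.diagCoeff x y * (s3 - s2))

theorem preOp_comm {i j : ℕ} (h : i + 2 ≤ j) (hj : j < n) (F : Equiv.Perm (Fin n) → K)
    (w : Equiv.Perm (Fin n)) :
    G.preOp σ i (G.preOp σ j F) w = G.preOp σ j (G.preOp σ i F) w := by
  obtain ⟨j, rfl⟩ : ∃ k, j = k + 1 := ⟨j - 1, by omega⟩
  rcases Nat.eq_zero_or_pos i with rfl | hi
  · simp only [preOp_succ, preOp_zero, ev_mul_sw_succ hj, show (0 : ℕ) ≠ j by omega,
      show (0 : ℕ) ≠ j + 1 by omega, if_false]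
    ring
  · obtain ⟨i, rfl⟩ : ∃ k, i = k + 1 := ⟨i - 1, by omega⟩
    simp only [preOp_succ, ev_mul_sw_succ hj, ev_mul_sw_succ (show i + 1 < n by omega),
      show i ≠ j by omega, show i ≠ j + 1 by omega, show i + 1 ≠ j by omega, mul_assoc w,
      show i + 1 ≠ j + 1 by omega, show j ≠ i by omega, show j ≠ i + 1 by omega,
      show j + 1 ≠ i by omega, show j + 1 ≠ i + 1 by omega, if_false,
      sw_comm (n := n) (Nat.succ_pos i) (show i.succ + 1 < j + 1 by omega) hj]
    ring

/-- The Jucys–Murphy recursion. -/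
theorem preOp_conj {i : ℕ} (h : i + 1 < n) {F H : Equiv.Perm (Fin n) → K}
    {w : Equiv.Perm (Fin n)} (hc : G.content σ (ev w i) ≠ G.content σ (ev w (i + 1)))
    (hF : H w = G.content σ (ev w i) * G.preOp σ (i + 1) F w)
    (hF' : H (w * sw n (i + 1)) =
      G.content σ (ev w (i + 1)) * G.preOp σ (i + 1) F (w * sw n (i + 1))) :
    G.preOp σ (i + 1) H w = G.q * (G.content σ (ev w (i + 1)) * F w) := by
  have b := G.offCoeff_mul_offCoeff (ev_ne w (show i ≠ i + 1 by omega)) hc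
  have h1 := sub_ne_zero.2 hc
  have h2 := sub_ne_zero.2 hc.symm
  rw [preOp_succ, hF, hF']
  simp only [preOp_succ, ev_mul_sw_succ h, mul_assoc w, sw_mul_self, mul_one, if_true,
    show i + 1 ≠ i by omega, if_false]
  generalize G.content σ (ev w i) = x at *
  generalize G.content σ (ev w (i + 1)) = y at *
  have e1 : G.diagCoeff x y * x + G.diagCoeff y x * y = 0 := by
    unfold diagCoeff
    field_simp
    ring
  linear_combination y * F w * b + G.diagCoeff x y * F w * e1 +
    G.offCoeff σ (ev w i) (ev w (i + 1)) * F (w * sw n (i + 1)) * e1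

end GenericParams

end ArikiKoike

namespace ArikiKoike

open HeckeDatum

/-- The standard fillings, as maps from entries to boxes. -/
abbrev StdFilling (n r N : ℕ) (σ : ℕ → ℕ) : Type :=
  {w : Equiv.Perm (Fin n) // RowColIncreasing r N σ w⁻¹}

namespace GenericParams

variable {K : Type*} [Field K] {n r N : ℕ} (G : GenericParams K n r N) (σ : ℕ → ℕ)

/-- Restriction to the standard fillings. -/
def res : (Equiv.Perm (Fin n) → K) →ₗ[K] (StdFilling n r N σ → K) :=
  LinearMap.funLeft K K Subtype.val

/-- The seminormal operators on functions on the standard fillings. -/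
noncomputable def seminormalOp (i : ℕ) : Module.End K (StdFilling n r N σ → K) :=
  res σ ∘ₗ G.preOp σ i ∘ₗ Function.ExtendByZero.linearMap K Subtype.val

variable {σ}

theorem exists_res (f : StdFilling n r N σ → K) : ∃ F, f = res σ F :=
  ⟨Function.ExtendByZero.linearMap K Subtype.val f, by
    funext w
    exact (Subtype.val_injective.extend_apply _ _ w).symm⟩

/-- An exchange leaves the standard fillings only if the two boxes are adjacent. Their contents then
differ by a factor `q`, a zero of the numerator. -/
theorem offCoeff_eq_zero (hσ : IsRows n r N σ) {w : Equiv.Perm (Fin n)}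
    (hw : RowColIncreasing r N σ w⁻¹) {i : ℕ} (h : i + 1 < n)
    (h' : ¬ RowColIncreasing r N σ (w * sw n (i + 1))⁻¹) :
    G.offCoeff σ (ev w i) (ev w (i + 1)) = 0 := by
  obtain ⟨h1, h2⟩ := G.adjacent_of_not hσ hw (Nat.succ_pos i) h h'
  rw [Nat.succ_sub_one] at h1 h2
  rw [offCoeff, if_pos h1]
  rcases h2 with h2 | h2 <;> rw [Nat.succ_eq_add_one] at h2 <;> rw [h2] <;> simp

/-- By `offCoeff_eq_zero` the value of `preOp` at a standard filling depends only on values at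
standard fillings. So the relations may be verified with arbitrary functions on all fillings. -/
theorem seminormalOp_res (hσ : IsRows n r N σ) {i : ℕ} (h : i < n)
    (F : Equiv.Perm (Fin n) → K) : G.seminormalOp σ i (res σ F) = res σ (G.preOp σ i F) := by
  have h1 : ∀ w : StdFilling n r N σ,
      Function.ExtendByZero.linearMap K Subtype.val (res σ F) w.1 = F w.1 := fun w =>
    Subtype.val_injective.extend_apply _ _ w
  funext w
  change G.preOp σ i (Function.ExtendByZero.linearMap K Subtype.val (res σ F)) w.1 =
    G.preOp σ i F w.1
  rcases i with - | i
  · rw [preOp_zero, preOp_zero, h1]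
  · rw [preOp_succ, preOp_succ, h1]
    by_cases hs : RowColIncreasing r N σ (w.1 * sw n (i + 1))⁻¹
    · rw [h1 ⟨_, hs⟩]
    · rw [G.offCoeff_eq_zero hσ w.2 h hs, zero_mul, zero_mul]

theorem list_prod_preOp (l : List ℕ) (F : Equiv.Perm (Fin n) → K) (hn : 0 < n)
    (hσ : IsRows n r N σ) (w : StdFilling n r N σ) :
    (l.map fun k => G.seminormalOp σ 0 - algebraMap K _ (G.Q k)).prod (res σ F) w =
      (l.map fun k => G.content σ (ev w.1 0) - G.Q k).prod * F w.1 := by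
  induction l generalizing F with
  | nil => simp [res]
  | cons k l ih =>
    have e : (G.seminormalOp σ 0 - algebraMap K _ (G.Q k)) (res σ F) =
        res σ (G.preOp σ 0 F - G.Q k • F) := by
      rw [LinearMap.sub_apply, G.seminormalOp_res hσ hn, Module.algebraMap_end_apply, map_sub,
        map_smul]
    have hc : Commute (G.seminormalOp σ 0 - algebraMap K _ (G.Q k))
        (l.map fun k => G.seminormalOp σ 0 - algebraMap K _ (G.Q k)).prod := by
      apply Commute.list_prod_right
      intro x hx
      obtain ⟨j, -, rfl⟩ := List.mem_map.1 hx
      exact Commute.sub_left ((Commute.refl _).sub_right (Algebra.commutes _ _).symm)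
        (Algebra.commutes _ _)
    rw [List.map_cons, List.prod_cons, hc.eq, Module.End.mul_apply, e, ih, List.map_cons,
      List.prod_cons, Pi.sub_apply, preOp_zero, Pi.smul_apply, smul_eq_mul]
    ring

/-- The seminormal representation. -/
noncomputable def seminormal (hσ : IsRows n r N σ) :
    HeckeDatum K (Module.End K (StdFilling n r N σ → K)) n r where
  q := G.q
  qi := G.qi
  Q := G.Q
  q_mul_qi := G.q_mul_qi
  T := G.seminormalOp σ
  quad i h0 h1 := by
    obtain ⟨i, rfl⟩ : ∃ k, i = k + 1 := ⟨i - 1, by omega⟩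
    refine LinearMap.ext fun f => ?_
    obtain ⟨F, rfl⟩ := exists_res f
    rw [Module.End.mul_apply, G.seminormalOp_res hσ h1, G.seminormalOp_res hσ h1,
      LinearMap.add_apply, LinearMap.smul_apply, G.seminormalOp_res hσ h1]
    funext w
    exact G.preOp_quad h1 F (G.content_ne hσ w.2 (by omega) (by omega) h1)
  braid i h0 h1 := by
    obtain ⟨i, rfl⟩ : ∃ k, i = k + 1 := ⟨i - 1, by omega⟩
    refine LinearMap.ext fun f => ?_
    obtain ⟨F, rfl⟩ := exists_res f
    have h2 : i + 1 < n := by omega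
    simp only [Module.End.mul_apply, G.seminormalOp_res hσ h1, G.seminormalOp_res hσ h2]
    funext w
    exact G.preOp_braid h1 F (G.content_ne hσ w.2 (by omega) (by omega) h2)
      (G.content_ne hσ w.2 (by omega) (by omega) h1)
      (G.content_ne hσ w.2 (by omega) (by omega) h1)
  comm i j h0 h1 h2 := by
    refine LinearMap.ext fun f => ?_
    obtain ⟨F, rfl⟩ := exists_res f
    have h3 : i < n := by omega
    simp only [Module.End.mul_apply, G.seminormalOp_res hσ h2, G.seminormalOp_res hσ h3]
    funext w
    exact G.preOp_comm h1 h2 F w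
  cyclo h0 := by
    refine LinearMap.ext fun f => ?_
    obtain ⟨F, rfl⟩ := exists_res f
    funext w
    rw [G.list_prod_preOp _ F h0 hσ w]
    obtain ⟨k, hk, hk'⟩ := G.content_zero hσ w.2 h0
    rw [List.prod_eq_zero (List.mem_map.2 ⟨k, List.mem_range.2 hk, by rw [hk', sub_self]⟩),
      zero_mul]
    rfl
  braidFour h1 := by
    refine LinearMap.ext fun f => ?_
    obtain ⟨F, rfl⟩ := exists_res f
    have h0 : 0 < n := by omega
    simp only [Module.End.mul_apply, G.seminormalOp_res hσ h0, G.seminormalOp_res hσ h1]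
    funext w
    have hc := G.content_ne hσ w.2 (show 0 < 1 by omega) (by omega) h1
    change G.preOp σ 0 (G.preOp σ 1 (G.preOp σ 0 (G.preOp σ 1 F))) w.1 =
      G.preOp σ 1 (G.preOp σ 0 (G.preOp σ 1 (G.preOp σ 0 F))) w.1
    -- `T 1 * T 0 * T 1` is `q` times the second Jucys–Murphy element. It is diagonal and therefore
    -- commutes with the diagonal `T 0`.
    have h3 : ∀ F, G.preOp σ (0 + 1) (G.preOp σ 0 (G.preOp σ 1 F)) w.1 =
        G.q * (G.content σ (ev w.1 (0 + 1)) * F w.1) := fun F => by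
      refine G.preOp_conj h1 hc (G.preOp_zero _ _ _) ?_
      rw [preOp_zero, ev_mul_sw_succ h1, if_pos rfl]
    rw [zero_add] at h3
    rw [preOp_zero, h3, h3, preOp_zero]
    ring
  comm_zero j h0 h1 := by
    refine LinearMap.ext fun f => ?_
    obtain ⟨F, rfl⟩ := exists_res f
    have h3 : 0 < n := by omega
    simp only [Module.End.mul_apply, G.seminormalOp_res hσ h1, G.seminormalOp_res hσ h3]
    funext w
    exact G.preOp_comm h0 h1 F w

/-- The Jucys–Murphy elements act diagonally, by the contents. -/
theorem seminormal_L (hσ : IsRows n r N σ) {m : ℕ} (hm : m < n) (f : StdFilling n r N σ → K)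
    (w : StdFilling n r N σ) :
    (G.seminormal hσ).L m f w = G.content σ (ev w.1 m) * f w := by
  induction m generalizing f w with
  | zero =>
    obtain ⟨F, rfl⟩ := exists_res f
    change G.seminormalOp σ 0 (res σ F) w = _
    rw [G.seminormalOp_res hσ hm]
    rfl
  | succ m ih =>
    obtain ⟨F, rfl⟩ := exists_res f
    have h1 : (G.seminormal hσ).L m (G.seminormalOp σ (m + 1) (res σ F)) =
        res σ fun w => G.content σ (ev w m) * G.preOp σ (m + 1) F w := by
      funext w
      rw [ih (by omega), G.seminormalOp_res hσ hm]
      rfl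
    have h2 : (G.seminormal hσ).L (m + 1) (res σ F) = G.qi • G.seminormalOp σ (m + 1)
        ((G.seminormal hσ).L m (G.seminormalOp σ (m + 1) (res σ F))) := rfl
    rw [h2, h1, G.seminormalOp_res hσ hm]
    have h3 := G.preOp_conj hm (F := F)
      (H := fun w => G.content σ (ev w m) * G.preOp σ (m + 1) F w) (w := w.1)
      (G.content_ne hσ w.2 (by omega) (by omega) hm) rfl (by
        rw [ev_mul_sw_succ hm, if_pos rfl])
    rw [Pi.smul_apply, smul_eq_mul]
    refine (congrArg (G.qi * ·) h3).trans ?_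
    change _ = _ * F w.1
    rw [ ← mul_assoc, mul_comm G.qi, G.q_mul_qi, one_mul]

end GenericParams

end ArikiKoike

/-! ### The generic module: weights of the `m_τ` and the cyclic vector -/

namespace ArikiKoike

open HeckeDatum

/-- If the last row of a component were non-empty, all `N` rows of it would be, and there would be
at least `N > n` boxes. -/
theorem HeckeDatum.isRows_of_lt {n r N : ℕ} {ρ : ℕ → ℕ} (hN : n < N)
    (hn : start ρ (r * N) = n)
    (h : ∀ s, s + 1 < r * N → (s + 1) % N ≠ 0 → ρ (s + 1) ≤ ρ s) : IsRows n r N ρ := by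
  refine ⟨by omega, hn, h, fun s hs h0 => ?_⟩
  by_contra hρ
  obtain ⟨k, hk⟩ : ∃ k, s + 1 = (k + 1) * N := by
    refine ⟨(s + 1) / N - 1, ?_⟩
    have h1 := Nat.div_add_mod (s + 1) N
    rw [h0, add_zero] at h1
    have h2 : 0 < (s + 1) / N := Nat.pos_of_ne_zero fun h2 => by rw [h2] at h1; omega
    rw [Nat.sub_add_cancel h2, mul_comm, h1]
  rw [add_mul, one_mul] at hk
  have key : ∀ j, j < N → 1 ≤ ρ (s - j) := by
    intro j
    induction j with
    | zero => intro _; rw [Nat.sub_zero]; omega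
    | succ j ih =>
      intro hj
      have h3 := h (s - (j + 1)) (by omega) (by
        rw [show s - (j + 1) + 1 = (N - (j + 1)) + k * N by omega, Nat.add_mul_mod_self_right,
          Nat.mod_eq_of_lt (by omega)]
        omega)
      rw [show s - (j + 1) + 1 = s - j by omega] at h3
      exact (ih (by omega)).trans h3
  have key2 : ∀ j, j ≤ N → j ≤ start ρ (k * N + j) := by
    intro j
    induction j with
    | zero => intro _; omega
    | succ j ih =>
      intro hj
      have h3 := key (s - (k * N + j)) (by omega)
      rw [show s - (s - (k * N + j)) = k * N + j by omega] at h3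
      have := ih (by omega)
      rw [← add_assoc, start_succ]
      omega
  have h4 := key2 N le_rfl
  have h5 := start_mono ρ (show k * N + N ≤ r * N by omega)
  omega

namespace GenericParams

variable {K : Type*} [Field K] {n r N : ℕ} (G : GenericParams K n r N) {σ : ℕ → ℕ}

theorem cont_eq_content (hσ : IsRows n r N σ) {τ : ℕ → ℕ} {s c : ℕ} (hs : s < r * N)
    (hc : c < τ s) : (G.seminormal hσ).cont N s c = G.content τ (start τ s + c) :=
  (G.content_start_add hs hc).symm

/-- The weights of the image of `m_τ`. -/
theorem box_eq_of_m_apply_ne_zero (hσ : IsRows n r N σ) {τ : ℕ → ℕ} (hτ : IsRows n r N τ)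
    (hv : (G.seminormal hσ).Vanishes N τ) {f : StdFilling n r N σ → K} {w : StdFilling n r N σ}
    (h : (G.seminormal hσ).m N τ f w ≠ 0) {j : ℕ} (hj : j < n) :
    ∃ s c, s < r * N ∧ c < σ s ∧ c < τ s ∧ ev w.1 j = start σ s + c ∧ j = start τ s + c := by
  -- By `L_mul_m` the image of `m_τ` has the weight of the initial filling of `τ`, so every filling
  -- in the support of `m_τ f` has this weight.
  have key : ∀ j < n, G.content σ (ev w.1 j) = G.content τ (ev (1 : Equiv.Perm (Fin n)) j) := by
    intro j hj
    obtain ⟨s, c, h1, h2, h3⟩ := hτ.exists_row hj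
    have h4 := congrFun (LinearMap.congr_fun (L_mul_m hτ hv h1 h2) f) w
    rw [← h3, Module.End.mul_apply, G.seminormal_L hσ hj, LinearMap.smul_apply, Pi.smul_apply,
      smul_eq_mul, G.cont_eq_content hσ h1 h2, ← h3] at h4
    rw [ev_one]
    exact mul_right_cancel₀ h h4
  obtain ⟨s, c, h1, h2, h3, h4, h5⟩ := G.box_eq_of_content_eq hσ hτ w.2
    (by rw [_root_.inv_one]; exact rowColIncreasing_one hτ) key hj
  rw [ev_one] at h5
  exact ⟨s, c, h1, h2, h3, h4, h5⟩

/-- Downward induction along the order. If everything above `τ` vanishes, a non-zero value of `m_τ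
f` puts every box of `τ` into `σ`, and then no partial sum of `τ` can exceed that of `σ`.
Multicompositions follow by `m_eq_zero_of_forall`. -/
theorem seminormal_vanishes (hσ : IsRows n r N σ) (hN : n < N) :
    (G.seminormal hσ).Vanishes N σ := by
  have key : ∀ τ : ℕ → ℕ, start τ (r * N) = n →
      (∀ s, s + 1 < r * N → (s + 1) % N ≠ 0 → τ (s + 1) ≤ τ s) →
      (∀ s ≤ r * N, start σ s ≤ start τ s) → (∃ s ≤ r * N, start σ s < start τ s) →
      (G.seminormal hσ).m N τ = 0 := by
    intro τ
    induction hk : ∑ s ∈ Finset.range (r * N), (n - start τ s) using Nat.strong_induction_on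
      generalizing τ with
    | _ k ih =>
    intro h1 h2 h3 ⟨s, hs, hlt⟩
    have hτ := isRows_of_lt hN h1 h2
    have hv : (G.seminormal hσ).Vanishes N τ := by
      refine (G.seminormal hσ).m_eq_zero_of_forall fun ρ g1 g2 g3 ⟨t, ht, ht'⟩ => ?_
      refine ih _ ?_ ρ rfl g1 g2 (fun s hs => (h3 s hs).trans (g3 s hs))
        ⟨t, ht, (h3 t ht).trans_lt ht'⟩
      rw [← hk]
      have hle := start_mono ρ ht
      refine Finset.sum_lt_sum (fun i hi => by have := g3 i (Finset.mem_range.1 hi).le; omega)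
        ⟨t, Finset.mem_range.2 (lt_of_le_of_ne ht fun h => by rw [h] at ht'; omega), by omega⟩
    refine LinearMap.ext fun f => ?_
    by_contra hne
    obtain ⟨w, hw⟩ := Function.ne_iff.1 hne
    have hle : ∀ t < r * N, τ t ≤ σ t := by
      intro t ht
      rcases Nat.eq_zero_or_pos (τ t) with h0 | h0
      · omega
      · obtain ⟨s', c', g1, g2, g3, -, g4⟩ := G.box_eq_of_m_apply_ne_zero hσ hτ hv hw
          (j := start τ t + (τ t - 1)) (by have := hτ.start_add_le ht; omega)
        obtain ⟨rfl, rfl⟩ := start_add_inj ht (by omega) g1 g3 g4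
        omega
    have : start τ s ≤ start σ s :=
      Finset.sum_le_sum fun i hi => hle i ((Finset.mem_range.1 hi).trans_le hs)
    omega
  exact (G.seminormal hσ).m_eq_zero_of_forall key

/-- The initial filling. -/
def initial (hσ : IsRows n r N σ) : StdFilling n r N σ :=
  ⟨1, by rw [_root_.inv_one]; exact rowColIncreasing_one hσ⟩

/-- The image of `m_σ` has the weight of the initial filling, and a standard filling is determined
by its weight. -/
theorem m_apply_eq_zero (hσ : IsRows n r N σ) (hN : n < N) (f : StdFilling n r N σ → K)
    {w : StdFilling n r N σ} (hw : w ≠ initial hσ) : (G.seminormal hσ).m N σ f w = 0 := by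
  by_contra h
  refine hw (Subtype.ext (perm_ext fun j hj => ?_))
  obtain ⟨s, c, -, -, -, h1, h2⟩ :=
    G.box_eq_of_m_apply_ne_zero hσ hσ (G.seminormal_vanishes hσ hN) h hj
  change ev w.1 j = ev 1 j
  rw [h1, ev_one, h2]

/-! ### The cyclic vector -/

theorem res_single (w : StdFilling n r N σ) :
    res σ (Pi.single w.1 (1 : K)) = Pi.single w 1 := by
  funext v
  change (Pi.single w.1 (1 : K) : Equiv.Perm (Fin n) → K) v.1 = _
  simp only [Pi.single_apply, Subtype.ext_iff]

theorem res_single_of_not {w : Equiv.Perm (Fin n)} (h : ¬ RowColIncreasing r N σ w⁻¹) :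
    res (r := r) (N := N) σ (Pi.single w (1 : K)) = 0 := by
  funext v
  change (Pi.single w (1 : K) : Equiv.Perm (Fin n) → K) v.1 = 0
  rw [Pi.single_apply, if_neg]
  rintro rfl
  exact h v.2

theorem preOp_single {i : ℕ} (h : i + 1 < n) (w : Equiv.Perm (Fin n)) :
    G.preOp σ (i + 1) (Pi.single w 1) =
      G.diagCoeff (G.content σ (ev w i)) (G.content σ (ev w (i + 1))) • Pi.single w 1 +
        G.offCoeff σ (ev w (i + 1)) (ev w i) • Pi.single (w * sw n (i + 1)) 1 := by
  funext v
  rw [preOp_succ]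
  simp only [Pi.add_apply, Pi.smul_apply, smul_eq_mul, Pi.single_apply]
  have e : v * sw n (i + 1) = w ↔ v = w * sw n (i + 1) := by
    constructor
    · rintro rfl; rw [mul_assoc, sw_mul_self, mul_one]
    · rintro rfl; rw [mul_assoc, sw_mul_self, mul_one]
  simp only [e]
  congr 1
  · split_ifs with h1
    · rw [h1]
    · rw [mul_zero, mul_zero]
  · split_ifs with h1
    · rw [h1, ev_mul_sw_succ h, ev_mul_sw_succ h]
      simp
    · rw [mul_zero, mul_zero]

/-- Exchanging neighbours in a row of the initial filling destroys standardness, so only the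
diagonal coefficient survives. It equals `q` because the contents have ratio `q`. -/
theorem seminormalOp_initial (hσ : IsRows n r N σ) {s i : ℕ} (hs : s < r * N)
    (h0 : start σ s < i) (h1 : i < start σ s + σ s) :
    G.seminormalOp σ i (Pi.single (initial hσ) 1) = G.q • Pi.single (initial hσ) 1 := by
  have hn := hσ.start_add_le hs
  obtain ⟨c, rfl⟩ : ∃ c, i = start σ s + c + 1 := ⟨i - start σ s - 1, by omega⟩
  rw [← res_single, G.seminormalOp_res hσ (by omega), G.preOp_single (by omega), map_add,
    map_smul, map_smul]
  have hns : ¬ RowColIncreasing r N σ ((1 : Equiv.Perm (Fin n)) * sw n (start σ s + c + 1))⁻¹ := by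
    intro h
    have := h.row s hs c (by omega)
    rw [one_mul, sw_inv, ev_sw (by omega) (by omega), ev_sw (by omega) (by omega), if_pos rfl,
      if_neg (by omega), if_pos rfl] at this
    omega
  change _ + _ • res σ (Pi.single ((1 : Equiv.Perm (Fin n)) * sw n (start σ s + c + 1)) 1) = _
  rw [res_single_of_not hns, smul_zero, add_zero]
  congr 1
  change G.diagCoeff (G.content σ (ev 1 (start σ s + c)))
    (G.content σ (ev 1 (start σ s + c + 1))) = G.q
  have hne := G.content_ne hσ (initial hσ).2 (show start σ s + c < start σ s + c + 1 by omega)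
    (by omega) (by omega)
  change G.content σ (ev 1 (start σ s + c)) ≠ G.content σ (ev 1 (start σ s + c + 1)) at hne
  rw [ev_one, ev_one] at hne ⊢
  have e : G.content σ (start σ s + c + 1) = G.q * G.content σ (start σ s + c) := by
    rw [add_assoc, G.content_start_add hs (by omega), G.content_start_add hs (by omega)]
    ring
  rw [e] at hne ⊢
  have := sub_ne_zero.2 hne.symm
  rw [diagCoeff, div_eq_iff this]
  ring

/-- If the sum vanished, then `q ^ l = 1`, and columns `0` and `l` of a row would have equal
contents. -/
theorem geom_sum_ne_zero (hr : 0 < r) (hN : 0 < N) {l : ℕ} (h0 : 0 < l) (h1 : l ≤ n) :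
    ∑ j ∈ Finset.range l, G.q ^ j ≠ 0 := by
  intro h
  have h2 := geom_sum_mul G.q l
  rw [h, zero_mul] at h2
  have := G.generic 0 0 l 0 0 0 hr hr h1 hN (Nat.zero_le n) hN (by
    rw [sub_eq_zero.1 h2.symm]; simp)
  omega

end GenericParams

/-! ### Eigenvectors of the symmetrizers -/

section Eigen

variable {K V : Type*} [Field K] [AddCommGroup V] [Module K V] {n r : ℕ}

theorem FinHecke.U_apply {D : FinHecke K (Module.End K V) n} {x : V} {p a : ℕ}
    (h : ∀ i, p < i → i ≤ p + a → D.T i x = D.q • x) : D.U p a x = D.q ^ a • x := by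
  induction a with
  | zero => simp [FinHecke.U]
  | succ a ih =>
    rw [FinHecke.U, Module.End.mul_apply, h _ (by omega) (by omega), map_smul,
      ih fun i h0 h1 => h i h0 (by omega), smul_smul, pow_succ, mul_comm]

theorem FinHecke.X_apply {D : FinHecke K (Module.End K V) n} {x : V} {p l : ℕ}
    (h : ∀ i, p < i → i < p + l → D.T i x = D.q • x)
    (hq : ∀ l', 0 < l' → l' ≤ l → ∑ j ∈ Finset.range l', D.q ^ j ≠ 0) :
    ∃ c : K, c ≠ 0 ∧ D.X p l x = c • x := by
  induction l generalizing p with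
  | zero => exact ⟨1, one_ne_zero, by simp [FinHecke.X]⟩
  | succ l ih =>
    obtain ⟨c, hc, hx⟩ := ih (p := p + 1) (fun i h0 h1 => h i (by omega) (by omega))
      fun l' h0 h1 => hq l' h0 (by omega)
    refine ⟨(∑ j ∈ Finset.range (l + 1), D.q ^ j) * c, mul_ne_zero (hq _ (by omega) le_rfl) hc, ?_⟩
    have hY : D.Y p l x = (∑ j ∈ Finset.range (l + 1), D.q ^ j) • x := by
      rw [FinHecke.Y, LinearMap.sum_apply, Finset.sum_smul]
      refine Finset.sum_congr rfl fun j hj => FinHecke.U_apply fun i h0 h1 => h i h0 ?_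
      have := Finset.mem_range.1 hj
      omega
    rw [FinHecke.X_succ, Module.End.mul_apply, hY, map_smul, hx, smul_smul]

theorem HeckeDatum.uu_apply {D : HeckeDatum K (Module.End K V) n r} {x : V} {a : ℕ → ℕ}
    {ct : ℕ → K} {k : ℕ}
    (h : ∀ j < k, ∀ m < a j, D.L m x = ct m • x ∧ ct m ≠ D.Q j) :
    ∃ c : K, c ≠ 0 ∧ D.uu a k x = c • x := by
  have hv : ∀ (c : K) (a : ℕ), (∀ m < a, D.L m x = ct m • x ∧ ct m ≠ c) →
      ∃ d : K, d ≠ 0 ∧ D.v c a x = d • x := by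
    intro c a
    induction a with
    | zero => intro _; exact ⟨1, one_ne_zero, by simp [v]⟩
    | succ a ih =>
      intro h
      obtain ⟨d, hd, hx⟩ := ih fun m hm => h m (by omega)
      obtain ⟨h1, h2⟩ := h a (by omega)
      refine ⟨(ct a - c) * d, mul_ne_zero (sub_ne_zero.2 h2) hd, ?_⟩
      rw [v, Module.End.mul_apply, LinearMap.sub_apply, h1, Module.algebraMap_end_apply, ← sub_smul,
        map_smul, hx, smul_smul]
  induction k with
  | zero => exact ⟨1, one_ne_zero, by simp [uu]⟩
  | succ k ih =>
    obtain ⟨d, hd, hx⟩ := ih fun j hj => h j (by omega)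
    obtain ⟨e, he, hy⟩ := hv (D.Q k) (a k) (h k (by omega))
    exact ⟨e * d, mul_ne_zero he hd, by
      rw [uu, Module.End.mul_apply, hy, map_smul, hx, smul_smul]⟩

end Eigen

namespace GenericParams

variable {K : Type*} [Field K] {n r N : ℕ} (G : GenericParams K n r N) {σ : ℕ → ℕ}

/-- The symmetrizers contribute geometric sums in `q`. The factors of `uu` contribute differences
between `Q k` and contents of boxes in components before the `k`-th. Both are non-zero by
genericity. -/
theorem m_initial (hσ : IsRows n r N σ) (hr : 0 < r) : ∃ c : K, c ≠ 0 ∧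
    (G.seminormal hσ).m N σ (Pi.single (initial hσ) 1) = c • Pi.single (initial hσ) 1 := by
  have hP : ∀ t, t ≤ r * N → ∃ c : K, c ≠ 0 ∧
      (G.seminormal hσ).P σ 0 t (Pi.single (initial hσ) 1) = c • Pi.single (initial hσ) 1 := by
    intro t
    induction t with
    | zero => intro _; exact ⟨1, one_ne_zero, by simp [FinHecke.P]⟩
    | succ t ih =>
      intro ht
      obtain ⟨c, hc, hx⟩ := ih (by omega)
      obtain ⟨d, hd, hy⟩ := FinHecke.X_apply (D := (G.seminormal hσ).toFinHecke)
        (x := Pi.single (initial hσ) 1) (p := start σ t) (l := σ t)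
        (fun i h0 h1 => G.seminormalOp_initial hσ ht h0 h1)
        fun l h0 h1 => G.geom_sum_ne_zero hr hσ.pos h0 (h1.trans (hσ.length_le ht))
      refine ⟨c * d, mul_ne_zero hc hd, ?_⟩
      rw [FinHecke.P, Module.End.mul_apply, hx, map_smul, zero_add, hy, smul_smul]
  obtain ⟨c, hc, hx⟩ := hP _ le_rfl
  obtain ⟨d, hd, hy⟩ := HeckeDatum.uu_apply (D := G.seminormal hσ) (x := Pi.single (initial hσ) 1)
    (a := fun k => start σ (k * N)) (ct := G.content σ) (k := r) (by
      intro k hk m hm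
      have hle := start_mono σ (Nat.mul_le_mul_right N hk.le)
      have hmn : m < n := by have := hσ.total; omega
      refine ⟨?_, ?_⟩
      · funext w
        rw [G.seminormal_L hσ hmn, Pi.smul_apply, smul_eq_mul, Pi.single_apply]
        split_ifs with h
        · rw [h]
          change G.content σ (ev 1 m) * 1 = _
          rw [ev_one]
        · rw [mul_zero, mul_zero]
      · obtain ⟨s, c, h1, h2, rfl⟩ := hσ.exists_row hmn
        rw [G.content_start_add h1 h2]
        intro h
        have hs : s < k * N := by
          by_contra h'
          have := start_mono σ (not_lt.1 h')
          omega
        have h3 : s / N < k := Nat.div_lt_of_lt_mul (by rwa [mul_comm])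
        have h4 := hσ.length_le h1
        have := G.generic (s / N) k c (s % N) 0 0 (by omega) hk (by omega) (Nat.mod_lt _ hσ.pos)
          (Nat.zero_le n) hσ.pos (by rw [h]; simp [seminormal])
        omega)
  refine ⟨c * d, mul_ne_zero hc hd, ?_⟩
  rw [m, Module.End.mul_apply, hx, map_smul, hy, smul_smul]

/-- Induction on the length. Undoing a descent preserves standardness, and `T i` minus its diagonal
coefficient carries the shorter basis vector to the longer one with coefficient `1`. -/
theorem exists_adjoin_apply (hσ : IsRows n r N σ) (w : StdFilling n r N σ) :
    ∃ h ∈ Algebra.adjoin K ((G.seminormal hσ).T '' Set.Iio n),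
      h (Pi.single (initial hσ) 1) = Pi.single w 1 := by
  induction hk : inv w.1 generalizing w with
  | zero =>
    obtain rfl : w = initial hσ := Subtype.ext (inv_eq_zero hk)
    exact ⟨1, one_mem _, rfl⟩
  | succ k ih =>
    obtain ⟨i, h0, h1, h2⟩ := exists_descent (u := w.1) (by
      intro h; rw [h, ArikiKoike.inv_one] at hk; omega)
    have h3 := inv_mul_sw_of_gt h0 h1 h2
    have hstd : RowColIncreasing r N σ (w.1 * sw n i)⁻¹ := by
      by_contra h
      have := (G.adjacent_of_not hσ w.2 h0 h1 h).1
      omega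
    obtain ⟨h, hh, he⟩ := ih ⟨_, hstd⟩ (by change inv (w.1 * sw n i) = k; omega)
    obtain ⟨i, rfl⟩ : ∃ k, i = k + 1 := ⟨i - 1, by omega⟩
    refine ⟨((G.seminormal hσ).T (i + 1) - algebraMap K _ (G.diagCoeff
      (G.content σ (ev (w.1 * sw n (i + 1)) i))
      (G.content σ (ev (w.1 * sw n (i + 1)) (i + 1))))) * h, ?_, ?_⟩
    · exact mul_mem (sub_mem (Algebra.subset_adjoin ⟨_, h1, rfl⟩) (algebraMap_mem _ _)) hh
    · rw [Module.End.mul_apply, he, LinearMap.sub_apply, Module.algebraMap_end_apply]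
      change G.seminormalOp σ (i + 1) _ - _ = _
      rw [← res_single, G.seminormalOp_res hσ h1, G.preOp_single h1, map_add, map_smul, map_smul,
        add_sub_cancel_left, mul_assoc, sw_mul_self, mul_one, res_single, ev_mul_sw_succ h1,
        ev_mul_sw_succ h1, if_pos rfl, if_neg (by omega), if_pos rfl, offCoeff,
        if_neg (by rw [Nat.add_sub_cancel] at h2; omega), one_smul]

/-- The `T_u m_σ δ_1`, with `u` standard, are linearly independent. -/
theorem linearIndependent_tw_m (hσ : IsRows n r N σ) (hN : n < N) (hr : 0 < r) :
    LinearIndependent K fun u : {u : Equiv.Perm (Fin n) // RowColIncreasing r N σ u} =>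
      ((G.seminormal hσ).tw u.1 * (G.seminormal hσ).m N σ) (Pi.single (initial hσ) 1) := by
  classical
  let e : {u : Equiv.Perm (Fin n) // RowColIncreasing r N σ u} ≃ StdFilling n r N σ :=
    (Equiv.inv _).subtypeEquiv fun u => by rw [Equiv.inv_apply, inv_inv]
  -- The vectors span, since the initial vector is cyclic and an eigenvector of `m_σ` with non-zero
  -- eigenvalue, and their number is the dimension.
  refine linearIndependent_of_top_le_span_of_card_eq_finrank ?_ ?_
  · obtain ⟨c, hc, hm⟩ := G.m_initial hσ hr
    have hspan : ∀ w : StdFilling n r N σ, (Pi.single w (1 : K) : StdFilling n r N σ → K) ∈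
        Submodule.span K (Set.range fun u : {u : Equiv.Perm (Fin n) // RowColIncreasing r N σ u} =>
          ((G.seminormal hσ).tw u.1 * (G.seminormal hσ).m N σ) (Pi.single (initial hσ) 1)) := by
      intro w
      obtain ⟨h, hh, he⟩ := G.exists_adjoin_apply hσ w
      have h1 := adjoin_mul_m_mem hσ (G.seminormal_vanishes hσ hN) hh
      have h2 : ∀ x ∈ (G.seminormal hσ).stdSpan N σ, x (Pi.single (initial hσ) 1) ∈
          Submodule.span K (Set.range
            fun u : {u : Equiv.Perm (Fin n) // RowColIncreasing r N σ u} =>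
            ((G.seminormal hσ).tw u.1 * (G.seminormal hσ).m N σ) (Pi.single (initial hσ) 1)) := by
        intro x hx
        induction hx using Submodule.span_induction with
        | mem x hx =>
          obtain ⟨u, hu, rfl⟩ := hx
          exact Submodule.subset_span ⟨⟨u, hu⟩, rfl⟩
        | zero => exact zero_mem _
        | add x y _ _ hx hy => exact add_mem hx hy
        | smul a x _ hx => exact Submodule.smul_mem _ a hx
      have h3 := h2 _ h1
      rw [Module.End.mul_apply, hm, map_smul, he] at h3
      exact (Submodule.smul_mem_iff _ hc).1 h3
    intro f _
    rw [pi_eq_sum_univ' f]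
    refine Submodule.sum_mem _ fun w _ => Submodule.smul_mem _ _ ?_
    exact hspan w
  · rw [Module.finrank_fintype_fun_eq_card]
    exact Fintype.card_congr e

end GenericParams

end ArikiKoike

namespace ArikiKoike

open HeckeDatum

/-! ### Subalgebras and homomorphisms -/

section Mem

variable {R A : Type*} [CommRing R] [Ring A] [Algebra R A] {n r : ℕ} {S : Subalgebra R A}

theorem FinHecke.U_mem {D : FinHecke R A n} {p a : ℕ}
    (h : ∀ i, p < i → i ≤ p + a → D.T i ∈ S) : D.U p a ∈ S := by
  induction a with
  | zero => exact one_mem _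
  | succ a ih =>
    exact mul_mem (ih fun i h0 h1 => h i h0 (by omega)) (h _ (by omega) (by omega))

theorem FinHecke.X_mem {D : FinHecke R A n} {p l : ℕ}
    (h : ∀ i, p < i → i < p + l → D.T i ∈ S) : D.X p l ∈ S := by
  induction l generalizing p with
  | zero => rw [X]; exact one_mem _
  | succ l ih =>
    rw [X_succ]
    refine mul_mem (ih fun i h0 h1 => h i (by omega) (by omega)) (sum_mem fun j hj => ?_)
    have := Finset.mem_range.1 hj
    exact U_mem fun i h0 h1 => h i h0 (by omega)

theorem FinHecke.P_mem {D : FinHecke R A n} {ρ : ℕ → ℕ} {s t : ℕ}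
    (h : ∀ i, 0 < i → i < start ρ (s + t) → D.T i ∈ S) : D.P ρ s t ∈ S := by
  induction t with
  | zero => exact one_mem _
  | succ t ih =>
    have h1 := start_succ ρ (s + t)
    rw [← add_assoc] at h
    exact mul_mem (X_mem fun i h0 h2 => h i (by omega) (by omega))
      (ih fun i h0 h2 => h i h0 (by omega))

namespace HeckeDatum

variable {D : HeckeDatum R A n r}

theorem L_mem (h : ∀ i < n, D.T i ∈ S) {m : ℕ} (hm : m < n) : D.L m ∈ S := by
  induction m with
  | zero => exact h 0 hm
  | succ m ih => exact S.smul_mem (mul_mem (mul_mem (h _ hm) (ih (by omega))) (h _ hm)) _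

theorem v_mem (h : ∀ i < n, D.T i ∈ S) (c : R) {a : ℕ} (ha : a ≤ n) : D.v c a ∈ S := by
  induction a with
  | zero => exact one_mem _
  | succ a ih => exact mul_mem (ih (by omega)) (sub_mem (L_mem h ha) (S.algebraMap_mem _))

theorem uu_mem (h : ∀ i < n, D.T i ∈ S) {a : ℕ → ℕ} {k : ℕ} (ha : ∀ j < k, a j ≤ n) :
    D.uu a k ∈ S := by
  induction k with
  | zero => exact one_mem _
  | succ k ih => exact mul_mem (ih fun j hj => ha j (by omega)) (v_mem h _ (ha k (by omega)))

theorem m_mem (h : ∀ i < n, D.T i ∈ S) {N : ℕ} {ρ : ℕ → ℕ} (hn : start ρ (r * N) ≤ n) :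
    D.m N ρ ∈ S :=
  mul_mem (uu_mem h (before_le_of_start hn))
    (FinHecke.P_mem fun i _ h1 => h i (by rw [zero_add] at h1; omega))

end HeckeDatum

end Mem

section Map

variable {R A R' A' : Type*} [CommRing R] [Ring A] [Algebra R A] [CommRing R'] [Ring A']
  [Algebra R' A'] {n r : ℕ} {f : A →+* A'}

theorem FinHecke.map_U {D : FinHecke R A n} {D' : FinHecke R' A' n}
    (h : ∀ i, f (D.T i) = D'.T i) (p a : ℕ) : f (D.U p a) = D'.U p a := by
  induction a with
  | zero => exact map_one f
  | succ a ih => rw [U, U, map_mul, ih, h]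

theorem FinHecke.map_X {D : FinHecke R A n} {D' : FinHecke R' A' n}
    (h : ∀ i, f (D.T i) = D'.T i) (p l : ℕ) : f (D.X p l) = D'.X p l := by
  induction l generalizing p with
  | zero => rw [X, X, map_one]
  | succ l ih =>
    rw [X_succ, X_succ, map_mul, ih, Y, Y, map_sum]
    simp only [map_U h]

theorem FinHecke.map_P {D : FinHecke R A n} {D' : FinHecke R' A' n}
    (h : ∀ i, f (D.T i) = D'.T i) (ρ : ℕ → ℕ) (s t : ℕ) : f (D.P ρ s t) = D'.P ρ s t := by
  induction t with
  | zero => exact map_one f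
  | succ t ih => rw [P, P, map_mul, ih, map_X h]

theorem FinHecke.map_tp {D : FinHecke R A n} {D' : FinHecke R' A' n}
    (h : ∀ i, f (D.T i) = D'.T i) (l : List ℕ) : f (D.tp l) = D'.tp l := by
  induction l with
  | nil => exact map_one f
  | cons i l ih => rw [tp, tp, map_mul, ih, h]

theorem FinHecke.map_tw {D : FinHecke R A n} {D' : FinHecke R' A' n}
    (h : ∀ i, f (D.T i) = D'.T i) (u : Equiv.Perm (Fin n)) : f (D.tw u) = D'.tw u :=
  map_tp h _

theorem HeckeDatum.map_m {D : HeckeDatum R A n r} {D' : HeckeDatum R' A' n r}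
    (h : ∀ i, f (D.T i) = D'.T i) (hqi : f (algebraMap R A D.qi) = algebraMap R' A' D'.qi)
    (hQ : ∀ k < r, f (algebraMap R A (D.Q k)) = algebraMap R' A' (D'.Q k)) (N : ℕ) (ρ : ℕ → ℕ) :
    f (D.m N ρ) = D'.m N ρ := by
  have hL : ∀ m, f (D.L m) = D'.L m := by
    intro m
    induction m with
    | zero => exact h 0
    | succ m ih =>
      rw [L, L, Algebra.smul_def, Algebra.smul_def, map_mul, map_mul, map_mul, hqi, ih, h]
  have hv : ∀ k < r, ∀ a, f (D.v (D.Q k) a) = D'.v (D'.Q k) a := by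
    intro k hk a
    induction a with
    | zero => exact map_one f
    | succ a ih => rw [v, v, map_mul, ih, map_sub, hL, hQ k hk]
  have hu : ∀ a : ℕ → ℕ, ∀ k ≤ r, f (D.uu a k) = D'.uu a k := by
    intro a k
    induction k with
    | zero => intro _; exact map_one f
    | succ k ih => intro hk; rw [uu, uu, map_mul, ih (by omega), hv k hk]
  rw [m, m, map_mul, hu _ r le_rfl, FinHecke.map_P h]

end Map

/-! ### Products -/

section Prod

variable {R S A S' A' : Type*} [CommRing R] [CommRing S] [Ring A] [Algebra S A] [Algebra R S]
  [Algebra R A] [IsScalarTower R S A] [CommRing S'] [Ring A'] [Algebra S' A'] [Algebra R S']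
  [Algebra R A'] [IsScalarTower R S' A'] {n r : ℕ}

/-- Two data with parameters that come from the same ring, side by side. -/
def HeckeDatum.prod (D : HeckeDatum S A n r) (D' : HeckeDatum S' A' n r) (q qi : R) (Q : ℕ → R)
    (hqi : q * qi = 1) (hq : algebraMap R S q = D.q) (hq' : algebraMap R S' q = D'.q)
    (hQ : ∀ k, algebraMap R S (Q k) = D.Q k) (hQ' : ∀ k, algebraMap R S' (Q k) = D'.Q k) :
    HeckeDatum R (A × A') n r where
  q := q
  qi := qi
  Q := Q
  q_mul_qi := hqi
  T i := (D.T i, D'.T i)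
  quad i h0 h1 := by
    refine Prod.ext ?_ ?_
    · have := D.quad i h0 h1
      rw [← hq, ← map_one (algebraMap R S), ← map_sub, algebraMap_smul, algebraMap_smul] at this
      exact this
    · have := D'.quad i h0 h1
      rw [← hq', ← map_one (algebraMap R S'), ← map_sub, algebraMap_smul, algebraMap_smul] at this
      exact this
  braid i h0 h1 := Prod.ext (D.braid i h0 h1) (D'.braid i h0 h1)
  comm i j h0 h1 h2 := Prod.ext (D.comm i j h0 h1 h2) (D'.comm i j h0 h1 h2)
  cyclo h0 := by
    refine Prod.ext ?_ ?_
    · rw [← RingHom.coe_fst, map_list_prod, List.map_map]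
      refine Eq.trans ?_ (D.cyclo h0)
      congr 2
      funext k
      rw [← hQ k, ← IsScalarTower.algebraMap_apply]
      rfl
    · rw [← RingHom.coe_snd, map_list_prod, List.map_map]
      refine Eq.trans ?_ (D'.cyclo h0)
      congr 2
      funext k
      rw [← hQ' k, ← IsScalarTower.algebraMap_apply]
      rfl
  braidFour h1 := Prod.ext (D.braidFour h1) (D'.braidFour h1)
  comm_zero j h0 h1 := Prod.ext (D.comm_zero j h0 h1) (D'.comm_zero j h0 h1)

end Prod

theorem HeckeDatum.map_qi {R S A : Type*} [CommRing R] [CommRing S] [Ring A] [Algebra S A]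
    [Algebra R S] {n r : ℕ} (D : HeckeDatum S A n r) {q qi : R} (hqi : q * qi = 1)
    (hq : algebraMap R S q = D.q) : algebraMap R S qi = D.qi := by
  have h1 := congrArg (algebraMap R S) hqi
  rw [map_mul, map_one, hq] at h1
  calc algebraMap R S qi = (D.q * D.qi) * algebraMap R S qi := by rw [D.q_mul_qi, one_mul]
    _ = D.qi * (D.q * algebraMap R S qi) := by ring
    _ = D.qi := by rw [h1, mul_one]

/-- If the parameters lift to generic ones, then `m_σ A m_σ` is spanned by `m_σ`, provided that
the `m_ρ` above it vanish. -/
theorem HeckeDatum.exists_m_mul_m_of_lift {R S A K : Type*} [CommRing R] [CommRing S] [Ring A]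
    [Algebra S A] [Algebra R S] [Algebra R A] [IsScalarTower R S A] [Field K] [Algebra R K]
    (hK : Function.Injective (algebraMap R K)) (hS : Function.Surjective (algebraMap R S))
    {n r N : ℕ} (D : HeckeDatum S A n r) (G : GenericParams K n r N) {q qi : R} {Q : ℕ → R}
    (hqi : q * qi = 1) (hq : algebraMap R S q = D.q) (hq' : algebraMap R K q = G.q)
    (hQ : ∀ k, algebraMap R S (Q k) = D.Q k) (hQ' : ∀ k, algebraMap R K (Q k) = G.Q k)
    {σ : ℕ → ℕ} (hσ : IsRows n r N σ) (hN : n < N) (hr : 0 < r) (hv : D.Vanishes N σ) {h : A}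
    (hh : h ∈ Algebra.adjoin S (D.T '' Set.Iio n)) : ∃ c : S, D.m N σ * h * D.m N σ =
      c • D.m N σ := by
  set E := G.seminormal hσ with hE
  set B := D.prod E q qi Q hqi hq hq' hQ hQ' with hB
  have hfst : ∀ ρ, (B.m N ρ).1 = D.m N ρ := fun ρ =>
    map_m (D := B) (D' := D) (f := RingHom.fst _ _) (fun i => rfl) (by
      rw [← D.map_qi hqi hq, ← IsScalarTower.algebraMap_apply]; rfl) (fun k _ => by
      rw [← hQ k, ← IsScalarTower.algebraMap_apply]; rfl) N ρ
  have hsnd : ∀ ρ, (B.m N ρ).2 = E.m N ρ := fun ρ =>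
    map_m (D := B) (D' := E) (f := RingHom.snd _ _) (fun i => rfl) (by
      rw [← E.map_qi hqi hq', ← IsScalarTower.algebraMap_apply]; rfl) (fun k _ => by
      rw [hE, show (G.seminormal hσ).Q k = G.Q k from rfl, ← hQ' k,
        ← IsScalarTower.algebraMap_apply]; rfl) N ρ
  have hsndtw : ∀ u, (B.tw u).2 = E.tw u := fun u =>
    FinHecke.map_tw (D := B.toFinHecke) (D' := E.toFinHecke) (f := RingHom.snd _ _)
      (fun i => rfl) u
  have hvB : B.Vanishes N σ := fun ρ h1 h2 h3 =>
    Prod.ext ((hfst ρ).trans (hv ρ h1 h2 h3))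
      ((hsnd ρ).trans (G.seminormal_vanishes hσ hN ρ h1 h2 h3))
  -- Only the first component of the lift is prescribed. Scalars lift because `R → S` is surjective.
  obtain ⟨h', hh', rfl⟩ : ∃ h' ∈ Algebra.adjoin R (B.T '' Set.Iio n), h'.1 = h := by
    induction hh using Algebra.adjoin_induction with
    | mem x hx =>
      obtain ⟨i, hi, rfl⟩ := hx
      exact ⟨B.T i, Algebra.subset_adjoin ⟨i, hi, rfl⟩, rfl⟩
    | algebraMap c =>
      obtain ⟨c, rfl⟩ := hS c
      refine ⟨algebraMap R _ c, Subalgebra.algebraMap_mem _ _, ?_⟩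
      rw [← IsScalarTower.algebraMap_apply]
      rfl
    | add x y _ _ hx hy =>
      obtain ⟨x, hx, rfl⟩ := hx
      obtain ⟨y, hy, rfl⟩ := hy
      exact ⟨x + y, add_mem hx hy, rfl⟩
    | mul x y _ _ hx hy =>
      obtain ⟨x, hx, rfl⟩ := hx
      obtain ⟨y, hy, rfl⟩ := hy
      exact ⟨x * y, mul_mem hx hy, rfl⟩
  have hmem := adjoin_mul_m_mem hσ hvB (mul_mem (m_mem (D := B)
    (S := Algebra.adjoin R (B.T '' Set.Iio n)) (fun i hi => Algebra.subset_adjoin ⟨i, hi, rfl⟩)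
    hσ.total.le) hh')
  have hrange : B.stdSpan N σ = Submodule.span R (Set.range
      fun u : {u : Equiv.Perm (Fin n) // RowColIncreasing r N σ u} => B.tw u.1 * B.m N σ) := by
    rw [stdSpan]
    congr 1
    ext x
    constructor
    · rintro ⟨u, hu, rfl⟩
      exact ⟨⟨u, hu⟩, rfl⟩
    · rintro ⟨u, rfl⟩
      exact ⟨u.1, u.2, rfl⟩
  classical
  rw [hrange, Submodule.mem_span_range_iff_exists_fun] at hmem
  -- Spanning in the product algebra yields one family of coefficients in `R` that is valid in both
  -- factors.
  obtain ⟨a, ha⟩ := hmem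
  let one : {u : Equiv.Perm (Fin n) // RowColIncreasing r N σ u} :=
    ⟨1, GenericParams.rowColIncreasing_one hσ⟩
  set δ : StdFilling n r N σ → K := Pi.single (GenericParams.initial hσ) 1 with hδ
  obtain ⟨c, hc, hm⟩ := G.m_initial hσ hr
  have hli := G.linearIndependent_tw_m hσ hN hr
  have h1 : ∑ u, algebraMap R K (a u) • (E.tw u.1 * E.m N σ) δ =
      (E.m N σ * h'.2 * E.m N σ) δ := by
    have h2 := congrArg (fun x : A × Module.End K (StdFilling n r N σ → K) => x.2 δ) ha
    simp only [Prod.snd_sum, Prod.smul_snd, Prod.snd_mul, hsnd, hsndtw, LinearMap.sum_apply,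
      LinearMap.smul_apply] at h2
    simpa only [algebraMap_smul] using h2
  -- In the generic factor everything in the image of `m_σ` is a multiple of `δ`, hence of `m_σ δ =
  -- c • δ`, which is the member of the independent family with index `1`.
  have h2 : (E.m N σ * h'.2 * E.m N σ) δ = ((E.m N σ * h'.2 * E.m N σ) δ
      (GenericParams.initial hσ) * c⁻¹) • (E.tw one.1 * E.m N σ) δ := by
    have e1 : (E.tw one.1 * E.m N σ) δ = c • δ := by
      rw [FinHecke.tw_one, one_mul, hm]
    rw [e1, smul_smul, inv_mul_cancel_right₀ hc]
    funext w
    rw [Pi.smul_apply, smul_eq_mul, hδ, Pi.single_apply]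
    split_ifs with hw
    · rw [hw, mul_one]
    · rw [mul_zero, mul_assoc (E.m N σ), Module.End.mul_apply]
      exact G.m_apply_eq_zero hσ hN _ hw
  -- Comparing coefficients in the linearly independent family gives zero in `K`, and `R` embeds
  -- into `K`.
  have h3 : ∀ u, u ≠ one → a u = 0 := by
    intro u hu
    rw [h2] at h1
    have h4 := Fintype.linearIndependent_iff.1 hli (fun u => algebraMap R K (a u) -
      if u = one then ((E.m N σ * h'.2 * E.m N σ) δ (GenericParams.initial hσ) * c⁻¹) else 0) (by
        simp only [sub_smul, Finset.sum_sub_distrib, ite_smul, zero_smul, Finset.sum_ite_eq',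
          Finset.mem_univ, if_true]
        rw [sub_eq_zero]
        exact h1) u
    rw [if_neg hu, sub_zero] at h4
    exact hK (h4.trans (map_zero _).symm)
  refine ⟨algebraMap R S (a one), ?_⟩
  rw [Finset.sum_eq_single one (fun u _ hu => by rw [h3 u hu, zero_smul])
    (fun h => absurd (Finset.mem_univ _) h)] at ha
  have h5 := congrArg Prod.fst ha
  rw [FinHecke.tw_one, one_mul, Prod.smul_fst, Prod.fst_mul, Prod.fst_mul, hfst] at h5
  rw [algebraMap_smul, h5]

end ArikiKoike

/-! ### Generic parameters over Laurent polynomials and their specialization -/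

namespace ArikiKoike

open HeckeDatum LaurentPolynomial

/-- The parameters `q u` and `Q k * u ^ ((n + N + 1) * k)` over the field of fractions of the
Laurent polynomials in `u`. -/
noncomputable def laurentParams {F : Type*} [Field F] (n r N : ℕ) (q : F) (Q : ℕ → F)
    (hq : q ≠ 0) (hQ : ∀ k, Q k ≠ 0) : GenericParams (FractionRing F[T;T⁻¹]) n r N where
  q := algebraMap F[T;T⁻¹] _ (C q * LaurentPolynomial.T 1)
  qi := algebraMap F[T;T⁻¹] _ (C q⁻¹ * LaurentPolynomial.T (-1))
  Q k := algebraMap F[T;T⁻¹] _ (C (Q k) * LaurentPolynomial.T ((n + N + 1) * k : ℕ))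
  q_mul_qi := by
    rw [← map_mul, mul_mul_mul_comm, ← map_mul, mul_inv_cancel₀ hq, ← T_add]
    simp
  generic := by
    intro k k' a b a' b' hk hk' ha hb ha' hb' h
    have hmono : ∀ k a b : ℕ, C (Q k) * LaurentPolynomial.T ((n + N + 1) * k : ℕ) *
        (C q * LaurentPolynomial.T 1) ^ a * (C q⁻¹ * LaurentPolynomial.T (-1)) ^ b =
        C (Q k * q ^ a * q⁻¹ ^ b) * LaurentPolynomial.T (((n + N + 1) * k : ℕ) + a - b) := by
      intro k a b
      rw [mul_pow, mul_pow, T_pow, T_pow, sub_eq_add_neg, T_add, T_add, ← map_pow, ← map_pow,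
        map_mul, map_mul]
      simp only [mul_one, mul_neg]
      ring
    simp only [← map_pow, ← map_mul, hmono] at h
    -- A content is a monomial of degree `(n + N + 1) * k + a - b` with `-N < a - b ≤ n`. The ranges
    -- for different `k` are disjoint, so the degree determines both `k` and `a - b`.
    have h1 := congrArg LaurentPolynomial.degree
      (FaithfulSMul.algebraMap_injective F[T;T⁻¹] (FractionRing F[T;T⁻¹]) h)
    rw [degree_C_mul_T _ _ (by simp [hq, hQ]), degree_C_mul_T _ _ (by simp [hq, hQ])] at h1
    have h2 : (((n + N + 1) * k : ℕ) : ℤ) + a - b = ((n + N + 1) * k' : ℕ) + a' - b' :=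
      WithBot.coe_injective h1
    have h3 : k = k' := by
      rcases lt_trichotomy k k' with h4 | h4 | h4
      · obtain ⟨d, rfl⟩ : ∃ d, k' = k + 1 + d := ⟨k' - (k + 1), by omega⟩
        rw [show (n + N + 1) * (k + 1 + d) = (n + N + 1) * k + (n + N + 1) + (n + N + 1) * d by
          ring] at h2
        omega
      · exact h4
      · obtain ⟨d, rfl⟩ : ∃ d, k = k' + 1 + d := ⟨k - (k' + 1), by omega⟩
        rw [show (n + N + 1) * (k' + 1 + d) = (n + N + 1) * k' + (n + N + 1) + (n + N + 1) * d by
          ring] at h2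
        omega
    subst h3
    exact ⟨rfl, by omega⟩

/-- If the `m_ρ` above `m_σ` vanish, then `m_σ A m_σ` is spanned by `m_σ`. -/
theorem HeckeDatum.exists_m_mul_m {F A : Type*} [Field F] [Ring A] [Algebra F A] {n r N : ℕ}
    (D : HeckeDatum F A n r) (hQ : ∀ k, D.Q k ≠ 0) {σ : ℕ → ℕ} (hσ : IsRows n r N σ) (hN : n < N)
    (hr : 0 < r) (hv : D.Vanishes N σ) {h : A}
    (hh : h ∈ Algebra.adjoin F (D.T '' Set.Iio n)) :
    ∃ c : F, D.m N σ * h * D.m N σ = c • D.m N σ := by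
  have hq : D.q ≠ 0 := left_ne_zero_of_mul_eq_one D.q_mul_qi
  -- Evaluation of the variable at `1` recovers the given parameters and makes `A` an algebra over
  -- the Laurent polynomials.
  let ε : F[T;T⁻¹] →+* F := eval₂ (RingHom.id F) (1 : Fˣ)
  have hε : ∀ (c : F) (k : ℤ), ε (C c * LaurentPolynomial.T k) = c := fun c k => by
    simp [ε, eval₂_C_mul_T]
  let _ : Algebra F[T;T⁻¹] F := ε.toAlgebra
  let _ : Algebra F[T;T⁻¹] A := ((algebraMap F A).comp ε).toAlgebra'
    fun c x => Algebra.commutes (ε c) x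
  have _ : IsScalarTower F[T;T⁻¹] F A := IsScalarTower.of_algebraMap_eq fun _ => rfl
  refine D.exists_m_mul_m_of_lift (R := F[T;T⁻¹]) (K := FractionRing F[T;T⁻¹])
    (FaithfulSMul.algebraMap_injective _ _)
    (fun c => ⟨C c * LaurentPolynomial.T 0, hε c 0⟩) (laurentParams n r N D.q D.Q hq hQ)
    (q := C D.q * LaurentPolynomial.T 1) (qi := C D.q⁻¹ * LaurentPolynomial.T (-1))
    (Q := fun k => C (D.Q k) * LaurentPolynomial.T ((n + N + 1) * k : ℕ)) ?_ (hε _ _) rfl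
    (fun k => hε _ _) (fun _ => rfl) hσ hN hr hv hh
  rw [mul_mul_mul_comm, ← map_mul, mul_inv_cancel₀ hq, ← T_add]
  simp

end ArikiKoike

/-! ### Multipartitions as lists of row lengths -/

namespace ArikiKoike

open HeckeDatum

theorem card_eq_sum_rowLen (μ : YoungDiagram) {M : ℕ} (hM : ∀ i, M ≤ i → μ.rowLen i = 0) :
    μ.card = ∑ i ∈ Finset.range M, μ.rowLen i := by
  have h : μ.cells = (Finset.range M).biUnion μ.row := by
    ext c
    simp only [Finset.mem_biUnion, Finset.mem_range, YoungDiagram.mem_row_iff,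
      YoungDiagram.mem_cells]
    constructor
    · intro hc
      refine ⟨c.1, ?_, hc, rfl⟩
      by_contra h
      have := YoungDiagram.mem_iff_lt_rowLen.1 (show (c.1, c.2) ∈ μ from hc)
      rw [hM _ (not_lt.1 h)] at this
      omega
    · rintro ⟨i, -, hc, -⟩
      exact hc
  rw [YoungDiagram.card, h, Finset.card_biUnion]
  · exact Finset.sum_congr rfl fun i _ => (μ.rowLen_eq_card).symm
  · intro i _ j _ hij
    rw [Function.onFun, Finset.disjoint_left]
    intro c hc hc'
    exact hij ((YoungDiagram.mem_row_iff.1 hc).2.symm.trans (YoungDiagram.mem_row_iff.1 hc').2)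

namespace Multipartition

variable {r n : ℕ}

theorem card_le (lam : Multipartition r n) (k : Fin r) : (lam.diag k).card ≤ n :=
  (Finset.single_le_sum (f := fun k => (lam.diag k).card) (fun _ _ => Nat.zero_le _)
    (Finset.mem_univ k)).trans_eq lam.sum_card

theorem rowLen_eq_zero (lam : Multipartition r n) (k : Fin r) {i : ℕ} (h : n ≤ i) :
    (lam.diag k).rowLen i = 0 := by
  by_contra h0
  have h1 : (i, 0) ∈ lam.diag k := YoungDiagram.mem_iff_lt_rowLen.2 (Nat.pos_of_ne_zero h0)
  have h2 := YoungDiagram.mem_iff_lt_colLen.1 h1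
  have h3 : (lam.diag k).colLen 0 ≤ (lam.diag k).card := by
    rw [YoungDiagram.colLen_eq_card]
    exact Finset.card_le_card (Finset.filter_subset _ _)
  have := lam.card_le k
  omega

/-- The row lengths of all components, with `n + 1` rows in each component. -/
def rows (lam : Multipartition r n) (s : ℕ) : ℕ :=
  if h : s / (n + 1) < r then (lam.diag ⟨s / (n + 1), h⟩).rowLen (s % (n + 1)) else 0

theorem rows_mul_add (lam : Multipartition r n) (k : Fin r) {i : ℕ} (hi : i < n + 1) :
    lam.rows (k * (n + 1) + i) = (lam.diag k).rowLen i := by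
  have h1 : (k.val * (n + 1) + i) / (n + 1) = k := by
    rw [mul_comm, Nat.mul_add_div (Nat.succ_pos n), Nat.div_eq_of_lt hi, add_zero]
  have h2 : (k.val * (n + 1) + i) % (n + 1) = i := by
    rw [mul_comm, Nat.mul_add_mod, Nat.mod_eq_of_lt hi]
  unfold rows
  rw [dif_pos (by rw [h1]; exact k.isLt), h2]
  congr 2
  exact Fin.ext h1

theorem start_rows_add (lam : Multipartition r n) (k : Fin r) {j : ℕ} (hj : j ≤ n + 1) :
    start lam.rows (k * (n + 1) + j) =
      start lam.rows (k * (n + 1)) + ∑ i ∈ Finset.range j, (lam.diag k).rowLen i := by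
  induction j with
  | zero => simp
  | succ j ih =>
    rw [← add_assoc, start_succ, ih (by omega), rows_mul_add lam k hj, Finset.sum_range_succ]
    omega

theorem card_eq (lam : Multipartition r n) (k : Fin r) :
    (lam.diag k).card = ∑ i ∈ Finset.range (n + 1), (lam.diag k).rowLen i :=
  card_eq_sum_rowLen _ fun _ h => lam.rowLen_eq_zero k (by omega)

theorem start_rows_eq_before (lam : Multipartition r n) (k : Fin r) :
    start lam.rows (k * (n + 1)) = lam.before k := by
  obtain ⟨k, hk⟩ := k
  change start lam.rows (k * (n + 1)) = lam.before ⟨k, hk⟩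
  induction k with
  | zero =>
    rw [before, zero_mul, start_zero, eq_comm]
    refine Finset.sum_eq_zero fun i hi => ?_
    have := Fin.lt_def.1 (Finset.mem_Iio.1 hi)
    exact absurd this (Nat.not_lt_zero _)
  | succ k ih =>
    have h1 := lam.start_rows_add ⟨k, by omega⟩ (j := n + 1) le_rfl
    rw [← card_eq] at h1
    change start lam.rows (k * (n + 1) + (n + 1)) = start lam.rows (k * (n + 1)) + _ at h1
    rw [ih (by omega)] at h1
    rw [add_mul, one_mul, h1, before, before]
    have h2 : Finset.Iio (⟨k + 1, hk⟩ : Fin r) =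
        insert (⟨k, by omega⟩ : Fin r) (Finset.Iio ⟨k, by omega⟩) := by
      ext i
      simp only [Finset.mem_Iio, Finset.mem_insert, Fin.lt_def, Fin.ext_iff]
      omega
    rw [h2, Finset.sum_insert (by simp)]
    omega

theorem start_rows_total (lam : Multipartition r n) : start lam.rows (r * (n + 1)) = n := by
  rcases Nat.eq_zero_or_pos r with rfl | hr
  · rw [zero_mul, start_zero]
    simpa using lam.sum_card
  · have h1 := lam.start_rows_add ⟨r - 1, by omega⟩ (j := n + 1) le_rfl
    rw [start_rows_eq_before, ← card_eq] at h1
    change start lam.rows ((r - 1) * (n + 1) + (n + 1)) = _ at h1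
    have h2 : (r - 1) * (n + 1) + (n + 1) = r * (n + 1) := by
      rw [← Nat.succ_mul, Nat.succ_eq_add_one, Nat.sub_add_cancel hr]
    rw [h2] at h1
    rw [h1, before]
    have h3 : (Finset.univ : Finset (Fin r)) =
        insert (⟨r - 1, by omega⟩ : Fin r) (Finset.Iio ⟨r - 1, by omega⟩) := by
      ext i
      have := i.isLt
      simp only [Finset.mem_univ, Finset.mem_Iio, Finset.mem_insert, Fin.lt_def, Fin.ext_iff,
        true_iff]
      omega
    rw [add_comm, ← Finset.sum_insert (f := fun i => (lam.diag i).card) (by simp), ← h3,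
      lam.sum_card]

theorem div_mod_rows {s : ℕ} (hs : s < r * (n + 1)) :
    s = s / (n + 1) * (n + 1) + s % (n + 1) ∧ s / (n + 1) < r ∧ s % (n + 1) < n + 1 :=
  ⟨(Nat.div_add_mod' s _).symm, Nat.div_lt_of_lt_mul (by rwa [mul_comm]),
    Nat.mod_lt _ (Nat.succ_pos n)⟩

theorem rows_succ_le (lam : Multipartition r n) {s : ℕ} (hs : s + 1 < r * (n + 1))
    (h : (s + 1) % (n + 1) ≠ 0) : lam.rows (s + 1) ≤ lam.rows s := by
  obtain ⟨h1, h2, h3⟩ := div_mod_rows hs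
  obtain ⟨i, hi⟩ : ∃ i, (s + 1) % (n + 1) = i + 1 := ⟨(s + 1) % (n + 1) - 1, by omega⟩
  rw [hi] at h1 h3
  have h4 : s = (⟨(s + 1) / (n + 1), h2⟩ : Fin r) * (n + 1) + i := by
    change s = (s + 1) / (n + 1) * (n + 1) + i
    omega
  have h5 : s + 1 = (⟨(s + 1) / (n + 1), h2⟩ : Fin r) * (n + 1) + (i + 1) := h1
  have e1 := lam.rows_mul_add ⟨(s + 1) / (n + 1), h2⟩ h3
  have e2 := lam.rows_mul_add ⟨(s + 1) / (n + 1), h2⟩ (show i < n + 1 by omega)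
  rw [← h5] at e1
  rw [← h4] at e2
  rw [e1, e2]
  exact (lam.diag _).rowLen_anti _ _ (Nat.le_succ i)

theorem isRows (lam : Multipartition r n) : IsRows n r (n + 1) lam.rows :=
  isRows_of_lt (Nat.lt_succ_self n) lam.start_rows_total fun _ => lam.rows_succ_le

/-- Dominance compares partial sums over all `j`, while the list keeps `n + 1` rows per component.
Larger `j` add only empty rows. -/
theorem dominates_of_start_le {lam mu : Multipartition r n}
    (h : ∀ s ≤ r * (n + 1), start mu.rows s ≤ start lam.rows s) : lam.Dominates mu := by
  intro k j _
  change mu.before k + _ ≤ lam.before k + _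
  have key : ∀ j ≤ n + 1, mu.before k + ∑ i ∈ Finset.range j, (mu.diag k).rowLen i ≤
      lam.before k + ∑ i ∈ Finset.range j, (lam.diag k).rowLen i := by
    intro j hj
    rw [← start_rows_eq_before, ← start_rows_eq_before, ← start_rows_add _ k hj,
      ← start_rows_add _ k hj]
    refine h _ ?_
    calc k.val * (n + 1) + j ≤ k.val * (n + 1) + (n + 1) := by omega
      _ = (k.val + 1) * (n + 1) := by ring
      _ ≤ r * (n + 1) := Nat.mul_le_mul_right _ k.isLt
  rcases Nat.le_total j (n + 1) with hj | hj
  · exact key j hj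
  · have h1 : ∀ nu : Multipartition r n, ∑ i ∈ Finset.range j, (nu.diag k).rowLen i =
        ∑ i ∈ Finset.range (n + 1), (nu.diag k).rowLen i := fun nu => by
      rw [← card_eq, card_eq_sum_rowLen (M := j) _ fun i hi => nu.rowLen_eq_zero k (by omega)]
    rw [h1, h1]
    exact key _ le_rfl

/-- A multipartition with given row lengths. -/
theorem exists_rows_eq {ρ : ℕ → ℕ} (hn : start ρ (r * (n + 1)) = n)
    (h : ∀ s, s + 1 < r * (n + 1) → (s + 1) % (n + 1) ≠ 0 → ρ (s + 1) ≤ ρ s) :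
    ∃ mu : Multipartition r n, ∀ s < r * (n + 1), mu.rows s = ρ s := by
  have hρ := isRows_of_lt (Nat.lt_succ_self n) hn h
  have hlt : ∀ (k : Fin r) (i : ℕ), i < n + 1 → k.val * (n + 1) + i < r * (n + 1) := by
    intro k i hi
    calc k.val * (n + 1) + i < k.val * (n + 1) + (n + 1) := by omega
      _ = (k.val + 1) * (n + 1) := by ring
      _ ≤ r * (n + 1) := Nat.mul_le_mul_right _ k.isLt
  -- Every row has length at most `n`, so the square of side `n + 1` cuts off no box.
  let d : Fin r → YoungDiagram := fun k =>
    { cells := (Finset.range (n + 1) ×ˢ Finset.range (n + 1)).filter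
        fun c => c.2 < ρ (k * (n + 1) + c.1)
      isLowerSet := by
        rintro ⟨a, b⟩ ⟨a', b'⟩ hle hab
        obtain ⟨h1, h2⟩ := hle
        simp only [Finset.coe_filter, Finset.mem_product, Finset.mem_range,
          Set.mem_ofPred_eq] at hab h1 h2 ⊢
        have h3 := hρ.le_of_le (s := k.val * (n + 1) + a') (s' := k.val * (n + 1) + a) (by omega)
          (hlt k a hab.1.1) (by
            rw [mul_comm, Nat.mul_add_div (Nat.succ_pos n), Nat.mul_add_div (Nat.succ_pos n),
              Nat.div_eq_of_lt (by omega), Nat.div_eq_of_lt (by omega)])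
        omega }
  have hd : ∀ (k : Fin r) (i : ℕ), i < n + 1 → (d k).rowLen i = ρ (k * (n + 1) + i) := by
    intro k i hi
    have h1 : ∀ j, j < (d k).rowLen i ↔ j < ρ (k * (n + 1) + i) := by
      intro j
      rw [← YoungDiagram.mem_iff_lt_rowLen, ← YoungDiagram.mem_cells]
      simp only [d, Finset.mem_filter, Finset.mem_product, Finset.mem_range]
      have := hρ.length_le (hlt k i hi)
      omega
    have h2 := h1 ((d k).rowLen i)
    have h3 := h1 (ρ (k * (n + 1) + i))
    omega
  have hd0 : ∀ (k : Fin r) (i : ℕ), n + 1 ≤ i → (d k).rowLen i = 0 := by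
    intro k i hi
    by_contra h0
    have h1 := YoungDiagram.mem_iff_lt_rowLen.2 (Nat.pos_of_ne_zero h0)
    rw [← YoungDiagram.mem_cells] at h1
    simp only [d, Finset.mem_filter, Finset.mem_product, Finset.mem_range] at h1
    omega
  have hsum : ∑ k, (d k).card = n := by
    have h1 : ∀ K : ℕ, K ≤ r →
        start ρ (K * (n + 1)) = ∑ k ∈ Finset.range K, if h : k < r then (d ⟨k, h⟩).card else 0 := by
      intro K
      induction K with
      | zero => intro _; simp
      | succ K ih =>
        intro hK
        have h2 : ∀ j ≤ n + 1, start ρ (K * (n + 1) + j) = start ρ (K * (n + 1)) +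
            ∑ i ∈ Finset.range j, (d ⟨K, hK⟩).rowLen i := by
          intro j
          induction j with
          | zero => intro _; simp
          | succ j ih2 =>
            intro hj
            have h3 : (d ⟨K, hK⟩).rowLen j = ρ (K * (n + 1) + j) := hd ⟨K, hK⟩ j hj
            rw [← add_assoc, start_succ, ih2 (by omega), Finset.sum_range_succ, h3]
            omega
        rw [Finset.sum_range_succ, dif_pos (show K < r from hK), ← ih (by omega), add_mul, one_mul, h2 _ le_rfl,
          card_eq_sum_rowLen _ (hd0 _)]
    rw [← hn, h1 r le_rfl, Finset.sum_range]
    simp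
  refine ⟨⟨d, hsum⟩, fun s hs => ?_⟩
  obtain ⟨h1, h2, h3⟩ := div_mod_rows hs
  rw [rows, dif_pos h2, hd _ _ h3]
  congr 1
  exact h1.symm

/-! ### The initial tableau -/

/-- The row of a box among the rows of all components. -/
def rowIndex {lam : Multipartition r n} (b : lam.boxes) : ℕ := comp b * (n + 1) + row b

theorem mem_boxes {lam : Multipartition r n} (b : lam.boxes) :
    (row b, col b) ∈ lam.diag (comp b) := by
  obtain ⟨b, hb⟩ := b
  obtain ⟨⟨k, c⟩, hc, rfl⟩ := Finset.mem_map.1 hb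
  exact (Finset.mem_sigma.1 hc).2

theorem exists_box {lam : Multipartition r n} {k : Fin r} {i j : ℕ} (h : (i, j) ∈ lam.diag k) :
    ∃ b : lam.boxes, comp b = k ∧ row b = i ∧ col b = j :=
  ⟨⟨toLex (k, toLex (i, j)), Finset.mem_map.2 ⟨⟨k, (i, j)⟩,
    Finset.mem_sigma.2 ⟨Finset.mem_univ _, h⟩, rfl⟩⟩, rfl, rfl, rfl⟩

theorem row_lt {lam : Multipartition r n} (b : lam.boxes) : row b < n + 1 := by
  by_contra h
  have h1 := YoungDiagram.mem_iff_lt_rowLen.1 (mem_boxes b)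
  rw [lam.rowLen_eq_zero _ (by omega)] at h1
  omega

theorem rowIndex_lt {lam : Multipartition r n} (b : lam.boxes) : rowIndex b < r * (n + 1) := by
  have h1 := row_lt b
  calc (comp b).val * (n + 1) + row b < (comp b).val * (n + 1) + (n + 1) := by omega
      _ = ((comp b).val + 1) * (n + 1) := by ring
      _ ≤ r * (n + 1) := Nat.mul_le_mul_right _ (comp b).isLt

theorem col_lt {lam : Multipartition r n} (b : lam.boxes) : col b < lam.rows (rowIndex b) := by
  rw [rowIndex, rows_mul_add lam _ (row_lt b)]
  exact YoungDiagram.mem_iff_lt_rowLen.1 (mem_boxes b)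

theorem rowIndex_eq_iff {lam : Multipartition r n} {b b' : lam.boxes} :
    rowIndex b = rowIndex b' ↔ comp b = comp b' ∧ row b = row b' := by
  constructor
  · intro h
    have h1 : ∀ b : lam.boxes, rowIndex b / (n + 1) = comp b ∧ rowIndex b % (n + 1) = row b :=
      fun b => ⟨by
        rw [rowIndex, mul_comm, Nat.mul_add_div (Nat.succ_pos n), Nat.div_eq_of_lt (row_lt b),
          add_zero], by
        rw [rowIndex, mul_comm, Nat.mul_add_mod, Nat.mod_eq_of_lt (row_lt b)]⟩
    exact ⟨Fin.ext (by rw [← (h1 b).1, ← (h1 b').1, h]), by rw [← (h1 b).2, ← (h1 b').2, h]⟩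
  · rintro ⟨h1, h2⟩
    rw [rowIndex, rowIndex, h1, h2]

/-- Numbering the boxes row by row is an order isomorphism onto `Fin n`, and there is only one. -/
theorem initialTableau_val {lam : Multipartition r n} (b : lam.boxes) :
    (lam.initialTableau b).val = start lam.rows (rowIndex b) + col b := by
  have hlt : ∀ b : lam.boxes, start lam.rows (rowIndex b) + col b < n := fun b => by
    have := lam.isRows.start_add_le (rowIndex_lt b)
    have := col_lt b
    omega
  let pos : lam.boxes → Fin n := fun b => ⟨_, hlt b⟩
  have hmono : StrictMono pos := by
    intro b b' h
    have h1 : rowIndex b < rowIndex b' ∨ rowIndex b = rowIndex b' ∧ col b < col b' := by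
      rcases (Prod.Lex.lt_iff (x := b.1) (y := b'.1)).1 h with h2 | ⟨h2, h3⟩
      · left
        have h3 : (comp b).val + 1 ≤ (comp b').val := h2
        have h4 := row_lt b
        calc (comp b).val * (n + 1) + row b < ((comp b).val + 1) * (n + 1) := by
              rw [add_mul]; omega
          _ ≤ (comp b').val * (n + 1) := Nat.mul_le_mul_right _ h3
          _ ≤ _ := Nat.le_add_right _ _
      · have h2' : comp b = comp b' := h2
        rcases (Prod.Lex.lt_iff).1 h3 with h4 | ⟨h4, h5⟩
        · left
          have h4' : row b < row b' := h4
          rw [rowIndex, rowIndex, h2']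
          omega
        · exact Or.inr ⟨rowIndex_eq_iff.2 ⟨h2', h4⟩, h5⟩
    rw [Fin.lt_def]
    change start lam.rows (rowIndex b) + col b < start lam.rows (rowIndex b') + col b'
    rcases h1 with h1 | ⟨h1, h2⟩
    · have h2 := start_mono lam.rows (show rowIndex b + 1 ≤ rowIndex b' from h1)
      rw [start_succ] at h2
      have := col_lt b
      omega
    · rw [h1]
      omega
  have hsurj : Function.Surjective pos := by
    intro x
    obtain ⟨s, c, h1, h2, h3⟩ := lam.isRows.exists_row x.isLt
    obtain ⟨h4, h5, h6⟩ := div_mod_rows h1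
    rw [rows, dif_pos h5] at h2
    obtain ⟨b, hb1, hb2, hb3⟩ := exists_box (YoungDiagram.mem_iff_lt_rowLen.2 h2)
    refine ⟨b, Fin.ext ?_⟩
    change start lam.rows (rowIndex b) + col b = x
    rw [h3, rowIndex, hb1, hb2, hb3]
    congr 2
    exact h4.symm
  have h1 : hmono.orderIsoOfSurjective pos hsurj =
      (lam.boxes.orderIsoOfFin lam.card_boxes).symm := Subsingleton.elim _ _
  change ((lam.boxes.orderIsoOfFin lam.card_boxes).symm b).val = _
  rw [← h1]
  rfl

theorem rowOf_initialTableau {lam : Multipartition r n} (b : lam.boxes) :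
    rowOf (r * (n + 1)) lam.rows (lam.initialTableau b) = rowIndex b := by
  rw [initialTableau_val, rowOf_start_add (rowIndex_lt b) (col_lt b)]

theorem isStandard_initialTableau (lam : Multipartition r n) : IsStandard lam.initialTableau := by
  intro b b' hc
  simp only [Fin.lt_def, initialTableau_val]
  refine ⟨fun h1 h2 => ?_, fun h1 h2 => ?_⟩
  · rw [rowIndex_eq_iff.2 ⟨hc, h1⟩]
    omega
  · have h3 := start_mono lam.rows (show rowIndex b + 1 ≤ rowIndex b' by
      rw [rowIndex, rowIndex, hc]; omega)
    rw [start_succ] at h3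
    have := col_lt b
    omega

theorem dPerm_initialTableau (lam : Multipartition r n) : dPerm lam.initialTableau = 1 :=
  Equiv.symm_trans_self _

theorem mem_rowStabilizer_iff {lam : Multipartition r n} {w : Equiv.Perm (Fin n)} :
    w ∈ lam.rowStabilizer ↔ w ∈ labelStab n (rowOf (r * (n + 1)) lam.rows) 0 := by
  have h : ∀ x : Fin n, rowOf (r * (n + 1)) lam.rows x =
      rowIndex (lam.initialTableau.symm x) := fun x => by
    rw [← rowOf_initialTableau, Equiv.apply_symm_apply]
  rw [mem_labelStab]
  constructor
  · refine fun hw => ⟨fun x hx => ?_, fun x hx => absurd hx (Nat.not_lt_zero _)⟩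
    rw [ev_of_lt w hx, h]
    exact (rowIndex_eq_iff.2 (hw ⟨x, hx⟩)).trans (h ⟨x, hx⟩).symm
  · intro hw x
    have := hw.1 x x.isLt
    rw [ev_val, h, h] at this
    exact rowIndex_eq_iff.1 this

end Multipartition

end ArikiKoike

/-! ### The algebra of the theorem as a `HeckeDatum` -/

namespace ArikiKoike

open HeckeDatum Multipartition

section Frozen

variable {n r : ℕ} {q : ℂ} {Q : Fin r → ℂ}

/-- The generators of the Hecke algebra. -/
noncomputable def heckeDatum (n : ℕ) {r : ℕ} (Q : Fin r → ℂ) (hq : q ≠ 0) :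
    HeckeDatum ℂ (HeckeAlg n q Q) n r where
  q := q
  qi := q⁻¹
  Q k := if h : k < r then Q ⟨k, h⟩ else 1
  q_mul_qi := mul_inv_cancel₀ hq
  T i := if h : i < n then T q Q ⟨i, h⟩ else 1
  quad i h0 h1 := by
    simp only [dif_pos h1]
    have h := T_quadratic (q := q) (Q := Q) ⟨i, h1⟩ h0
    rw [add_mul, mul_sub, one_mul, ← Algebra.commutes, ← Algebra.smul_def] at h
    rw [sub_smul, one_smul, ← Algebra.algebraMap_eq_smul_one]
    rw [← sub_eq_zero, ← h]
    abel
  braid i h0 h1 := by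
    simp only [dif_pos h1, dif_pos (show i < n by omega)]
    exact T_braidThree _ _ h0 rfl
  comm i j h0 h1 h2 := by
    simp only [dif_pos h2, dif_pos (show i < n by omega)]
    exact T_comm _ _ h1
  cyclo h0 := by
    have h := T_cyclotomic (q := q) (Q := Q) ⟨0, h0⟩ rfl
    rw [← h]
    congr 1
    apply List.ext_getElem
    · simp
    · intro k h1 h2
      have hk : k < r := by simpa using h1
      simp [h0, hk]
  braidFour h1 := by
    simp only [dif_pos h1, dif_pos (show 0 < n by omega)]
    exact T_braidFour _ _ rfl rfl
  comm_zero j h0 h1 := by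
    simp only [dif_pos h1, dif_pos (show 0 < n by omega)]
    exact T_comm _ _ (by simpa using h0)

variable (hq : q ≠ 0)

theorem heckeDatum_T {i : ℕ} (h : i < n) : (heckeDatum n Q hq).T i = T q Q ⟨i, h⟩ := dif_pos h

theorem heckeDatum_Q (k : Fin r) : (heckeDatum n Q hq).Q k = Q k := dif_pos k.isLt

/-- The value `1` outside the range is chosen so that this holds for all `k`, as
`HeckeDatum.exists_m_mul_m` asks. -/
theorem heckeDatum_Q_ne_zero (hQ : ∀ k, Q k ≠ 0) (k : ℕ) : (heckeDatum n Q hq).Q k ≠ 0 := by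
  change (if h : k < r then Q ⟨k, h⟩ else 1) ≠ 0
  split_ifs with h
  · exact hQ _
  · exact one_ne_zero

theorem toHecke_surjective : Function.Surjective (toHecke n q Q) :=
  RingQuot.mkAlgHom_surjective ℂ _

theorem adjoin_range_T : Algebra.adjoin ℂ (Set.range (T (n := n) q Q)) = ⊤ := by
  have h1 : Set.range (T (n := n) q Q) = toHecke n q Q '' Set.range (FreeAlgebra.ι ℂ) := by
    rw [← Set.range_comp]
    rfl
  rw [h1, ← AlgHom.map_adjoin, FreeAlgebra.adjoin_range_ι, Algebra.map_top,
    AlgHom.range_eq_top]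
  exact toHecke_surjective

theorem heckeDatum_adjoin (h : HeckeAlg n q Q) :
    h ∈ Algebra.adjoin ℂ ((heckeDatum n Q hq).T '' Set.Iio n) := by
  have h1 : Set.range (T q Q) = (heckeDatum n Q hq).T '' Set.Iio n := by
    ext x
    constructor
    · rintro ⟨i, rfl⟩
      exact ⟨i, i.isLt, heckeDatum_T hq i.isLt⟩
    · rintro ⟨i, hi, rfl⟩
      exact ⟨⟨i, hi⟩, (heckeDatum_T hq hi).symm⟩
  rw [← h1, adjoin_range_T]
  trivial

theorem wordPerm_eq (l : List (Fin (n - 1))) :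
    wordPerm n l = wp n (l.map fun j => j.val + 1) := by
  induction l with
  | nil => rfl
  | cons j l ih =>
    rw [wordPerm, List.map_cons, List.reverse_cons, List.prod_append, List.map_cons, wp, ← ih,
      List.prod_singleton]
    congr 1
    have := j.isLt
    rw [sw, dif_pos ⟨Nat.succ_pos _, by omega⟩]
    rfl

theorem IsReducedWord.isRed {l : List (Fin (n - 1))} {w : Equiv.Perm (Fin n)}
    (h : IsReducedWord l w) : IsRed (l.map fun j => j.val + 1) w := by
  obtain ⟨h1, h2⟩ := h
  have h3 : ∀ i ∈ l.map (fun j => j.val + 1), 0 < i ∧ i < n := by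
    intro i hi
    obtain ⟨j, -, rfl⟩ := List.mem_map.1 hi
    have := j.isLt
    exact ⟨Nat.succ_pos _, by omega⟩
  rw [wordPerm_eq] at h1
  refine ⟨h1, h3, le_antisymm ?_ ?_⟩
  · obtain ⟨l₀, hl₀⟩ := exists_isRed w
    obtain ⟨l', hl'⟩ : ∃ l' : List (Fin (n - 1)), l'.map (fun j => j.val + 1) = l₀ := by
      have h4 := hl₀.2.1
      clear hl₀
      induction l₀ with
      | nil => exact ⟨[], rfl⟩
      | cons i l₀ ih =>
        obtain ⟨l', hl'⟩ := ih fun j hj => h4 j (List.mem_cons_of_mem _ hj)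
        obtain ⟨h5, h6⟩ := h4 i List.mem_cons_self
        exact ⟨⟨i - 1, by omega⟩ :: l', by
          rw [List.map_cons, hl']
          congr 1
          exact Nat.sub_add_cancel h5⟩
    have h4 := h2 l' (by rw [wordPerm_eq, hl', hl₀.1])
    rw [List.length_map, ← hl₀.2.2, ← hl', List.length_map]
    exact h4
  · rw [← h1]
    exact inv_wp_le _ h3

/-- In `Tw` the first letter of a word is applied first, since permutations act from the right,
whereas `tw` follows the composition of maps. Hence the inverse. -/
theorem Tw_eq (w : Equiv.Perm (Fin n)) : Tw q Q w = (heckeDatum n Q hq).tw w⁻¹ := by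
  have h := (Classical.choose_spec (exists_reducedWord w)).isRed
  rw [Tw, FinHecke.tw_eq _ h.reverse]
  have key : ∀ l : List (Fin (n - 1)),
      (l.map fun j => T q Q (⟨j.val + 1, by omega⟩ : Fin n)).prod =
        (heckeDatum n Q hq).tp (l.map fun j => j.val + 1).reverse := by
    intro l
    induction l with
    | nil => rfl
    | cons j l ih =>
      have := j.isLt
      rw [List.map_cons, List.prod_cons, ih, List.map_cons, List.reverse_cons, FinHecke.tp_append]
      congr 1
      rw [FinHecke.tp, FinHecke.tp, one_mul, heckeDatum_T hq]
  exact key _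

theorem jm_eq {m : ℕ} (h : m < n) : jm q Q m h = (heckeDatum n Q hq).L m := by
  induction m with
  | zero => exact (heckeDatum_T hq h).symm
  | succ m ih =>
    rw [jm, ih, L, heckeDatum_T hq h]
    rfl

/-- The row stabilizer is closed under inversion, so the two conventions for `T_w` give the same
sum. Peeling off one row after another turns it into the product of the symmetrizers. -/
theorem xElt_eq (lam : Multipartition r n) :
    xElt q Q lam = (heckeDatum n Q hq).P lam.rows 0 (r * (n + 1)) := by
  set D := heckeDatum n Q hq
  set f := rowOf (r * (n + 1)) lam.rows with hf
  classical
  have h1 : xElt q Q lam = ∑ u ∈ labelStab n f 0, D.tw u := by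
    rw [xElt]
    refine Finset.sum_bij' (fun w _ => w⁻¹) (fun w _ => w⁻¹) ?_ ?_ ?_ ?_ ?_
    · intro w hw
      exact inv_mem_labelStab (mem_rowStabilizer_iff.1 (Finset.mem_filter.1 hw).2)
    · intro w hw
      exact Finset.mem_filter.2 ⟨Finset.mem_univ _, mem_rowStabilizer_iff.2 (inv_mem_labelStab hw)⟩
    · intro w _; exact inv_inv w
    · intro w _; exact inv_inv w
    · intro w _; exact Tw_eq hq w
  have h2 : ∀ t ≤ r * (n + 1), ∑ u ∈ labelStab n f 0, D.tw u =
      (∑ u ∈ labelStab n f (start lam.rows t), D.tw u) * D.P lam.rows 0 t := by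
    intro t
    induction t with
    | zero => intro _; rw [start_zero, FinHecke.P, mul_one]
    | succ t ih =>
      intro ht
      rw [ih (by omega), FinHecke.sum_labelStab_row D.toFinHecke (p := start lam.rows t)
        (l := lam.rows t) (lam.isRows.start_add_le ht) ?_, start_succ, FinHecke.P, zero_add,
        mul_assoc]
      intro y hy0 hy1 x hx hxn
      obtain ⟨c, rfl⟩ : ∃ c, y = start lam.rows t + c := ⟨y - start lam.rows t, by omega⟩
      obtain ⟨s, d, h3, h4, rfl⟩ := lam.isRows.exists_row hxn
      rw [hf, rowOf_start_add h3 h4, rowOf_start_add ht (by omega)]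
      constructor
      · rintro rfl; omega
      · intro h5
        by_contra h6
        rcases lt_or_gt_of_ne h6 with h7 | h7
        · have := start_mono lam.rows (show s + 1 ≤ t from h7)
          rw [start_succ] at this; omega
        · have := start_mono lam.rows (show t + 1 ≤ s from h7)
          rw [start_succ] at this; omega
  rw [h1, h2 _ le_rfl, lam.start_rows_total, labelStab_of_le le_rfl, Finset.sum_singleton,
    FinHecke.tw_one, one_mul]

theorem mElt_eq (lam : Multipartition r n) :
    mElt q Q lam = (heckeDatum n Q hq).m (n + 1) lam.rows := by
  rw [mElt, m, xElt_eq hq]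
  congr 1
  have h1 : ∀ (c : ℂ) (a : ℕ) (ha : a ≤ n), (List.ofFn fun m : Fin a =>
      jm q Q m.val (m.isLt.trans_le ha) - algebraMap ℂ _ c).prod = (heckeDatum n Q hq).v c a := by
    intro c a
    induction a with
    | zero => intro _; rfl
    | succ a ih =>
      intro ha
      rw [List.ofFn_succ', List.concat_eq_append, List.prod_append, List.prod_singleton, v,
        ← ih (by omega), ← jm_eq hq (show a < n from ha)]
      rfl
  have h2 : ∀ (K : ℕ) (hK : K ≤ r), (List.ofFn fun k : Fin K =>
      (heckeDatum n Q hq).v (Q (k.castLE hK)) (lam.before (k.castLE hK))).prod =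
        (heckeDatum n Q hq).uu (fun k => start lam.rows (k * (n + 1))) K := by
    intro K
    induction K with
    | zero => intro _; rfl
    | succ K ih =>
      intro hK
      have h3 := lam.start_rows_eq_before ⟨K, hK⟩
      change start lam.rows (K * (n + 1)) = _ at h3
      rw [List.ofFn_succ', List.concat_eq_append, List.prod_append, List.prod_singleton, uu,
        ← ih (by omega), h3, ← heckeDatum_Q (n := n) (Q := Q) hq]
      rfl
  refine Eq.trans (congrArg List.prod (congrArg List.ofFn (funext fun k => ?_))) (h2 r le_rfl)
  exact h1 (Q k) (lam.before k) (lam.before_le k)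

theorem Tw_one : Tw q Q (1 : Equiv.Perm (Fin n)) = 1 := by
  have h := (Classical.choose_spec (exists_reducedWord (1 : Equiv.Perm (Fin n)))).2 [] rfl
  rw [Tw, List.eq_nil_of_length_eq_zero (Nat.le_zero.1 h)]
  rfl

theorem anti_one : anti (1 : HeckeAlg n q Q) = 1 := by
  rw [anti, map_one]
  rfl

theorem mTab_initialTableau (mu : Multipartition r n) :
    mTab q Q mu.initialTableau mu.initialTableau = mElt q Q mu := by
  rw [mTab, dPerm_initialTableau, Tw_one, anti_one, one_mul, mul_one]

/-- `m_μ` is the generator for a pair of initial tableaux. As every `m_st` is a multiple of its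
`m_μ`, stability of the ideal can be tested on the `m_μ`. -/
theorem mElt_mem_Nbar {lam mu : Multipartition r n} (h : mu.Dominates lam) (h' : mu ≠ lam) :
    mElt q Q mu ∈ Nbar q Q lam :=
  TwoSidedIdeal.subset_span ⟨mu, h, h', _, _, mu.isStandard_initialTableau,
    mu.isStandard_initialTableau, (mTab_initialTableau mu).symm⟩

end Frozen

end ArikiKoike

namespace ArikiKoike

open HeckeDatum

/-! ### The anti-involution -/

section Anti

variable {R A : Type*} [CommRing R] [Ring A] [Algebra R A] {n r : ℕ} {D : HeckeDatum R A n r}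
  {N : ℕ} {ρ : ℕ → ℕ}

theorem HeckeDatum.commute_uu_P (hn : start ρ (r * N) ≤ n) {t : ℕ} (ht : t ≤ r * N) :
    Commute (D.uu (fun k => start ρ (k * N)) r) (D.P ρ 0 t) := by
  induction t with
  | zero => exact Commute.one_right _
  | succ t ih =>
    refine Commute.mul_right (FinHecke.commute_X fun i h0 h1 => ?_) (ih (by omega))
    rw [zero_add] at h0 h1
    have := start_mono ρ ht
    rw [start_succ] at this
    exact (D.commute_T_uu (by omega) (by omega) (before_le_of_start hn)
      fun j _ => start_ne_of_mem_row h0 h1 _).symm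

theorem FinHecke.commute_X_P {D : FinHecke R A n} {t : ℕ} (ht : start ρ (t + 1) ≤ n) :
    Commute (D.X (start ρ t) (ρ t)) (D.P ρ 0 t) := by
  rw [start_succ] at ht
  refine D.commute_P fun j h0 h1 => (FinHecke.commute_X fun i h2 h3 => ?_).symm
  rw [zero_add] at h1
  rw [start_zero] at h0
  exact D.comm _ _ h0 (by omega) (by omega)

variable {f : A →ₐ[R] Aᵐᵒᵖ}

/-- `m_ρ` is invariant under the anti-involution. -/
theorem HeckeDatum.map_op_m (hf : ∀ i, f (D.T i) = MulOpposite.op (D.T i))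
    (hn : start ρ (r * N) ≤ n) : f (D.m N ρ) = MulOpposite.op (D.m N ρ) := by
  have hX : ∀ p l, p + l ≤ n → f (D.X p l) = MulOpposite.op (D.X p l) := fun p l h => by
    rw [← D.op_X h]
    exact FinHecke.map_X (D := D.toFinHecke) (D' := D.op) (f := (f : A →+* Aᵐᵒᵖ)) hf p l
  have hP : ∀ t ≤ r * N, f (D.P ρ 0 t) = MulOpposite.op (D.P ρ 0 t) := by
    intro t
    induction t with
    | zero => intro _; exact map_one f
    | succ t ih =>
      intro ht
      have h1 := (start_mono ρ ht).trans hn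
      have h2 := FinHecke.commute_X_P (D := D.toFinHecke) h1
      rw [start_succ] at h1
      rw [FinHecke.P, zero_add, map_mul, ih (by omega), hX _ _ h1, ← MulOpposite.op_mul, h2.eq]
  have hL : ∀ m, f (D.L m) = MulOpposite.op (D.L m) := by
    intro m
    induction m with
    | zero => exact hf 0
    | succ m ih =>
      rw [L, map_smul, map_mul, map_mul, ih, hf, ← MulOpposite.op_mul, ← MulOpposite.op_mul,
        ← mul_assoc, MulOpposite.op_smul]
  have hv : ∀ c a, a ≤ n → f (D.v c a) = MulOpposite.op (D.v c a) := by
    intro c a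
    induction a with
    | zero => intro _; exact map_one f
    | succ a ih =>
      intro ha
      have hc : Commute (D.L a - algebraMap R A c) (D.v c a) :=
        (D.commute_v c fun m hm => D.commute_L_L ha (by omega)).sub_left (Algebra.commutes _ _)
      rw [v, map_mul, ih (by omega), map_sub, hL, AlgHom.commutes, MulOpposite.algebraMap_apply,
        ← MulOpposite.op_sub, ← MulOpposite.op_mul, hc.eq]
  have hu : ∀ k ≤ r, f (D.uu (fun k => start ρ (k * N)) k) =
      MulOpposite.op (D.uu (fun k => start ρ (k * N)) k) := by
    intro k
    induction k with
    | zero => intro _; exact map_one f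
    | succ k ih =>
      intro hk
      have ha := before_le_of_start hn k hk
      have hc : Commute (D.v (D.Q k) (start ρ (k * N))) (D.uu (fun k => start ρ (k * N)) k) :=
        (D.commute_v _ fun m hm => (D.commute_L_uu (by omega)
          fun j hj => before_le_of_start hn j (by omega)).symm).symm
      rw [uu, map_mul, ih (by omega), hv _ _ ha, ← MulOpposite.op_mul, hc.eq]
  rw [m, map_mul, hu r le_rfl, hP _ le_rfl, ← MulOpposite.op_mul, (commute_uu_P hn le_rfl).eq]

end Anti

/-! ### The semilinear involution -/

section Bar

variable {F A : Type*} [Field F] [Ring A] [Algebra F A] {n r : ℕ}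

theorem FinHecke.Dn_add {D : FinHecke F A n} (p a b : ℕ) :
    D.Dn p (a + b) = D.Dn (p + a) b * D.Dn p a :=
  congrArg MulOpposite.unop (D.op.U_add p a b)

theorem FinHecke.Shr_one {D : FinHecke F A n} (p l : ℕ) :
    D.Shr p l 1 = ∑ j ∈ Finset.range (l + 1), D.Dn (p + j) (l - j) := by
  induction l generalizing p with
  | zero => simp [Shr, Sh_zero_left]
  | succ l ih =>
    rw [Shr, Sh_succ_one, MulOpposite.unop_add, Finset.sum_range_succ']
    congr 1
    refine (ih (p + 1)).trans (Finset.sum_congr rfl fun j _ => ?_)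
    congr 1 <;> omega

theorem FinHecke.Dn_mul_X {D : FinHecke F A n} {p a l : ℕ} (h : p + l ≤ n) (ha : a < l) :
    D.Dn p a * D.X p l = D.q ^ a • D.X p l := by
  induction a with
  | zero => simp
  | succ a ih =>
    rw [Dn_succ, mul_assoc, ih (by omega), mul_smul_comm, D.T_mul_X h (by omega) (by omega),
      smul_smul, pow_succ]

theorem FinHecke.isUnit_Dn {D : HeckeDatum F A n r} {p a : ℕ} (h : p + a < n) :
    IsUnit (D.Dn p a) := by
  induction a with
  | zero => exact isUnit_one
  | succ a ih =>
    rw [Dn_succ]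
    exact (D.isUnit_T (by omega) (by omega)).mul (ih (by omega))

variable {D : HeckeDatum F A n r} {f : A →+* A} {τ : F →+* F}

/-- A semilinear ring endomorphism that inverts the generators and the parameters. -/
structure IsBar (D : HeckeDatum F A n r) (f : A →+* A) (τ : F →+* F) : Prop where
  smul : ∀ c x, f (c • x) = τ c • f x
  q : τ D.q = D.qi
  Q : ∀ k < r, D.Q k * τ (D.Q k) = 1
  mul_T : ∀ i < n, f (D.T i) * D.T i = 1
  T_mul : ∀ i < n, D.T i * f (D.T i) = 1

namespace IsBar

variable (hf : IsBar D f τ)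
include hf

theorem qi : τ D.qi = D.q := by
  have h := congrArg τ D.q_mul_qi
  rw [map_mul, map_one, hf.q] at h
  calc τ D.qi = (D.q * D.qi) * τ D.qi := by rw [D.q_mul_qi, one_mul]
    _ = D.q := by rw [mul_assoc, h, mul_one]

theorem map_U_mul_Dn {p a : ℕ} (h : p + a < n) : D.Dn p a * f (D.U p a) = 1 := by
  induction a with
  | zero => simp [FinHecke.U]
  | succ a ih =>
    have h1 : D.Dn p a * f (D.U p a) = 1 := ih (by omega)
    rw [FinHecke.Dn_succ, FinHecke.U, map_mul, mul_assoc, ← mul_assoc (D.Dn p a), h1, one_mul,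
      hf.T_mul _ (by omega)]

/-- Since `f (U p j)` is inverse to `Dn p j`, multiplication by the full descending run turns `f (Y
p l)` into the reflected shuffle sum, and the run moves `X (p + 1) l` to `X p l`. By `X_add'` the
product is the symmetrizer of length `l + 1`. The run acts on that symmetrizer by `q ^ l`, so
cancelling it gives the scalar. -/
theorem map_X {p l : ℕ} (h : p + l ≤ n) : ∃ c : F, c ≠ 0 ∧ f (D.X p l) = c • D.X p l := by
  induction l generalizing p with
  | zero => exact ⟨1, one_ne_zero, by simp [FinHecke.X]⟩
  | succ l ih =>
    obtain ⟨c, hc, hX⟩ := ih (p := p + 1) (by omega)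
    have hqi : D.qi ≠ 0 := right_ne_zero_of_mul_eq_one D.q_mul_qi
    refine ⟨c * D.qi ^ l, mul_ne_zero hc (pow_ne_zero _ hqi), ?_⟩
    have hD : D.Dn p l * f (D.Y p l) = D.Shr p l 1 := by
      rw [FinHecke.Y, map_sum, Finset.mul_sum, FinHecke.Shr_one]
      refine Finset.sum_congr rfl fun j hj => ?_
      have hj' := Finset.mem_range.1 hj
      have h1 := FinHecke.Dn_add (D := D.toFinHecke) p j (l - j)
      rw [show j + (l - j) = l by omega] at h1
      rw [h1, mul_assoc, hf.map_U_mul_Dn (by omega), mul_one]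
    have hs : SemiconjBy (D.Dn p l) (D.X (p + 1) l) (D.X p l) :=
      FinHecke.semiconj_X fun j h0 h1 => by
        have := D.semiconj_Dn_T (p := p) (a := l) (i := p + j) (by omega) (by omega) (by omega)
        rwa [show p + j + 1 = p + 1 + j by omega] at this
    have hX1 : D.X (p + l) 1 = 1 := by simp [FinHecke.X, FinHecke.Y, FinHecke.U]
    have hadd := D.X_add' p l 1 h
    rw [hX1, one_mul] at hadd
    refine (FinHecke.isUnit_Dn (D := D) (p := p) (a := l) (by omega)).mul_left_cancel ?_
    rw [mul_smul_comm, FinHecke.Dn_mul_X h (Nat.lt_succ_self l), smul_smul, mul_assoc, ← mul_pow,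
      mul_comm D.qi, D.q_mul_qi, one_pow, mul_one, FinHecke.X_succ, map_mul, hX, smul_mul_assoc,
      mul_smul_comm, ← mul_assoc, hs.eq, mul_assoc, hD, ← hadd, FinHecke.X_succ]

theorem map_P {ρ : ℕ → ℕ} {t : ℕ} (h : start ρ t ≤ n) :
    ∃ c : F, c ≠ 0 ∧ f (D.P ρ 0 t) = c • D.P ρ 0 t := by
  induction t with
  | zero => exact ⟨1, one_ne_zero, by simp [FinHecke.P]⟩
  | succ t ih =>
    rw [start_succ] at h
    obtain ⟨c, hc, hP⟩ := ih (by omega)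
    obtain ⟨d, hd, hX⟩ := hf.map_X h
    refine ⟨d * c, mul_ne_zero hd hc, ?_⟩
    rw [FinHecke.P, map_mul, zero_add, hX, hP, smul_mul_assoc, mul_smul_comm, smul_smul]

theorem map_L {m : ℕ} (h : m < n) : f (D.L m) * D.L m = 1 ∧ D.L m * f (D.L m) = 1 := by
  induction m with
  | zero => exact ⟨hf.mul_T 0 h, hf.T_mul 0 h⟩
  | succ m ih =>
    obtain ⟨h1, h2⟩ := ih (by omega)
    have h3 := hf.mul_T _ h
    have h4 := hf.T_mul _ h
    rw [L, hf.smul, hf.qi, map_mul, map_mul]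
    constructor
    · rw [smul_mul_smul_comm, D.q_mul_qi, one_smul]
      calc _ = f (D.T (m + 1)) * (f (D.L m) * ((f (D.T (m + 1)) * D.T (m + 1)) * D.L m)) *
            D.T (m + 1) := by simp only [mul_assoc]
        _ = 1 := by rw [h3, one_mul, h1, mul_one, h3]
    · rw [smul_mul_smul_comm, mul_comm D.qi, D.q_mul_qi, one_smul]
      calc _ = D.T (m + 1) * (D.L m * ((D.T (m + 1) * f (D.T (m + 1))) * f (D.L m))) *
            f (D.T (m + 1)) := by simp only [mul_assoc]
        _ = 1 := by rw [h4, one_mul, h2, mul_one, h4]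

theorem commute_map_L {C : A} {m : ℕ} (h : m < n) (hC : Commute C (D.L m)) :
    Commute C (f (D.L m)) := by
  obtain ⟨h1, h2⟩ := hf.map_L h
  exact (show Commute C (↑(⟨D.L m, f (D.L m), h2, h1⟩ : Aˣ)) from hC).units_inv_right

/-- Inverting both `L` and the parameter `c` turns `L - c` into a scalar multiple of `L⁻¹ * (L -
c)`. The commutation clause allows the units from several factors to be collected in front. -/
theorem map_v {k a : ℕ} (hk : k < r) (ha : a ≤ n) :
    ∃ g : A, IsUnit g ∧ (∀ C, (∀ m < n, Commute C (D.L m)) → Commute C g) ∧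
      f (D.v (D.Q k) a) = g * D.v (D.Q k) a := by
  induction a with
  | zero => exact ⟨1, isUnit_one, fun C _ => Commute.one_right C, by rw [v, map_one, mul_one]⟩
  | succ a ih =>
    obtain ⟨g, h1, h2, h3⟩ := ih (by omega)
    have hQ := hf.Q k hk
    obtain ⟨h4, h5⟩ := hf.map_L (m := a) ha
    have hL : f (D.L a - algebraMap F A (D.Q k)) =
        (-τ (D.Q k)) • f (D.L a) * (D.L a - algebraMap F A (D.Q k)) := by
      rw [map_sub, Algebra.algebraMap_eq_smul_one, hf.smul, map_one, smul_mul_assoc, mul_sub, h4,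
        mul_smul_comm, mul_one, smul_sub, smul_smul, neg_mul, mul_comm, hQ]
      simp only [neg_smul, one_smul]
      abel
    have hc : Commute (f (D.L a)) (D.v (D.Q k) a) :=
      (hf.commute_map_L ha (D.commute_v _ fun m hm => D.commute_L_L ha (by omega)).symm).symm
    refine ⟨g * ((-τ (D.Q k)) • f (D.L a)), h1.mul ?_, fun C hC => (h2 C hC).mul_right
      ((hf.commute_map_L ha (hC a ha)).smul_right _), ?_⟩
    · have h6 : -τ (D.Q k) ≠ 0 := neg_ne_zero.2 (right_ne_zero_of_mul_eq_one hQ)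
      exact (show IsUnit (f (D.L a)) from ⟨⟨_, _, h4, h5⟩, rfl⟩).smul (Units.mk0 _ h6)
    · rw [v, map_mul, h3, hL]
      have hc' : Commute ((-τ (D.Q k)) • f (D.L a)) (D.v (D.Q k) a) := hc.smul_left _
      rw [mul_assoc g, ← mul_assoc (D.v _ _), ← hc'.eq]
      simp only [mul_assoc]

theorem map_uu {a : ℕ → ℕ} {k : ℕ} (hk : k ≤ r) (ha : ∀ j < k, a j ≤ n) :
    ∃ g : A, IsUnit g ∧ (∀ C, (∀ m < n, Commute C (D.L m)) → Commute C g) ∧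
      f (D.uu a k) = g * D.uu a k := by
  induction k with
  | zero => exact ⟨1, isUnit_one, fun C _ => Commute.one_right C, by rw [uu, map_one, mul_one]⟩
  | succ k ih =>
    obtain ⟨g, h1, h2, h3⟩ := ih (by omega) fun j hj => ha j (by omega)
    obtain ⟨g', h1', h2', h3'⟩ := hf.map_v hk (ha k (by omega))
    have hc : Commute (D.uu a k) g' := h2' _ fun m hm =>
      (D.commute_L_uu hm fun j hj => ha j (by omega)).symm
    refine ⟨g * g', h1.mul h1', fun C hC => (h2 C hC).mul_right (h2' C hC), ?_⟩
    rw [uu, map_mul, h3, h3', mul_assoc g, ← mul_assoc (D.uu a k), hc.eq]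
    simp only [mul_assoc]

theorem map_m {N : ℕ} {ρ : ℕ → ℕ} (hn : start ρ (r * N) ≤ n) :
    ∃ g : A, IsUnit g ∧ f (D.m N ρ) = g * D.m N ρ := by
  obtain ⟨g, h1, -, h2⟩ := hf.map_uu (a := fun k => start ρ (k * N)) le_rfl
    (before_le_of_start hn)
  obtain ⟨c, hc, h3⟩ := hf.map_P hn
  refine ⟨c • g, h1.smul (Units.mk0 c hc), ?_⟩
  rw [m, map_mul, h2, h3, mul_smul_comm, smul_mul_assoc, mul_assoc]

end IsBar

end Bar

end ArikiKoike

namespace ArikiKoike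

open HeckeDatum Multipartition

/-! ### The ideal `N̄^λ` and the involutions -/

section Map

variable {R A A' : Type*} [CommRing R] [Ring A] [Algebra R A] [Ring A'] [Algebra R A'] {n r : ℕ}

/-- The images of the generators under an algebra homomorphism. -/
def HeckeDatum.map (D : HeckeDatum R A n r) (f : A →ₐ[R] A') : HeckeDatum R A' n r where
  q := D.q
  qi := D.qi
  Q := D.Q
  q_mul_qi := D.q_mul_qi
  T i := f (D.T i)
  quad i h0 h1 := by
    rw [← map_mul, D.quad i h0 h1, map_add, map_smul, map_smul, map_one]
  braid i h0 h1 := by simp only [← map_mul, D.braid i h0 h1]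
  comm i j h0 h1 h2 := (D.comm i j h0 h1 h2).map f
  cyclo h0 := by
    have h := congrArg f (D.cyclo h0)
    rw [map_zero, map_list_prod, List.map_map] at h
    rw [← h]
    congr 2
    funext k
    simp
  braidFour h1 := by simp only [← map_mul, D.braidFour h1]
  comm_zero j h0 h1 := (D.comm_zero j h0 h1).map f

theorem HeckeDatum.m_map (D : HeckeDatum R A n r) (f : A →ₐ[R] A') (N : ℕ) (ρ : ℕ → ℕ) :
    (D.map f).m N ρ = f (D.m N ρ) :=
  (map_m (D := D) (D' := D.map f) (f := (f : A →+* A')) (fun _ => rfl) (f.commutes _)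
    (fun _ _ => f.commutes _) N ρ).symm

theorem HeckeDatum.m_congr (D : HeckeDatum R A n r) {N : ℕ} {ρ ρ' : ℕ → ℕ}
    (h : ∀ s < r * N, ρ s = ρ' s) : D.m N ρ = D.m N ρ' := by
  rw [m, m, D.uu_congr fun _ hk => start_congr fun s hs =>
    h s (hs.trans_le (Nat.mul_le_mul_right N hk.le)),
    D.P_congr (start_zero ρ |>.trans (start_zero ρ').symm) fun s _ hs => h s (by omega)]

end Map

variable {n r : ℕ} {q : ℂ} {Q : Fin r → ℂ}

/-- `m_λ H m_λ` is spanned by `m_λ` modulo `N̄^λ`. -/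
theorem exists_mElt_mul_mElt (hr : 0 < r) (hq : q ≠ 0) (hQ : ∀ k, Q k ≠ 0)
    (lam : Multipartition r n) (h : HeckeAlg n q Q) :
    ∃ c : ℂ, mElt q Q lam * h * mElt q Q lam - c • mElt q Q lam ∈ Nbar q Q lam := by
  set f := (Nbar q Q lam).ringCon.mkₐ ℂ with hf
  set D := (heckeDatum n Q hq).map f with hD
  have hm : ∀ mu : Multipartition r n, D.m (n + 1) mu.rows = f (mElt q Q mu) := fun mu => by
    rw [m_map, mElt_eq hq]
  have hker : ∀ x y, f x = f y ↔ x - y ∈ Nbar q Q lam := fun x y =>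
    (RingCon.eq _).trans (TwoSidedIdeal.rel_iff _ x y)
  -- Only multipartitions have to be checked, and for those above `λ` the element `m_μ` lies in
  -- `N̄^λ`.
  have hv : D.Vanishes (n + 1) lam.rows := by
    refine D.m_eq_zero_of_forall fun ρ h1 h2 h3 ⟨t, ht, ht'⟩ => ?_
    obtain ⟨mu, hmu⟩ := exists_rows_eq h1 h2
    have hst : ∀ s ≤ r * (n + 1), start mu.rows s = start ρ s := fun s hs =>
      start_congr fun i hi => hmu i (hi.trans_le hs)
    rw [← D.m_congr hmu, hm, ← map_zero f, hker, sub_zero]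
    refine mElt_mem_Nbar (dominates_of_start_le fun s hs => ?_) ?_
    · rw [hst s hs]
      exact h3 s hs
    · rintro rfl
      rw [hst t ht] at ht'
      exact lt_irrefl _ ht'
  have hadj : f h ∈ Algebra.adjoin ℂ (D.T '' Set.Iio n) := by
    have h1 : D.T '' Set.Iio n = f '' ((heckeDatum n Q hq).T '' Set.Iio n) := by
      rw [Set.image_image]
      rfl
    rw [h1, ← AlgHom.map_adjoin]
    exact ⟨h, heckeDatum_adjoin hq h, rfl⟩
  obtain ⟨c, hc⟩ := D.exists_m_mul_m (heckeDatum_Q_ne_zero (n := n) hq hQ) lam.isRows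
    (Nat.lt_succ_self n) hr hv hadj
  refine ⟨c, (hker _ _).1 ?_⟩
  rw [map_mul, map_mul, map_smul, ← hm, hc]

theorem anti_add (x y : HeckeAlg n q Q) : anti (x + y) = anti x + anti y := by
  rw [anti, map_add]
  rfl

theorem antiHom_T (i : Fin n) : antiHom n q Q (T q Q i) = MulOpposite.op (T q Q i) := by
  conv_rhs => rw [← anti_T i]
  rfl

theorem anti_algebraMap (c : ℂ) :
    anti (algebraMap ℂ (HeckeAlg n q Q) c) = algebraMap ℂ _ c := by
  rw [Algebra.algebraMap_eq_smul_one, anti_smul, anti_one]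

theorem hecke_induction {p : HeckeAlg n q Q → Prop} (hT : ∀ i, p (T q Q i))
    (hC : ∀ c, p (algebraMap ℂ _ c)) (hadd : ∀ x y, p x → p y → p (x + y))
    (hmul : ∀ x y, p x → p y → p (x * y)) (h : HeckeAlg n q Q) : p h := by
  have hh : h ∈ Algebra.adjoin ℂ (Set.range (T (n := n) q Q)) := by
    rw [adjoin_range_T]
    trivial
  induction hh using Algebra.adjoin_induction with
  | mem x hx =>
    obtain ⟨i, rfl⟩ := hx
    exact hT i
  | algebraMap c => exact hC c
  | add x y _ _ hx hy => exact hadd x y hx hy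
  | mul x y _ _ hx hy => exact hmul x y hx hy

theorem anti_anti (x : HeckeAlg n q Q) : anti (anti x) = x := by
  induction x using hecke_induction with
  | hT i => rw [anti_T, anti_T]
  | hC c => rw [anti_algebraMap, anti_algebraMap]
  | hadd x y hx hy => rw [anti_add, anti_add, hx, hy]
  | hmul x y hx hy => rw [anti_mul, anti_mul, hx, hy]

theorem anti_mElt (hq : q ≠ 0) (mu : Multipartition r n) : anti (mElt q Q mu) = mElt q Q mu := by
  have h : antiHom n q Q ((heckeDatum n Q hq).m (n + 1) mu.rows) =
      MulOpposite.op ((heckeDatum n Q hq).m (n + 1) mu.rows) := by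
    refine map_op_m (fun i => ?_) mu.start_rows_total.le
    change antiHom n q Q (if h : i < n then T q Q ⟨i, h⟩ else 1) = _
    by_cases hi : i < n
    · rw [heckeDatum_T hq hi, dif_pos hi, antiHom_T]
    · rw [dif_neg hi, map_one, ← MulOpposite.op_one, show (heckeDatum n Q hq).T i = 1 from
        dif_neg hi]
  rw [mElt_eq hq, anti, h, MulOpposite.unop_op]

/-- `*` sends `m_st` to a two-sided multiple of `m_μ`, because it fixes `m_μ`. -/
theorem anti_mem_Nbar (hq : q ≠ 0) {lam : Multipartition r n} {x : HeckeAlg n q Q}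
    (hx : x ∈ Nbar q Q lam) : anti x ∈ Nbar q Q lam := by
  have h : Nbar q Q lam ≤ (Nbar q Q lam).op.comap (antiHom n q Q) := by
    refine TwoSidedIdeal.span_le.2 ?_
    rintro _ ⟨mu, h1, h2, s, t, -, -, rfl⟩
    refine (TwoSidedIdeal.mem_comap _).2 (TwoSidedIdeal.mem_op_iff.2 ?_)
    change anti (mTab q Q s t) ∈ _
    rw [mTab, anti_mul, anti_mul, anti_mElt hq]
    exact TwoSidedIdeal.mul_mem_left _ _ _
      (TwoSidedIdeal.mul_mem_right _ _ _ (mElt_mem_Nbar h1 h2))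
  exact TwoSidedIdeal.mem_op_iff.1 ((TwoSidedIdeal.mem_comap _).1 (h hx))

section Sigma

variable (hq : ‖q‖ = 1) (hQ : ∀ k, ‖Q k‖ = 1)
include hq hQ

theorem sigma_algebraMap (c : ℂ) :
    sigma hq hQ (algebraMap ℂ (HeckeAlg n q Q) c) = algebraMap ℂ _ (starRingEnd ℂ c) := by
  rw [Algebra.algebraMap_eq_smul_one, sigma_smul, map_one, Algebra.algebraMap_eq_smul_one]

theorem sigma_sigma (x : HeckeAlg n q Q) : sigma hq hQ (sigma hq hQ x) = x := by
  induction x using hecke_induction with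
  | hT i =>
    have h1 : sigma hq hQ (sigma hq hQ (T q Q i)) * sigma hq hQ (T q Q i) = 1 := by
      rw [← map_mul, sigma_T, ← val_Tunit hq hQ, Units.inv_mul, map_one]
    rw [sigma_T hq hQ i] at h1 ⊢
    exact Units.mul_inv_eq_one.1 h1
  | hC c => rw [sigma_algebraMap, sigma_algebraMap, Complex.conj_conj]
  | hadd x y hx hy => rw [map_add, map_add, hx, hy]
  | hmul x y hx hy => rw [map_mul, map_mul, hx, hy]

theorem anti_inv_Tunit (i : Fin n) :
    anti (↑(Tunit hq hQ i)⁻¹ : HeckeAlg n q Q) = ↑(Tunit hq hQ i)⁻¹ := by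
  have h := congrArg anti (Units.inv_mul (Tunit hq hQ i))
  rw [anti_mul, val_Tunit, anti_T, anti_one, ← val_Tunit hq hQ] at h
  exact (Units.mul_eq_one_iff_inv_eq.1 h).symm

theorem sigma_anti (x : HeckeAlg n q Q) : sigma hq hQ (anti x) = anti (sigma hq hQ x) := by
  induction x using hecke_induction with
  | hT i => rw [anti_T, sigma_T, anti_inv_Tunit]
  | hC c => rw [anti_algebraMap, sigma_algebraMap, anti_algebraMap]
  | hadd x y hx hy => rw [anti_add, map_add, map_add, anti_add, hx, hy]
  | hmul x y hx hy => rw [anti_mul, map_mul, map_mul, anti_mul, hx, hy]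

theorem sigma_mElt (mu : Multipartition r n) :
    ∃ g, IsUnit g ∧ sigma hq hQ (mElt q Q mu) = g * mElt q Q mu := by
  have hq0 : q ≠ 0 := fun h => by simp [h] at hq
  have hf : IsBar (heckeDatum n Q hq0) (sigma hq hQ) (starRingEnd ℂ) :=
    { smul := sigma_smul hq hQ
      q := (Complex.inv_eq_conj hq).symm
      Q := fun k hk => by
        rw [show (heckeDatum n Q hq0).Q k = Q ⟨k, hk⟩ from dif_pos hk,
          ← Complex.inv_eq_conj (hQ _), mul_inv_cancel₀]
        exact fun h => by simpa [h] using hQ ⟨k, hk⟩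
      mul_T := fun i hi => by
        rw [heckeDatum_T hq0 hi, sigma_T, ← val_Tunit hq hQ, Units.inv_mul]
      T_mul := fun i hi => by
        rw [heckeDatum_T hq0 hi, sigma_T, ← val_Tunit hq hQ, Units.mul_inv] }
  rw [mElt_eq hq0]
  exact hf.map_m mu.start_rows_total.le

/-- `σ` sends `m_st` to a two-sided multiple of `m_μ`, because `σ(m_μ)` is a left multiple of `m_μ`.
-/
theorem sigma_mem_Nbar {lam : Multipartition r n} {x : HeckeAlg n q Q}
    (hx : x ∈ Nbar q Q lam) : sigma hq hQ x ∈ Nbar q Q lam := by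
  have h : Nbar q Q lam ≤ (Nbar q Q lam).comap (sigma hq hQ) := by
    refine TwoSidedIdeal.span_le.2 ?_
    rintro _ ⟨mu, h1, h2, s, t, -, -, rfl⟩
    refine (TwoSidedIdeal.mem_comap _).2 ?_
    obtain ⟨g, -, hg⟩ := sigma_mElt hq hQ mu
    rw [mTab, map_mul, map_mul, hg]
    exact TwoSidedIdeal.mul_mem_right _ _ _ (TwoSidedIdeal.mul_mem_left _ _ _
      (TwoSidedIdeal.mul_mem_left _ _ _ (mElt_mem_Nbar h1 h2)))
  exact (TwoSidedIdeal.mem_comap _).1 (h hx)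

/-- On the image of the braid group, `σ ∘ *` is the inversion. -/
theorem sigma_anti_of_mem_braidImage {u : (HeckeAlg n q Q)ˣ} (hu : u ∈ braidImage n q Q) :
    sigma hq hQ (anti (u : HeckeAlg n q Q)) = ↑u⁻¹ := by
  have hinv : ∀ u : (HeckeAlg n q Q)ˣ, sigma hq hQ (anti (u : HeckeAlg n q Q)) = ↑u⁻¹ →
      sigma hq hQ (anti (↑u⁻¹ : HeckeAlg n q Q)) = ↑u := by
    intro u h
    rw [← h, ← sigma_anti hq hQ, anti_anti, sigma_sigma]
  induction hu using Subgroup.closure_induction with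
  | mem u hu =>
    obtain ⟨i, hi⟩ := hu
    rw [hi, anti_T, sigma_T]
    congr 2
    exact Units.ext (by rw [hi, val_Tunit])
  | one => rw [Units.val_one, anti_one, map_one, _root_.inv_one, Units.val_one]
  | mul u v _ _ hu hv => rw [Units.val_mul, anti_mul, map_mul, hu, hv, mul_inv_rev, Units.val_mul]
  | inv u _ hu => rw [inv_inv, hinv u hu]

end Sigma

end ArikiKoike

namespace ArikiKoike

/-! ### The forms on the Specht modules -/

section Forms

variable {n r : ℕ} {q : ℂ} {Q : Fin r → ℂ} {lam : Multipartition r n}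

theorem toModNbar_eq_zero_iff {x : HeckeAlg n q Q} :
    toModNbar q Q lam x = 0 ↔ x ∈ Nbar q Q lam :=
  (Submodule.Quotient.mk_eq_zero _).trans TwoSidedIdeal.mem_asIdeal

theorem coe_smul_zElt (h : HeckeAlg n q Q) :
    ((h • zElt q Q lam : specht q Q lam) : ModNbar q Q lam) =
      toModNbar q Q lam (h * mElt q Q lam) := rfl

theorem smul_zElt_eq_zero_iff {h : HeckeAlg n q Q} :
    h • zElt q Q lam = 0 ↔ h * mElt q Q lam ∈ Nbar q Q lam := by
  rw [← toModNbar_eq_zero_iff, ← coe_smul_zElt, ZeroMemClass.coe_eq_zero]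

theorem smul_zElt_eq_smul_iff {h : HeckeAlg n q Q} {c : ℂ} :
    h • zElt q Q lam = c • zElt q Q lam ↔
      h * mElt q Q lam - c • mElt q Q lam ∈ Nbar q Q lam := by
  rw [Subtype.ext_iff, coe_smul_zElt, ← TwoSidedIdeal.mem_asIdeal]
  exact Submodule.Quotient.eq _

theorem exists_smul_zElt_eq (v : specht q Q lam) : ∃ h : HeckeAlg n q Q, h • zElt q Q lam = v := by
  obtain ⟨h, hh⟩ := Submodule.mem_span_singleton.1 v.2
  exact ⟨h, Subtype.ext hh⟩

theorem zElt_ne_zero (hD : Nontrivial (dModule q Q lam)) : zElt q Q lam ≠ 0 := by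
  intro hz
  refine not_subsingleton (dModule q Q lam) ⟨fun x y => ?_⟩
  have h0 : ∀ x : dModule q Q lam, x = 0 := by
    intro x
    obtain ⟨v, rfl⟩ := Submodule.Quotient.mk_surjective _ x
    obtain ⟨h, rfl⟩ := exists_smul_zElt_eq v
    rw [hz, smul_zero, Submodule.Quotient.mk_zero]
  rw [h0 x, h0 y]

/-- If `h m_λ` lies in `N̄^λ`, so does `m_λ h^*`. Hence the form does not depend on the choice of
`h` for the vector `h z_λ`. -/
theorem mElt_mul_smul_eq_zero (hq : q ≠ 0) {h : HeckeAlg n q Q} (hh : h • zElt q Q lam = 0)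
    (a : HeckeAlg n q Q) : (mElt q Q lam * anti h * a) • zElt q Q lam = 0 := by
  have h1 := anti_mem_Nbar hq (smul_zElt_eq_zero_iff.1 hh)
  rw [anti_mul, anti_mElt hq] at h1
  exact smul_zElt_eq_zero_iff.2
    (TwoSidedIdeal.mul_mem_right _ _ _ (TwoSidedIdeal.mul_mem_right _ _ _ h1))

/-- Both `m_λ` and the ideal are stable under `*`, which can be applied to the congruence. This is
the source of the symmetry of the form. -/
theorem mElt_mul_anti_smul (hq : q ≠ 0) {a : HeckeAlg n q Q} {c : ℂ}
    (h : (mElt q Q lam * a) • zElt q Q lam = c • zElt q Q lam) :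
    (mElt q Q lam * anti a) • zElt q Q lam = c • zElt q Q lam := by
  have h1 := anti_mem_Nbar hq (smul_zElt_eq_smul_iff.1 h)
  rw [sub_eq_add_neg, anti_add, ← neg_smul, anti_smul, anti_mul, anti_mul, anti_mElt hq,
    ← mul_assoc, neg_smul, ← sub_eq_add_neg] at h1
  exact smul_zElt_eq_smul_iff.2 h1

/-- The bilinear form on the Specht module exists. -/
theorem exists_isDJMForm (hr : 0 < r) (hq : q ≠ 0) (hQ : ∀ k, Q k ≠ 0)
    (hz : zElt q Q lam ≠ 0) :
    ∃ B : LinearMap.BilinForm ℂ (specht q Q lam), IsDJMForm q Q lam B := by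
  have key : ∀ v w : specht q Q lam, ∃ c : ℂ, ∀ h h' : HeckeAlg n q Q,
      h • zElt q Q lam = v → h' • zElt q Q lam = w →
        (mElt q Q lam * anti h * h') • zElt q Q lam = c • zElt q Q lam := by
    intro v w
    obtain ⟨h₀, rfl⟩ := exists_smul_zElt_eq v
    obtain ⟨h₁, rfl⟩ := exists_smul_zElt_eq w
    obtain ⟨c, hc⟩ := exists_mElt_mul_mElt hr hq hQ lam (anti h₀ * h₁)
    rw [← mul_assoc, ← smul_zElt_eq_smul_iff] at hc
    refine ⟨c, fun h h' hh hh' => ?_⟩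
    have h1 : (h + (-1 : ℂ) • h₀) • zElt q Q lam = 0 := by
      rw [add_smul, hh, neg_one_smul, neg_smul, add_neg_cancel]
    have h2 := mElt_mul_smul_eq_zero hq h1 h'
    rw [anti_add, anti_smul, neg_one_smul, mul_add, mul_neg, add_mul, neg_mul, add_smul, neg_smul,
      add_neg_eq_zero] at h2
    rw [h2, ← hc, mul_smul, hh', ← mul_smul]
  choose b hb using key
  have hb' : ∀ h h' : HeckeAlg n q Q, (mElt q Q lam * anti h * h') • zElt q Q lam =
      b (h • zElt q Q lam) (h' • zElt q Q lam) • zElt q Q lam :=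
    fun h h' => hb _ _ h h' rfl rfl
  have hinj := smul_left_injective ℂ hz
  have hsmul : ∀ (c : ℂ) (h : HeckeAlg n q Q), c • h • zElt q Q lam = (c • h) • zElt q Q lam :=
    fun c h => (smul_assoc c h _).symm
  refine ⟨LinearMap.mk₂ ℂ b ?_ ?_ ?_ ?_, fun h h' => hb' h h'⟩
  · intro v v' w
    obtain ⟨h, rfl⟩ := exists_smul_zElt_eq v
    obtain ⟨h', rfl⟩ := exists_smul_zElt_eq v'
    obtain ⟨k, rfl⟩ := exists_smul_zElt_eq w
    refine hinj ?_
    simp only [add_smul]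
    rw [← add_smul, ← hb', ← hb', ← hb', anti_add, mul_add, add_mul, add_smul]
  · intro c v w
    obtain ⟨h, rfl⟩ := exists_smul_zElt_eq v
    obtain ⟨k, rfl⟩ := exists_smul_zElt_eq w
    refine hinj ?_
    simp only [smul_eq_mul]
    rw [mul_smul, hsmul, ← hb', ← hb', anti_smul, mul_smul_comm, smul_mul_assoc, smul_assoc]
  · intro v w w'
    obtain ⟨h, rfl⟩ := exists_smul_zElt_eq v
    obtain ⟨k, rfl⟩ := exists_smul_zElt_eq w
    obtain ⟨k', rfl⟩ := exists_smul_zElt_eq w'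
    refine hinj ?_
    simp only [add_smul]
    rw [← add_smul, ← hb', ← hb', ← hb', mul_add, add_smul]
  · intro c v w
    obtain ⟨h, rfl⟩ := exists_smul_zElt_eq v
    obtain ⟨k, rfl⟩ := exists_smul_zElt_eq w
    refine hinj ?_
    simp only [smul_eq_mul]
    rw [mul_smul, hsmul, ← hb', ← hb', mul_smul_comm, smul_assoc]

namespace IsDJMForm

variable {B : LinearMap.BilinForm ℂ (specht q Q lam)} (hB : IsDJMForm q Q lam B)
include hB

theorem symm (hq : q ≠ 0) (hz : zElt q Q lam ≠ 0) (v w : specht q Q lam) : B v w = B w v := by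
  obtain ⟨h, rfl⟩ := exists_smul_zElt_eq v
  obtain ⟨k, rfl⟩ := exists_smul_zElt_eq w
  have h1 := hB h k
  rw [mul_assoc] at h1
  have h2 := mElt_mul_anti_smul hq h1
  rw [anti_mul, anti_anti, ← mul_assoc, hB] at h2
  exact (smul_left_injective ℂ hz h2).symm

theorem smul_left (hz : zElt q Q lam ≠ 0) (h : HeckeAlg n q Q) (v w : specht q Q lam) :
    B (h • v) w = B v (anti h • w) := by
  obtain ⟨k, rfl⟩ := exists_smul_zElt_eq v
  obtain ⟨l, rfl⟩ := exists_smul_zElt_eq w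
  refine smul_left_injective ℂ hz ?_
  simp only [smul_smul]
  rw [← hB, ← hB, anti_mul]
  simp only [mul_assoc]

theorem mElt_mul_smul (h : HeckeAlg n q Q) (v : specht q Q lam) :
    (mElt q Q lam * h) • v = B (anti h • zElt q Q lam) v • zElt q Q lam := by
  obtain ⟨k, rfl⟩ := exists_smul_zElt_eq v
  rw [← hB, anti_anti, mul_smul _ k]

theorem mem_djmRad_iff (hq : q ≠ 0) (hz : zElt q Q lam ≠ 0) {v : specht q Q lam} :
    v ∈ djmRad q Q lam ↔ ∀ w, B v w = 0 := by
  change (∀ h, (mElt q Q lam * h) • v = 0) ↔ _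
  constructor
  · intro h w
    obtain ⟨k, rfl⟩ := exists_smul_zElt_eq w
    have h1 := h (anti k)
    rw [hB.mElt_mul_smul, anti_anti, smul_eq_zero_iff_left hz] at h1
    rw [hB.symm hq hz, h1]
  · intro h k
    rw [hB.mElt_mul_smul, hB.symm hq hz, h, zero_smul]

/-- For `v` outside the radical some `m_λ h v` is a non-zero multiple of `z_λ`, and `z_λ` generates
the module. -/
theorem isSimpleModule (hD : Nontrivial (dModule q Q lam)) :
    IsSimpleModule (HeckeAlg n q Q) (dModule q Q lam) := by
  rw [isSimpleModule_iff_toSpanSingleton_surjective]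
  refine ⟨hD, fun x hx y => ?_⟩
  obtain ⟨v, rfl⟩ := Submodule.Quotient.mk_surjective _ x
  obtain ⟨w, rfl⟩ := Submodule.Quotient.mk_surjective _ y
  obtain ⟨k, rfl⟩ := exists_smul_zElt_eq w
  have hv : ¬ ∀ h, (mElt q Q lam * h) • v = 0 := fun h =>
    hx ((Submodule.Quotient.mk_eq_zero _).2 h)
  push Not at hv
  obtain ⟨h, hh⟩ := hv
  rw [hB.mElt_mul_smul] at hh
  set c := B (anti h • zElt q Q lam) v with hc
  have hc0 : c ≠ 0 := fun h0 => hh (by rw [h0, zero_smul])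
  refine ⟨k * (c⁻¹ • (mElt q Q lam * h)), ?_⟩
  rw [LinearMap.toSpanSingleton_apply, ← Submodule.Quotient.mk_smul, mul_smul, smul_assoc,
    hB.mElt_mul_smul, ← hc, smul_smul, inv_mul_cancel₀ hc0, one_smul]

end IsDJMForm

section Sigma

variable (hq : ‖q‖ = 1) (hQ : ∀ k, ‖Q k‖ = 1)

/-- The semilinear map that `σ` induces on `H / N̄^λ`. -/
noncomputable def sigmaModNbar (lam : Multipartition r n) :
    ModNbar q Q lam →ₛₗ[sigma (n := n) hq hQ] ModNbar q Q lam :=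
  Submodule.mapQ _ _
    ({ toFun := sigma hq hQ
       map_add' := map_add _
       map_smul' := map_mul _ } : HeckeAlg n q Q →ₛₗ[sigma hq hQ] HeckeAlg n q Q)
    fun _ hx => TwoSidedIdeal.mem_asIdeal.2 (sigma_mem_Nbar hq hQ (TwoSidedIdeal.mem_asIdeal.1 hx))

theorem sigmaModNbar_toModNbar (x : HeckeAlg n q Q) :
    sigmaModNbar hq hQ lam (toModNbar q Q lam x) = toModNbar q Q lam (sigma hq hQ x) := rfl

theorem sigmaModNbar_mem (v : specht q Q lam) :
    sigmaModNbar hq hQ lam v ∈ specht q Q lam := by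
  obtain ⟨h, rfl⟩ := exists_smul_zElt_eq v
  obtain ⟨g, -, hg⟩ := sigma_mElt hq hQ lam
  rw [coe_smul_zElt, sigmaModNbar_toModNbar, map_mul, hg, ← mul_assoc, ← coe_smul_zElt]
  exact SetLike.coe_mem _

/-- The semilinear map that `σ` induces on the Specht module. -/
noncomputable def sigmaSpecht (lam : Multipartition r n) :
    specht q Q lam →ₛₗ[starRingEnd ℂ] specht q Q lam where
  toFun v := ⟨sigmaModNbar hq hQ lam v, sigmaModNbar_mem hq hQ v⟩
  map_add' v w := Subtype.ext (map_add _ _ _)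
  map_smul' c v := Subtype.ext (by
    change sigmaModNbar hq hQ lam (c • (v : ModNbar q Q lam)) =
      starRingEnd ℂ c • sigmaModNbar hq hQ lam v
    rw [← algebraMap_smul (HeckeAlg n q Q) c, map_smulₛₗ, sigma_algebraMap, algebraMap_smul])

theorem coe_sigmaSpecht (v : specht q Q lam) :
    (sigmaSpecht hq hQ lam v : ModNbar q Q lam) = sigmaModNbar hq hQ lam v := rfl

theorem isInducedSigma_sigmaSpecht : IsInducedSigma hq hQ lam (sigmaSpecht hq hQ lam) :=
  fun x _ => sigmaModNbar_toModNbar hq hQ x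

theorem sigmaSpecht_smul (h : HeckeAlg n q Q) (v : specht q Q lam) :
    sigmaSpecht hq hQ lam (h • v) = sigma hq hQ h • sigmaSpecht hq hQ lam v :=
  Subtype.ext (map_smulₛₗ _ _ _)

theorem sigmaSpecht_sigmaSpecht (v : specht q Q lam) :
    sigmaSpecht hq hQ lam (sigmaSpecht hq hQ lam v) = v := by
  obtain ⟨h, rfl⟩ := exists_smul_zElt_eq v
  refine Subtype.ext ?_
  rw [coe_sigmaSpecht, coe_sigmaSpecht, coe_smul_zElt, sigmaModNbar_toModNbar,
    sigmaModNbar_toModNbar, sigma_sigma]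

/-- The bilinear form is `σ`-semi-invariant up to a phase. -/
theorem IsDJMForm.exists_phase {B : LinearMap.BilinForm ℂ (specht q Q lam)}
    (hB : IsDJMForm q Q lam B) (hD : Nontrivial (dModule q Q lam)) :
    ∃ c : ℂ, ‖c‖ = 1 ∧ ∀ v w, B (sigmaSpecht hq hQ lam v) (sigmaSpecht hq hQ lam w) =
      c * starRingEnd ℂ (B v w) := by
  have hq0 : q ≠ 0 := fun h => by simp [h] at hq
  have hz := zElt_ne_zero hD
  obtain ⟨g, -, hg⟩ := sigma_mElt hq hQ lam
  have hsz : sigmaSpecht hq hQ lam (zElt q Q lam) = g • zElt q Q lam :=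
    Subtype.ext (congrArg (toModNbar q Q lam) hg)
  -- `*` fixes `m_λ` and commutes with `σ`, so `g` can be moved to the other side of `m_λ`.
  have hmg : mElt q Q lam * anti g = sigma hq hQ (mElt q Q lam) := by
    conv_rhs => rw [← anti_mElt hq0, sigma_anti, hg, anti_mul, anti_mElt hq0]
  have h1 : ∀ v w, B (sigmaSpecht hq hQ lam v) (sigmaSpecht hq hQ lam w) • zElt q Q lam =
      starRingEnd ℂ (B v w) • g • zElt q Q lam := by
    intro v w
    obtain ⟨h, rfl⟩ := exists_smul_zElt_eq v
    obtain ⟨k, rfl⟩ := exists_smul_zElt_eq w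
    have h2 := congrArg (sigmaSpecht hq hQ lam) (hB h k)
    rw [sigmaSpecht_smul, LinearMap.map_smulₛₗ, hsz] at h2
    rw [← h2, sigmaSpecht_smul, sigmaSpecht_smul, hsz, smul_smul, smul_smul, smul_smul, ← hB,
      anti_mul, map_mul, map_mul, sigma_anti, ← hmg]
    simp only [mul_assoc]
  -- The form does not vanish identically, since otherwise the radical would be everything. A
  -- non-zero value in `h1` shows that `g` acts on `z_λ` by a scalar.
  obtain ⟨v, w, hvw⟩ : ∃ v w, B v w ≠ 0 := by
    by_contra! h
    obtain ⟨x, hx⟩ := exists_ne (0 : dModule q Q lam)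
    obtain ⟨v, rfl⟩ := Submodule.Quotient.mk_surjective _ x
    exact hx ((Submodule.Quotient.mk_eq_zero _).2 ((hB.mem_djmRad_iff hq0 hz).2 (h v)))
  obtain ⟨c, hc⟩ : ∃ c : ℂ, g • zElt q Q lam = c • zElt q Q lam := by
    have h2 := h1 v w
    have h3 : starRingEnd ℂ (B v w) ≠ 0 := (map_ne_zero _).2 hvw
    exact ⟨(starRingEnd ℂ (B v w))⁻¹ *
      B (sigmaSpecht hq hQ lam v) (sigmaSpecht hq hQ lam w), by
      rw [mul_smul, h2, smul_smul, inv_mul_cancel₀ h3, one_smul]⟩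
  have h4 : ∀ v w, B (sigmaSpecht hq hQ lam v) (sigmaSpecht hq hQ lam w) =
      c * starRingEnd ℂ (B v w) := by
    intro v w
    refine smul_left_injective ℂ hz ?_
    change _ • zElt q Q lam = _ • zElt q Q lam
    rw [h1, hc, smul_smul, mul_comm]
  refine ⟨c, ?_, h4⟩
  -- Applying the relation twice and using `σ² = 1` yields `|c|² = 1`.
  have h5 := h4 (sigmaSpecht hq hQ lam v) (sigmaSpecht hq hQ lam w)
  rw [sigmaSpecht_sigmaSpecht, sigmaSpecht_sigmaSpecht, h4, map_mul, Complex.conj_conj, ← mul_assoc,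
    Complex.mul_conj'] at h5
  have h6 : (‖c‖ : ℂ) ^ 2 = 1 := (mul_eq_right₀ hvw).1 h5.symm
  have h7 : ‖c‖ ^ 2 = 1 := by exact_mod_cast h6
  exact (pow_eq_one_iff_of_nonneg (norm_nonneg c) two_ne_zero).1 h7

end Sigma

/-- A sesquilinear form on the quotient of a module by a submodule, from a bilinear form and
a semilinear map. -/
theorem exists_sesquilin_quotient {H S : Type*} [Ring H] [Algebra ℂ H] [AddCommGroup S]
    [Module H S] [Module ℂ S] [IsScalarTower ℂ H S] (N : Submodule H S)
    (b : S →ₗ[ℂ] S →ₛₗ[starRingEnd ℂ] ℂ) (hl : ∀ v ∈ N, ∀ w, b v w = 0)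
    (hr : ∀ w ∈ N, ∀ v, b v w = 0) :
    ∃ F : (S ⧸ N) →ₗ[ℂ] (S ⧸ N) →ₛₗ[starRingEnd ℂ] ℂ,
      ∀ v w, F (Submodule.Quotient.mk v) (Submodule.Quotient.mk w) = b v w := by
  have hsec := Function.surjInv_eq (Submodule.Quotient.mk_surjective N)
  set sec := Function.surjInv (Submodule.Quotient.mk_surjective N)
  have key : ∀ v w, b (sec (Submodule.Quotient.mk v)) (sec (Submodule.Quotient.mk w)) = b v w := by
    intro v w
    have h1 := hl _ ((Submodule.Quotient.eq N).1 (hsec (Submodule.Quotient.mk v)))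
      (sec (Submodule.Quotient.mk w))
    have h2 := hr _ ((Submodule.Quotient.eq N).1 (hsec (Submodule.Quotient.mk w))) v
    rw [map_sub, LinearMap.sub_apply, sub_eq_zero] at h1
    rw [map_sub, sub_eq_zero] at h2
    rw [h1, h2]
  refine ⟨LinearMap.mk₂'ₛₗ (RingHom.id ℂ) (starRingEnd ℂ) (fun x y => b (sec x) (sec y))
    ?_ ?_ ?_ ?_, key⟩
  all_goals
    intro x y z
  · obtain ⟨x, rfl⟩ := Submodule.Quotient.mk_surjective _ x
    obtain ⟨y, rfl⟩ := Submodule.Quotient.mk_surjective _ y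
    obtain ⟨z, rfl⟩ := Submodule.Quotient.mk_surjective _ z
    rw [← Submodule.Quotient.mk_add, key, key, key, map_add, LinearMap.add_apply]
  · obtain ⟨y, rfl⟩ := Submodule.Quotient.mk_surjective _ y
    obtain ⟨z, rfl⟩ := Submodule.Quotient.mk_surjective _ z
    rw [← Submodule.Quotient.mk_smul, key, key, map_smul, LinearMap.smul_apply, RingHom.id_apply]
  · obtain ⟨x, rfl⟩ := Submodule.Quotient.mk_surjective _ x
    obtain ⟨y, rfl⟩ := Submodule.Quotient.mk_surjective _ y
    obtain ⟨z, rfl⟩ := Submodule.Quotient.mk_surjective _ z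
    rw [← Submodule.Quotient.mk_add, key, key, key, map_add]
  · obtain ⟨y, rfl⟩ := Submodule.Quotient.mk_surjective _ y
    obtain ⟨z, rfl⟩ := Submodule.Quotient.mk_surjective _ z
    rw [← Submodule.Quotient.mk_smul, key, key, map_smulₛₗ]

end Forms

end ArikiKoike

/-! ### The invariant Hermitian form -/

theorem mainTheorem3 {r n : ℕ} (hr : 0 < r) (hn : 0 < n) (q : ℂ) (Q : Fin r → ℂ)
    (hq : ‖q‖ = 1) (hQ : ∀ k, ‖Q k‖ = 1) (lam : ArikiKoike.Multipartition r n)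
    (hD : Nontrivial (ArikiKoike.dModule q Q lam)) :
    IsSimpleModule (ArikiKoike.HeckeAlg n q Q) (ArikiKoike.dModule q Q lam) ∧
    ∃ (B : LinearMap.BilinForm ℂ (ArikiKoike.specht q Q lam))
      (s : ArikiKoike.specht q Q lam →ₛₗ[starRingEnd ℂ] ArikiKoike.specht q Q lam)
      (α : ℂ)
      (F : ArikiKoike.dModule q Q lam →ₗ[ℂ]
        ArikiKoike.dModule q Q lam →ₛₗ[starRingEnd ℂ] ℂ),
      -- the symmetric contravariant bilinear form on the Specht module, and its radical
      ArikiKoike.IsDJMForm q Q lam B ∧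
      (∀ v w, B v w = B w v) ∧
      (∀ (h : ArikiKoike.HeckeAlg n q Q) v w, B (h • v) w = B v (ArikiKoike.anti h • w)) ∧
      (∀ v, v ∈ ArikiKoike.djmRad q Q lam ↔ ∀ w, B v w = 0) ∧
      -- the semilinear involution on the Specht module
      ArikiKoike.IsInducedSigma hq hQ lam s ∧
      (∀ v, s (s v) = v) ∧
      (∀ (h : ArikiKoike.HeckeAlg n q Q) v, s (h • v) = ArikiKoike.sigma hq hQ h • s v) ∧
      -- the Hermitian form is the twisted bilinear form up to a phase
      ‖α‖ = 1 ∧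
      (∀ v w, F (Submodule.Quotient.mk v) (Submodule.Quotient.mk w) = α * B v (s w)) ∧
      (∀ v w, F w v = starRingEnd ℂ (F v w)) ∧
      F.Nondegenerate ∧
      (∀ (h : ArikiKoike.HeckeAlg n q Q) v w,
        F (h • v) w = F v (ArikiKoike.sigma hq hQ (ArikiKoike.anti h) • w)) ∧
      (∀ u ∈ ArikiKoike.braidImage n q Q, ∀ v w,
        F ((u : ArikiKoike.HeckeAlg n q Q) • v) w =
          F v ((↑u⁻¹ : ArikiKoike.HeckeAlg n q Q) • w)) := by
  open ArikiKoike in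
  have hq0 : q ≠ 0 := fun h => by simp [h] at hq
  have hQ0 : ∀ k, Q k ≠ 0 := fun k h => by simpa [h] using hQ k
  have hz := zElt_ne_zero hD
  obtain ⟨B, hB⟩ := exists_isDJMForm hr hq0 hQ0 hz
  obtain ⟨c, hc, hBc⟩ := hB.exists_phase hq hQ hD
  set s := sigmaSpecht hq hQ lam with hs
  have hss : ∀ v, s (s v) = v := sigmaSpecht_sigmaSpecht hq hQ
  have hsh : ∀ (h : HeckeAlg n q Q) v, s (h • v) = sigma hq hQ h • s v := sigmaSpecht_smul hq hQ
  have hc0 : c ≠ 0 := fun h => by simp [h] at hc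
  -- With `α² = c⁻¹` and `|α| = 1` one has `α c = conj α`, which is the condition for the twisted
  -- form to be Hermitian.
  obtain ⟨α, hα⟩ := IsAlgClosed.exists_pow_nat_eq c⁻¹ two_pos
  have hα1 : ‖α‖ = 1 := by
    have h := congrArg norm hα
    rw [norm_pow, norm_inv, hc, _root_.inv_one] at h
    exact (pow_eq_one_iff_of_nonneg (norm_nonneg α) two_ne_zero).1 h
  have hα0 : α ≠ 0 := fun h => by simp [h] at hα1
  have hrad : ∀ v, v ∈ djmRad q Q lam ↔ ∀ w, B v w = 0 := fun v => hB.mem_djmRad_iff hq0 hz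
  have hsymm := hB.symm hq0 hz
  -- Moving `σ` to the other argument shows that the twisted form also vanishes when its second
  -- argument is in the radical, so that it descends to `D^λ`. The same identity gives the Hermitian
  -- symmetry.
  have hsrad : ∀ v w, B v (s w) = c * starRingEnd ℂ (B (s v) w) := fun v w => by
    rw [← hBc, hss]
  obtain ⟨F, hF⟩ := exists_sesquilin_quotient (djmRad q Q lam)
    (LinearMap.mk₂'ₛₗ (RingHom.id ℂ) (starRingEnd ℂ) (fun v w => α * B v (s w))
      (fun v v' w => by rw [map_add, LinearMap.add_apply, mul_add])
      (fun a v w => by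
        simp only [map_smul, LinearMap.smul_apply, smul_eq_mul, RingHom.id_apply]
        ring)
      (fun v w w' => by rw [map_add, map_add, mul_add])
      (fun a v w => by rw [LinearMap.map_smulₛₗ, map_smul, smul_eq_mul, smul_eq_mul]; ring))
    (fun v hv w => by
      change α * B v (s w) = 0
      rw [(hrad v).1 hv, mul_zero])
    (fun w hw v => by
      change α * B v (s w) = 0
      rw [hsrad, hsymm, (hrad w).1 hw, map_zero, mul_zero, mul_zero])
  replace hF : ∀ v w, F (Submodule.Quotient.mk v) (Submodule.Quotient.mk w) = α * B v (s w) := hF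
  have hherm : ∀ v w, F w v = starRingEnd ℂ (F v w) := by
    intro x y
    obtain ⟨v, rfl⟩ := Submodule.Quotient.mk_surjective _ x
    obtain ⟨w, rfl⟩ := Submodule.Quotient.mk_surjective _ y
    have h1 : starRingEnd ℂ α * α = 1 := by
      rw [Complex.conj_mul', hα1]
      norm_num
    have h2 : α * c = starRingEnd ℂ α := by
      refine mul_right_cancel₀ hα0 ?_
      rw [h1, mul_right_comm, ← pow_two, hα, inv_mul_cancel₀ hc0]
    rw [hF, hF, map_mul, hsrad, hsymm (s w) v, ← mul_assoc, h2]
  have hleft : F.SeparatingLeft := by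
    intro x hx
    obtain ⟨v, rfl⟩ := Submodule.Quotient.mk_surjective _ x
    refine (Submodule.Quotient.mk_eq_zero _).2 ((hrad v).2 fun w => ?_)
    have h := hx (Submodule.Quotient.mk (s w))
    rw [hF, hss] at h
    exact (mul_eq_zero.1 h).resolve_left hα0
  have hinv : ∀ (h : HeckeAlg n q Q) v w,
      F (h • v) w = F v (sigma hq hQ (anti h) • w) := by
    intro h x y
    obtain ⟨v, rfl⟩ := Submodule.Quotient.mk_surjective _ x
    obtain ⟨w, rfl⟩ := Submodule.Quotient.mk_surjective _ y
    rw [← Submodule.Quotient.mk_smul, ← Submodule.Quotient.mk_smul, hF, hF, hsh, sigma_sigma,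
      hB.smul_left hz]
  refine ⟨hB.isSimpleModule hD, B, s, α, F, hB, hsymm, hB.smul_left hz, hrad,
    isInducedSigma_sigmaSpecht hq hQ, hss, hsh, hα1, hF, hherm,
    ⟨hleft, fun y hy => hleft y fun x => ?_⟩, hinv, fun u hu v w => ?_⟩
  · rw [hherm, hy, map_zero]
  · rw [hinv, sigma_anti_of_mem_braidImage hq hQ hu]
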